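/- **Setting.** Let $X$ be a reduced algebraic variety over a field $K$ of characteristic zero (not necessarily equidimensional), with irreducible components $X^{(1)},\dots,X^{(m)}$ in a fixed order, $m\ge 2$. A $\mathbb{Q}$-Weil divisor on $X$ is a finite $\mathbb{Q}$-linear combination of irreducible subvarieties of $X$, each of codimension one in every $X^{(i)}$ that contains it. Let $D$ be a $\mathbb{Q}$-Weil divisor on $X$, and let $E=\sum a_kH_k$ be an ordered snc divisor on $X$: the $H_k$ are closed subschemes whose cycles are Weil divisors on $X$ and, at every closed point, some local embedding of $X$ in a smooth variety has a regular system of coordinates in which the $H_k$ through the point are the restrictions to $X$ of distinct coordinate hypersurfaces; $\operatorname{Supp}E=\bigcup_k H_k$. All points $a$ below are closed. **Definitions.** $(X,D)$ is *stable-snc at* $a$ if some neighbourhood of $a$ in $X$ embeds in a smooth variety $Z$ with regular coordinates $(x_1,\dots,x_p,y_1,\dots,y_q,z_1,\dots,z_r,w_1,\dots,w_s)$ at $a$ such that each component $X^{(i)}$ through $a$ is $(\{x_k=0\}_{k\in I_i},\ z_1=\dots=z_r=0)$, where the $I_i$ form a partition of $\{1,\dots,p\}$, and $D=\sum_j\alpha_j\,(y_j=0)|_X$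 near $a$, with $\alpha_j\in\mathbb{Q}$. The triple $(X,D,E)$ is stable-snc at $a$ if $(X,D+E)$ is. If $X=Y\cup T$, where $Y,T$ are closed subvarieties without common components, and $D'$ is a Weil divisor on $Y$, the $4$-tuple $(Y,D',E,T)$ is stable-snc at $a$ if there is a $\mathbb{Q}$-Weil divisor $D_T$ on $T$ such that $(X,D'+D_T,E)$ is stable-snc at $a$. Put $X^{m-1}=X^{(1)}\cup\dots\cup X^{(m-1)}$, let $D_i$ be the sum (with coefficients) of the components of $D$ lying in $X^{(i)}$, and put $D^{m-1}=D_1+\dots+D_{m-1}$. For $\Omega=(e,c_1,\dots,c_n)$ with $c_1\ge\dots\ge c_n\ge0$, and $q\in\mathbb{N}$, let $\Sigma_{\Omega,q}$ be the set of $a\in X^{(m)}$ such that: there are precisely $n$ components $X^{(i_1)},\dots,X^{(i_n)}$ of $X$ that are equal to $X^{(m)}$ or contain a component of $D$ through $a$; $e$ is the minimal embedding dimension of $\bigcup_jX^{(i_j)}$ at $a$; $c_1,\dots,c_n$ are (in a suitable order of the components) the codimensions of the $X^{(i_j)}$ in a minimal embedding variety of this union at $a$; and $q$ is the minimum number of components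 of $D$ at $a$ lying in any one of the $X^{(i_j)}$. The Hilbert–Samuel function of a Noetherian local ring $(A,\mathfrak m)$ is $k\mapsto\operatorname{length}(A/\mathfrak m^{k+1})$. If $|c|=\sum c_i$ and $|c|+q\le e$, let $H_{\Omega,q}$ be the Hilbert–Samuel function of $$K[[x_{1,1},\dots,x_{n,c_n},y_1,\dots,y_{e-|c|}]]\Big/\bigcap_{i=1}^n(x_{i,1},\dots,x_{i,c_i},\,y_1\cdots y_q).$$ Let $J=\bigcap_{1\le i,j\le m}[I_{D_i}+I_{X^{(j)}}:I_{D_j}+I_{X^{(i)}}]\subseteq\mathcal O_X$, where $I_{D_i}$ and $I_{X^{(i)}}$ denote the ideal sheaves of $\operatorname{Supp}D_i$ and $X^{(i)}$. **Proposition.** Let $a\in X^{m-1}\cap X^{(m)}$ be a closed point. 1. Suppose that $(X,E)$ is stable-snc at $a$ and that no component of $D$ through $a$ lies in $\operatorname{Supp}E$. Then $(X,D,E)$ is stable-snc at $a$ if and only if both the $4$-tuple $(X^{m-1},D^{m-1},E,X^{(m)})$ and the pair $(X,D)$ are stable-snc at $a$. 2. Suppose that $D$ is reduced, that no component of $D$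 lies in $\operatorname{Sing}X$, and that $a$ lies on a component of $D$ contained in $X^{(m)}$ and on a component of $D$ contained in $X^{(i)}$, for some $i\ne m$. Then $(X,D)$ is stable-snc at $a$ if and only if (a) the $4$-tuple $(X^{m-1},D^{m-1},0,X^{(m)})$ is stable-snc at $a$; (b) there are $\Omega=(e,c_1,\dots,c_n)$ and $q$ with $|c|+q\le e$ such that $a\in\Sigma_{\Omega,q}$ and the Hilbert–Samuel function of $\mathcal O_{\operatorname{Supp}D,a}$ equals $H_{\Omega,q}$; and (c) $J_a=\mathcal O_{X,a}$. -/

import Mathlib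

open AlgebraicGeometry CategoryTheory IsLocalRing

universe u

namespace StableSnc

noncomputable section

/-! ### Germs of subvarieties and Hilbert-Samuel functions -/

/-- The ideal, in the local ring of `X` at `x`, of the closed subset `S` with its reduced
structure: the intersection of the primes of the local ring given by the points of `S` that
specialize to `x`. It is the unit ideal if `S` is closed and does not contain `x`. -/
def idealAt {X : Scheme.{u}} (S : Set X) (x : X) : Ideal (X.presheaf.stalk x) :=
  ⨅ (η : X) (_ : η ∈ S) (h : η ⤳ x),
    (maximalIdeal (X.presheaf.stalk η)).comap (X.presheaf.stalkSpecializes h).hom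

/-- The stalk at `x` of a (quasi-coherent) ideal sheaf. -/
def stalkIdeal {X : Scheme.{u}} (I : X.IdealSheafData) (x : X) : Ideal (X.presheaf.stalk x) :=
  ⨆ (V : X.affineOpens) (h : x ∈ V.1), (I.ideal V).map (X.presheaf.germ V.1 x h).hom

/-- The Hilbert-Samuel function `k ↦ length (B / 𝔪_B ^ (k + 1))` of the local ring
`B = A ⧸ I`; note that `B / 𝔪_B ^ (k + 1) = A / (I + 𝔪_A ^ (k + 1))`. -/
def hilbertSamuel {A : Type*} [CommRing A] [IsLocalRing A] (I : Ideal A) (k : ℕ) : ℕ∞ :=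
  Module.length A (A ⧸ (I ⊔ maximalIdeal A ^ (k + 1)))

/-- The embedding dimension of the local ring `A ⧸ I`: the minimal number of generators of its
maximal ideal. -/
def embDim {A : Type*} [CommRing A] [IsLocalRing A] (I : Ideal A) : ℕ :=
  ((maximalIdeal A).map (Ideal.Quotient.mk I)).spanFinrank

/-- A regular system of coordinates (parameters) of a local ring. -/
def IsRegularSystem {R : Type*} [CommRing R] [IsLocalRing R] {σ : Type*} [Fintype σ]
    (t : σ → R) : Prop :=
  Ideal.span (Set.range t) = maximalIdeal R ∧ ringKrullDim R = (Fintype.card σ : ℕ)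

/-! ### Weil divisors

A `ℚ`-Weil divisor on `X` is a function `D : X → ℚ` of finite support: the value at `η` is the
coefficient of the prime divisor `closure {η}`. -/

/-- The support of a divisor. -/
def supp {X : Scheme.{u}} (D : X → ℚ) : Set X := ⋃ η ∈ {η : X | D η ≠ 0}, closure {η}

/-- `D` is a `ℚ`-Weil divisor on the closed subset `T` of `X`, where `T` is a union of irreducible
components of `X`: a finite linear combination of irreducible subvarieties of `T`, each of
codimension one in every irreducible component of `T` that contains it. -/
def IsWeilDivisorOn {X : Scheme.{u}} (T : Set X) (D : X → ℚ) : Prop :=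
  {η : X | D η ≠ 0}.Finite ∧
  ∀ η : X, D η ≠ 0 → η ∈ T ∧
    ∀ C ∈ irreducibleComponents X, C ⊆ T → η ∈ C →
      ringKrullDim (X.presheaf.stalk η ⧸ idealAt C η) = 1

/-- The sum of the components of `D` that lie in the closed subset `T`, with their
coefficients. -/
def part {X : Scheme.{u}} (T : Set X) (D : X → ℚ) : X → ℚ := T.indicator D

/-- The prime divisor coefficients of the closed subscheme defined by `I`: the coefficient of
`closure {η}` is the length of the local ring of the subscheme at `η`, if `η` is the generic
point of an irreducible component of the subscheme, and zero otherwise (the length is then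
zero or infinite). -/
def cycle {X : Scheme.{u}} (I : X.IdealSheafData) (η : X) : ℚ :=
  ((Module.length (X.presheaf.stalk η) (X.presheaf.stalk η ⧸ stalkIdeal I η)).toNat : ℚ)

/-! ### Local embeddings and stable simple normal crossings -/

/-- A local embedding of the `K`-variety `X` at the point `a` in a smooth variety `Z`: a closed
embedding over `K` of an open neighbourhood `U` of `a` in `Z`. -/
structure LocalEmbedding {K : Type u} [Field K] {X : Scheme.{u}}
    (f : X ⟶ Spec (.of K)) (a : X) where
  U : X.Opens
  mem : a ∈ U
  Z : Scheme.{u}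
  g : Z ⟶ Spec (.of K)
  smooth : Smooth g
  i : U.toScheme ⟶ Z
  closedImmersion : IsClosedImmersion i
  comm : i ≫ g = U.ι ≫ f

namespace LocalEmbedding

variable {K : Type u} [Field K] {X : Scheme.{u}} {f : X ⟶ Spec (.of K)} {a : X}

/-- The image of `a` in `Z`. -/
def pt (L : LocalEmbedding f a) : L.Z := L.i ⟨a, L.mem⟩

/-- The local ring of `Z` at the image of `a`. -/
abbrev ring (L : LocalEmbedding f a) : Type u := L.Z.presheaf.stalk L.pt

/-- Restriction of germs of functions from `Z` to `X`. -/
def restr (L : LocalEmbedding f a) : L.ring →+* X.presheaf.stalk a :=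
  (L.i.stalkMap ⟨a, L.mem⟩ ≫ (L.U.stalkIso ⟨a, L.mem⟩).hom).hom

end LocalEmbedding

/-- `(X, D)` is stable-snc at `a`: there are a local embedding in a smooth variety `Z` and regular
coordinates `x, y, z, w` of `Z` at `a` such that every irreducible component of `X` at `a` is
`(x_k = 0 for k in its block, z = 0)`, the blocks being a partition of the set of indices of the
`x_k`, and `D = ∑ α_j (y_j = 0)|_X` near `a`. Here `(y_j = 0)|_X` is the sum of the prime divisors
`(y_j = 0) ∩ C`, for `C` an irreducible component of `X` at `a`, and `blk k` is the component whose
block contains `k`. -/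
def StableSncAt {K : Type u} [Field K] {X : Scheme.{u}} (f : X ⟶ Spec (.of K))
    (D : X → ℚ) (a : X) : Prop :=
  ∃ (L : LocalEmbedding f a) (p q r s : ℕ)
    (x : Fin p → L.ring) (y : Fin q → L.ring) (z : Fin r → L.ring) (w : Fin s → L.ring)
    (blk : Fin p → Set X) (α : Fin q → ℚ),
    IsRegularSystem (Sum.elim x (Sum.elim y (Sum.elim z w))) ∧
    (∀ k, blk k ∈ irreducibleComponents X ∧ a ∈ blk k) ∧
    (∀ C ∈ irreducibleComponents X, a ∈ C →
      (idealAt C a).comap L.restr = Ideal.span (x '' {k | blk k = C} ∪ Set.range z)) ∧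
    ∀ η : X, η ⤳ a → D η = ∑ j, α j * Set.indicator
      {ζ : X | ∃ C ∈ irreducibleComponents X, a ∈ C ∧
        (idealAt (closure {ζ}) a).comap L.restr =
          Ideal.span (x '' {k | blk k = C} ∪ Set.range z ∪ {y j})} 1 η

/-- An ordered snc divisor `E = ∑ a_k H_k` on `X`: the `H_k` are closed subschemes and `E` is
locally, at each closed point, the restriction to `X` of an snc divisor on a smooth local embedding
variety, i.e. the `H_k` through the point are the restrictions of distinct coordinate
hypersurfaces. It is assumed that the `H_k` are Weil divisors. -/
structure OrderedSncDivisor {K : Type u} [Field K] {X : Scheme.{u}}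
    (f : X ⟶ Spec (.of K)) where
  len : ℕ
  H : Fin len → X.IdealSheafData
  coeff : Fin len → ℚ
  snc : ∀ a : X, IsClosed ({a} : Set X) →
    ∃ (L : LocalEmbedding f a) (N : ℕ) (t : Fin N → L.ring) (τ : Fin len → Fin N),
      IsRegularSystem t ∧ Set.InjOn τ {k | a ∈ (H k).support} ∧
      ∀ k, a ∈ (H k).support → stalkIdeal (H k) a = Ideal.span {L.restr (t (τ k))}
  weil : ∀ k, IsWeilDivisorOn Set.univ (cycle (H k))

namespace OrderedSncDivisor

variable {K : Type u} [Field K] {X : Scheme.{u}} {f : X ⟶ Spec (.of K)}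

/-- The support of `E`: the union of all `H_k`. -/
def support (E : OrderedSncDivisor f) : Set X := ⋃ k, (E.H k).support

/-- The `ℚ`-Weil divisor `∑ a_k H_k`. -/
def toDivisor (E : OrderedSncDivisor f) : X → ℚ := fun η => ∑ k, E.coeff k * cycle (E.H k) η

end OrderedSncDivisor

/-- The triple `(X, D, E)` is stable-snc at `a` if `(X, D + E)` is. -/
def TripleStableSncAt {K : Type u} [Field K] {X : Scheme.{u}} (f : X ⟶ Spec (.of K))
    (D E : X → ℚ) (a : X) : Prop :=
  StableSncAt f (D + E) a

/-- The `4`-tuple `(Y, D, E, T)` is stable-snc at `a`, where `X = Y ∪ T` is a decomposition into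
closed subvarieties without common components and `D` is a Weil divisor on `Y`: there is a Weil
divisor `D_T` on `T` such that `(X, D + D_T, E)` is stable-snc at `a`. -/
def FourTupleStableSncAt {K : Type u} [Field K] {X : Scheme.{u}} (f : X ⟶ Spec (.of K))
    (Y : Set X) (D E : X → ℚ) (T : Set X) (a : X) : Prop :=
  Y ∪ T = Set.univ ∧ IsWeilDivisorOn Y D ∧
    ∃ DT : X → ℚ, IsWeilDivisorOn T DT ∧ TripleStableSncAt f (D + DT) E a

/-- The singular locus. -/
def singLocus (X : Scheme.{u}) : Set X := {x | ¬ IsRegularLocalRing (X.presheaf.stalk x)}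

/-! ### Ordered components

The irreducible components of `X` are `C 0, …, C n`, so `C (Fin.last n)` is the last one. -/

/-- The union of all components but the last. -/
def initUnion {X : Scheme.{u}} {n : ℕ} (C : Fin (n + 1) → Set X) : Set X :=
  ⋃ i : Fin n, C i.castSucc

/-- The sum of the `D_i` for all components but the last, where `D_i` is the sum of all components
of `D` that lie in the `i`-th component of `X`. -/
def initDivisor {X : Scheme.{u}} {n : ℕ} (C : Fin (n + 1) → Set X) (D : X → ℚ) : X → ℚ :=
  ∑ i : Fin n, part (C i.castSucc) D

/-- The indices of the components `C i` of `X` such that `i` is last, or `C i` contains a component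
of `D` through `a`. -/
def relevant {X : Scheme.{u}} {n : ℕ} (C : Fin (n + 1) → Set X) (D : X → ℚ) (a : X) :
    Set (Fin (n + 1)) :=
  {i | i = Fin.last n ∨ ∃ η : X, η ⤳ a ∧ D η ≠ 0 ∧ η ∈ C i}

/-- `a` belongs to the stratum `Σ_{Ω,q}` with `Ω = (e, c)`, `c = (c_1 ≥ … ≥ c_N)`: it lies in the
last component, there are precisely `N` relevant components, `e` is the minimal embedding dimension
of their union at `a`, the `c_j` are their codimensions in a minimal embedding variety
of their union at `a`, and `q` is the minimum number of components of `D` at `a` in any one of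
them. -/
def MemStratum {X : Scheme.{u}} {n : ℕ} (C : Fin (n + 1) → Set X) (D : X → ℚ)
    (e : ℕ) {N : ℕ} (c : Fin N → ℕ) (q : ℕ) (a : X) : Prop :=
  a ∈ C (Fin.last n) ∧ Antitone c ∧
  (∃ φ : Fin N ≃ relevant C D a, ∀ j,
    ringKrullDim (X.presheaf.stalk a ⧸ idealAt (C (φ j)) a) + (c j : ℕ) = (e : ℕ)) ∧
  e = embDim (idealAt (⋃ i ∈ relevant C D a, C i) a) ∧
  IsLeast ((fun i => {η : X | η ⤳ a ∧ D η ≠ 0 ∧ η ∈ C i}.ncard) '' relevant C D a) q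

/-- For `|c| + q ≤ e`, the ideal `⋂ i, (x_{i,1}, …, x_{i,c_i}, y_1 ⋯ y_q)` in the ring of formal
power series over `K` in the `x_{i,j}` and `y_1, …, y_{e - |c|}`. -/
def modelIdeal (K : Type u) [Field K] (e : ℕ) {N : ℕ} (c : Fin N → ℕ) (q : ℕ) :
    Ideal (MvPowerSeries ((Σ i : Fin N, Fin (c i)) ⊕ Fin (e - ∑ i, c i)) K) :=
  ⨅ i : Fin N, Ideal.span
    (Set.range (fun j : Fin (c i) => MvPowerSeries.X (Sum.inl ⟨i, j⟩)) ∪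
      {∏ l ∈ Finset.univ.filter (fun l : Fin (e - ∑ i, c i) => l.val < q),
        MvPowerSeries.X (Sum.inr l)})

/-- The stalk at `a` of the obstruction ideal `J(X, D)`, the intersection over all `i, j` of the
ideal quotients `[I_{D_i} + I_{C_j} : I_{D_j} + I_{C_i}]`. (Sums, finite intersections and
quotients of coherent ideal sheaves are computed stalkwise.) -/
def obstructionIdeal {X : Scheme.{u}} {n : ℕ} (C : Fin (n + 1) → Set X) (D : X → ℚ) (a : X) :
    Ideal (X.presheaf.stalk a) :=
  ⨅ (i : Fin (n + 1)) (j : Fin (n + 1)),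
    (idealAt (supp (part (C i) D)) a ⊔ idealAt (C j) a).colon
      ((idealAt (supp (part (C j) D)) a ⊔ idealAt (C i) a : Ideal (X.presheaf.stalk a)) :
        Set (X.presheaf.stalk a))

end

end StableSnc

namespace StableSnc

/-! ### Evaluation of homogeneous polynomials -/

section Polynomial

variable {A : Type*} [CommRing A] {σ : Type*}

/-! Everything takes place in the local ring `O` of `X` at `a`. Stable-snc coordinates, after
division by the coordinates vanishing on all components, present `O` as a quotient of a regular
local ring in which the component ideals are generated by disjoint blocks of coordinates
(`IsSncChart`). Let `S` be the sum of the component ideals. Elements of `O` lift to coordinates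
complementary to the blocks exactly when they are linearly independent modulo `m^2 + S`
(`IndepMod`). Hence, once `X` itself is stable-snc, the condition on `D` becomes coordinate free:
`D` has equations that are independent in this sense, each with one coefficient on all components
(`IsSncDivisor`). Moreover, the branch of such an equation on a single component determines the
equation modulo `S` up to a unit, and independence depends on nothing more.

For the first equivalence, suppose that `D` and `E` are separately stable-snc and that the 4-tuple
provides an snc divisor with equations `g`. On a component other than the last, this divisor is `D +
E`, so the equations of `D` and of `E` are associated modulo `S` to distinct members of `g`.
Together they are therefore independent, and `D + E` is stable-snc (`StableSncAt.add_of_fourTuple`).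
In the other direction the essential point is that `D` can be separated from `E`
(`StableSncAt.of_add`).

For the second equivalence, necessity is a computation in coordinates. For sufficiency, the 4-tuple
gives equations `v` of `D` on the components other than the last. On the last component, a regular
local ring and hence factorial, each branch has an equation `g_j`. The condition on `J` says that `∏
v` and `∏ g` have the same trace on the intersection of the last component with each other one. Two
steps then conclude. The numbers of equations agree (`IsSncChart.card_eq_of_hilbertSamuel`): too
many `g_j` contradict the equality of traces, and too few make the Hilbert-Samuel function too large
(`hilbertSamuel_lt`). With equal numbers, the `g_j` and `v_l` are matched up to units on the
intersections, and distributivity of monomial ideals glues each pair to one equation valid on all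
components (`IsSncChart.exists_matching`).

The algebra rests on expanding elements of a regular local ring over the rationals as power series
over its residue field (`exists_toPowerSeries`). Membership in a monomial ideal is then a condition
on coefficients (`exists_mem_mono_iff`), which gives intersections, lengths and Hilbert-Samuel
functions by counting exponents. Factoriality is proved for power series by Weierstrass preparation
and descends through ideal quotients (`IsRegularSystem.irreducible_iff_prime`). -/

lemma ringHom_eval {B : Type*} [CommRing B] (f : A →+* B) (v : σ → A) (F : MvPolynomial σ A) :
    f (MvPolynomial.eval v F) = MvPolynomial.eval (f ∘ v) (MvPolynomial.map f F) := by
  rw [MvPolynomial.eval_map]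
  exact MvPolynomial.eval₂_comp_left f (RingHom.id A) v F

lemma eval_sub_eval_mem {J : Ideal A} {u v : σ → A} (h : ∀ k, u k - v k ∈ J)
    (F : MvPolynomial σ A) : MvPolynomial.eval u F - MvPolynomial.eval v F ∈ J := by
  rw [← Ideal.Quotient.eq_zero_iff_mem, map_sub, sub_eq_zero, ringHom_eval, ringHom_eval]
  congr 2
  funext k
  exact Ideal.Quotient.eq.2 (h k)

lemma degree_eq_of_isHomogeneous {F : MvPolynomial σ A} {j : ℕ} (hF : F.IsHomogeneous j)
    {d : σ →₀ ℕ} (hd : d ∈ F.support) : d.degree = j := by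
  rw [← hF (MvPolynomial.mem_support_iff.1 hd), Finsupp.degree_eq_weight_one]
  rfl

lemma eval_mul_of_isHomogeneous [Fintype σ] {F : MvPolynomial σ A} {j : ℕ}
    (hF : F.IsHomogeneous j) (c : A) (v : σ → A) :
    MvPolynomial.eval (fun k => c * v k) F = c ^ j * MvPolynomial.eval v F := by
  rw [MvPolynomial.eval_eq', MvPolynomial.eval_eq', Finset.mul_sum]
  refine Finset.sum_congr rfl fun d hd => ?_
  have hsum : ∑ i, d i = j := by
    rw [← degree_eq_of_isHomogeneous hF hd, Finsupp.degree_eq_sum]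
  simp only [mul_pow, Finset.prod_mul_distrib, Finset.prod_pow_eq_pow_sum, hsum]
  ring

lemma sup_pow_le (I J : Ideal A) (n : ℕ) : (I ⊔ J) ^ n ≤ I ⊔ J ^ n := by
  induction n with
  | zero => simp
  | succ n ih =>
    calc (I ⊔ J) ^ (n + 1) = (I ⊔ J) ^ n * (I ⊔ J) := pow_succ _ _
      _ ≤ (I ⊔ J ^ n) * (I ⊔ J) := Ideal.mul_mono ih le_rfl
      _ = I * (I ⊔ J) ⊔ (J ^ n * I ⊔ J ^ n * J) := by rw [Ideal.sup_mul, Ideal.mul_sup (J ^ n)]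
      _ ≤ I ⊔ J ^ (n + 1) := by
        have h1 : I * (I ⊔ J) ≤ I := Ideal.mul_le_left
        have h2 : J ^ n * I ≤ I := Ideal.mul_le_right
        rw [← pow_succ]
        exact sup_le (h1.trans le_sup_left) (sup_le (h2.trans le_sup_left) le_sup_right)

end Polynomial

/-! ### Quasi-regularity, by restriction to a general line -/

section RegularSystem

variable {R : Type*} [CommRing R] [IsLocalRing R] {σ : Type*} [Fintype σ] {t : σ → R}

lemma IsRegularSystem.mem_maximalIdeal (ht : IsRegularSystem t) (i : σ) :
    t i ∈ maximalIdeal R :=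
  ht.1 ▸ Ideal.subset_span ⟨i, rfl⟩

/-- An ideal with fewer generators than the dimension does not contain a power of the maximal
ideal. -/
lemma not_pow_maximalIdeal_le_span [IsNoetherianRing R] {S : Finset R}
    (hS : (S.card : WithBot ℕ∞) < ringKrullDim R) (hm : ∀ x ∈ S, x ∈ maximalIdeal R) (n : ℕ) :
    ¬ maximalIdeal R ^ n ≤ Ideal.span (S : Set R) := by
  intro h
  have hle : Ideal.span (S : Set R) ≤ maximalIdeal R := Ideal.span_le.2 hm
  have hmin : maximalIdeal R ∈ (Ideal.span (S : Set R)).minimalPrimes := by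
    refine ⟨⟨inferInstance, hle⟩, fun p hp _ => ?_⟩
    have := hp.1
    exact Ideal.IsPrime.le_of_pow_le (h.trans hp.2)
  have h1 := Ideal.height_le_card_of_mem_minimalPrimes_span_finset hmin
  have h2 : ((maximalIdeal R).height : WithBot ℕ∞) = ringKrullDim R :=
    IsLocalRing.maximalIdeal_height_eq_ringKrullDim
  rw [← h2] at hS
  have h3 : ((S.card : ℕ∞) : WithBot ℕ∞) < (maximalIdeal R).height := by exact_mod_cast hS
  exact absurd h1 (not_le.2 (WithBot.coe_lt_coe.1 h3))

/-- The linear change of coordinates that makes the line through `a` the last axis. -/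
def lineCoord [DecidableEq σ] (t a : σ → R) (i k : σ) : R :=
  if k = i then t i else a i * t k - a k * t i

lemma isRegularSystem_lineCoord [DecidableEq σ] (ht : IsRegularSystem t) {a : σ → R} {i : σ}
    (ha : IsUnit (a i)) : IsRegularSystem (lineCoord t a i) := by
  refine ⟨le_antisymm (Ideal.span_le.2 ?_) ?_, ht.2⟩
  · rintro _ ⟨k, rfl⟩
    simp only [lineCoord, SetLike.mem_coe]
    split_ifs
    · exact ht.mem_maximalIdeal i
    · exact sub_mem (Ideal.mul_mem_left _ _ (ht.mem_maximalIdeal k))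
        (Ideal.mul_mem_left _ _ (ht.mem_maximalIdeal i))
  · rw [← ht.1, Ideal.span_le]
    rintro _ ⟨k, rfl⟩
    have hi : t i ∈ Ideal.span (Set.range (lineCoord t a i)) :=
      Ideal.subset_span ⟨i, by simp [lineCoord]⟩
    by_cases hk : k = i
    · exact hk ▸ hi
    · have h1 : lineCoord t a i k ∈ Ideal.span (Set.range (lineCoord t a i)) :=
        Ideal.subset_span ⟨k, rfl⟩
      rw [lineCoord, if_neg hk] at h1
      have h2 := add_mem h1 (Ideal.mul_mem_left _ (a k) hi)
      rw [sub_add_cancel] at h2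
      exact (Ideal.unit_mul_mem_iff_mem _ ha).1 h2

/-- The forms of degree `j` that do not vanish at `a` modulo the maximal ideal are not in the ideal
of the line through `a`, up to terms of higher order. -/
lemma eval_notMem_line [IsNoetherianRing R] [DecidableEq σ] (ht : IsRegularSystem t) {a : σ → R}
    {i : σ} (ha : IsUnit (a i)) {F : MvPolynomial σ R} {j : ℕ} (hF : F.IsHomogeneous j)
    (hFa : IsUnit (MvPolynomial.eval a F)) :
    MvPolynomial.eval t F ∉
      Ideal.span (lineCoord t a i '' {k | k ≠ i}) ⊔ maximalIdeal R ^ (j + 1) := by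
  set J := Ideal.span (lineCoord t a i '' {k | k ≠ i}) with hJ
  intro h
  have ht' := isRegularSystem_lineCoord ht ha
  have hm : maximalIdeal R ≤ J ⊔ Ideal.span {t i} := by
    rw [← ht'.1, Ideal.span_le]
    rintro _ ⟨k, rfl⟩
    by_cases hk : k = i
    · exact Ideal.mem_sup_right (Ideal.subset_span (by simp [lineCoord, hk]))
    · exact Ideal.mem_sup_left (Ideal.subset_span ⟨k, hk, rfl⟩)
  have hpow : ∀ n, maximalIdeal R ^ n ≤ J ⊔ Ideal.span {t i ^ n} := by
    intro n
    refine (Ideal.pow_right_mono hm n).trans ?_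
    rw [← Ideal.span_singleton_pow]
    exact sup_pow_le J _ n
  -- Modulo the ideal of the line, `a i * t k` and `a k * t i` agree, so homogeneity exchanges the
  -- values of `F` at `t` and at `a`.
  have hev : (a i) ^ j * MvPolynomial.eval t F - t i ^ j * MvPolynomial.eval a F ∈ J := by
    rw [← eval_mul_of_isHomogeneous hF, ← eval_mul_of_isHomogeneous hF]
    refine eval_sub_eval_mem (fun k => ?_) F
    by_cases hk : k = i
    · subst hk; simp [mul_comm]
    · refine Ideal.subset_span ⟨k, hk, ?_⟩
      simp only [lineCoord, if_neg hk]; ring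
  have h1 : t i ^ j * MvPolynomial.eval a F ∈ J ⊔ Ideal.span {t i ^ (j + 1)} := by
    have h2 := Ideal.mul_mem_left _ (a i ^ j) ((sup_le le_sup_left (hpow (j + 1)) : _ ≤ _) h)
    have h3 := sub_mem h2 (Ideal.mem_sup_left hev)
    simpa using h3
  have h2 : t i ^ j ∈ J ⊔ Ideal.span {t i ^ (j + 1)} := (Ideal.mul_unit_mem_iff_mem _ hFa).1 h1
  have h3 : t i ^ j ∈ J := by
    obtain ⟨x, hx, y, hy, hxy⟩ := Submodule.mem_sup.1 h2
    obtain ⟨r, rfl⟩ := Ideal.mem_span_singleton'.1 hy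
    have hu : IsUnit (1 - r * t i) := by
      by_contra hu
      have h4 := add_mem ((mem_maximalIdeal _).2 hu)
        (Ideal.mul_mem_left _ r (ht.mem_maximalIdeal i))
      rw [sub_add_cancel] at h4
      exact (mem_maximalIdeal _).1 h4 isUnit_one
    refine (Ideal.mul_unit_mem_iff_mem _ hu).1 ?_
    have : t i ^ j * (1 - r * t i) = x := by linear_combination -hxy
    rwa [this]
  -- `J` has one generator fewer than the dimension, so by Krull's height theorem it cannot contain
  -- a power of the maximal ideal.
  have hle : maximalIdeal R ^ j ≤ J :=
    (hpow j).trans (sup_le le_rfl ((Ideal.span_singleton_le_iff_mem _).2 h3))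
  classical
  have hJ' : J =
      Ideal.span (((Finset.univ.erase i).image (lineCoord t a i) : Finset R) : Set R) := by
    rw [hJ]; congr 1; ext; simp
  rw [hJ'] at hle
  refine not_pow_maximalIdeal_le_span ?_ ?_ j hle
  · rw [ht.2]
    have h5 : ((Finset.univ.erase i).image (lineCoord t a i)).card < Fintype.card σ :=
      Finset.card_image_le.trans_lt (Finset.card_lt_card (Finset.erase_ssubset (Finset.mem_univ i)))
    exact_mod_cast h5
  · intro x hx
    obtain ⟨k, -, rfl⟩ := Finset.mem_image.1 hx
    exact ht'.mem_maximalIdeal k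

variable [Algebra ℚ R]

/-- Makes the residue field infinite, so that a nonzero form over it has a point where it does not
vanish. -/
instance charZero_residueField : CharZero (ResidueField R) :=
  charZero_of_injective_algebraMap (algebraMap ℚ (ResidueField R)).injective

/-- If a form of degree `j` in the coordinates is nonzero modulo the maximal ideal, then its value
is nonzero modulo the power `j + 1` of the maximal ideal, even after restriction to a line. -/
lemma exists_line_of_map_residue_ne_zero [IsNoetherianRing R] [DecidableEq σ]
    (ht : IsRegularSystem t)
    {F : MvPolynomial σ R} {j : ℕ} (hj : j ≠ 0) (hF : F.IsHomogeneous j)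
    (hF0 : MvPolynomial.map (residue R) F ≠ 0) :
    ∃ (a : σ → R) (i : σ), IsUnit (a i) ∧ MvPolynomial.eval t F ∉
      Ideal.span (lineCoord t a i '' {k | k ≠ i}) ⊔ maximalIdeal R ^ (j + 1) := by
  obtain ⟨c, hc⟩ : ∃ c, MvPolynomial.eval c (MvPolynomial.map (residue R) F) ≠ 0 := by
    by_contra! h
    exact hF0 (MvPolynomial.funext fun c => by simpa using h c)
  choose a ha using fun k => residue_surjective (c k)
  have hca : residue R (MvPolynomial.eval a F) =
      MvPolynomial.eval c (MvPolynomial.map (residue R) F) := by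
    rw [ringHom_eval]
    congr 2
    funext k; exact ha k
  obtain ⟨i, hi⟩ : ∃ i, c i ≠ 0 := by
    by_contra! h
    have : c = fun k => 0 * c k := by funext k; simp [h k]
    rw [this, eval_mul_of_isHomogeneous (hF.map _), zero_pow hj, zero_mul] at hc
    exact hc rfl
  have hunit : ∀ r : R, residue R r ≠ 0 → IsUnit r := fun r hr => by
    rwa [Ne, residue_eq_zero_iff, mem_maximalIdeal, mem_nonunits_iff, not_not] at hr
  have hai : IsUnit (a i) := hunit _ (by rwa [ha])
  exact ⟨a, i, hai, eval_notMem_line ht hai hF (hunit _ (by rwa [hca]))⟩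

/-- A regular system of coordinates is quasi-regular. -/
lemma map_residue_eq_zero [IsNoetherianRing R] (ht : IsRegularSystem t)
    {F : MvPolynomial σ R} {j : ℕ} (hF : F.IsHomogeneous j)
    (h : MvPolynomial.eval t F ∈ maximalIdeal R ^ (j + 1)) :
    MvPolynomial.map (residue R) F = 0 := by
  classical
  by_contra h0
  rcases eq_or_ne j 0 with rfl | hj
  · rw [← MvPolynomial.totalDegree_zero_iff_isHomogeneous,
      MvPolynomial.totalDegree_eq_zero_iff_eq_C] at hF
    rw [hF] at h h0
    simp only [MvPolynomial.eval_C, zero_add, pow_one, MvPolynomial.map_C] at h h0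
    exact h0 (by rw [(residue_eq_zero_iff _).2 h, map_zero])
  · obtain ⟨a, i, -, h1⟩ := exists_line_of_map_residue_ne_zero ht hj hF h0
    exact h1 (Ideal.mem_sup_right h)

/-- For a nonzero element of the maximal ideal of a regular local ring, there are regular
coordinates such that the element does not vanish on the last axis. -/
lemma exists_isRegularSystem_notMem [IsNoetherianRing R] (ht : IsRegularSystem t) {f : R}
    (hf0 : f ≠ 0) (hf : f ∈ maximalIdeal R) :
    ∃ (t' : σ → R) (i : σ), IsRegularSystem t' ∧ f ∉ Ideal.span (t' '' {k | k ≠ i}) := by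
  classical
  -- `j` is the order of `f`, finite by Krull's intersection theorem. The line is chosen off the
  -- zero set of the initial form.
  obtain ⟨j, hj, hj'⟩ : ∃ j, f ∈ maximalIdeal R ^ j ∧ f ∉ maximalIdeal R ^ (j + 1) := by
    by_contra! h
    refine hf0 ?_
    have : f ∈ (⨅ n, maximalIdeal R ^ n : Ideal R) := by
      rw [Ideal.mem_iInf]
      intro n
      induction n with
      | zero => simp
      | succ n ih => exact h n ih
    rwa [Ideal.iInf_pow_eq_bot_of_isLocalRing _ (Ideal.IsPrime.ne_top inferInstance)] at this
  have hj0 : j ≠ 0 := by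
    rintro rfl
    simp only [zero_add, pow_one] at hj'
    exact hj' hf
  rw [← ht.1, Ideal.mem_span_pow_iff_exists_isHomogeneous] at hj
  obtain ⟨F, hF, rfl⟩ := hj
  have h0 : MvPolynomial.map (residue R) F ≠ 0 := by
    intro h0
    refine hj' ?_
    rw [MvPolynomial.eval_eq']
    refine sum_mem fun d hd => ?_
    have hsum : ∑ i, d i = j := by
      rw [← degree_eq_of_isHomogeneous hF hd, Finsupp.degree_eq_sum]
    have h1 : MvPolynomial.coeff d F ∈ maximalIdeal R := by
      rw [← residue_eq_zero_iff, ← MvPolynomial.coeff_map, h0, MvPolynomial.coeff_zero]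
    rw [pow_succ']
    refine Ideal.mul_mem_mul h1 ?_
    rw [← hsum, ← Finset.prod_pow_eq_pow_sum]
    exact Ideal.prod_mem_prod fun k _ => Ideal.pow_mem_pow (ht.mem_maximalIdeal k) _
  obtain ⟨a, i, ha, h1⟩ := exists_line_of_map_residue_ne_zero ht hj0 hF h0
  exact ⟨_, i, isRegularSystem_lineCoord ht ha, fun h => h1 (Ideal.mem_sup_left h)⟩

end RegularSystem

/-- The field is algebraic, hence separable, over a purely transcendental extension of the
rationals. Formal smoothness is what lifts the residue field to the completion. -/
lemma formallySmooth_rat (κ : Type*) [Field κ] [Algebra ℚ κ] : Algebra.FormallySmooth ℚ κ := by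
  have : CharZero κ := charZero_of_injective_algebraMap (algebraMap ℚ κ).injective
  obtain ⟨ι, v, hv⟩ := exists_isTranscendenceBasis' ℚ κ
  have : Algebra.IsAlgebraic (IntermediateField.adjoin ℚ (Set.range v)) κ := hv.isAlgebraic_field
  exact .of_algebraicIndependent_of_isSeparable hv.1

/-! ### Monomials in a family of elements -/

section Monomial

variable {R : Type*} [CommRing R] {σ : Type*} [Fintype σ]

/-- The monomial in the elements `t` with exponent `α`. -/
def tmon (t : σ → R) (α : σ →₀ ℕ) : R := ∏ i, t i ^ α i

lemma tmon_add (t : σ → R) (α β : σ →₀ ℕ) : tmon t (α + β) = tmon t α * tmon t β := by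
  simp [tmon, pow_add, Finset.prod_mul_distrib]

lemma tmon_single (t : σ → R) (i : σ) : tmon t (Finsupp.single i 1) = t i := by
  classical
  rw [tmon, Finset.prod_eq_single i]
  · simp
  · intro j _ hj; simp [hj.symm]
  · simp

lemma tmon_mem_pow {I : Ideal R} {t : σ → R} (ht : ∀ i, t i ∈ I) (α : σ →₀ ℕ) :
    tmon t α ∈ I ^ α.degree := by
  rw [Finsupp.degree_eq_sum, ← Finset.prod_pow_eq_pow_sum]
  exact Ideal.prod_mem_prod fun k _ => Ideal.pow_mem_pow (ht k) _

end Monomial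

lemma factorPow_evalₐ {R : Type*} [CommRing R] {I : Ideal R} {m n : ℕ} (h : m ≤ n)
    (x : AdicCompletion I R) :
    Ideal.Quotient.factorPow I h (AdicCompletion.evalₐ I n x) = AdicCompletion.evalₐ I m x := by
  induction x using AdicCompletion.induction_on with
  | h a =>
    rw [AdicCompletion.evalₐ_mk, AdicCompletion.evalₐ_mk, Ideal.Quotient.factorPow,
      Ideal.Quotient.factor_mk, Ideal.Quotient.eq, ← neg_mem_iff, neg_sub]
    have := a.property h
    rwa [SModEq.sub_mem, smul_eq_mul, Ideal.mul_top] at this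

/-! ### Cohen structure: power series expansion over the residue field -/

section Cohen

variable {R : Type*} [CommRing R] [IsLocalRing R] [Algebra ℚ R]

variable (R) in
/-- The residue field lifts compatibly to the quotients by the powers of the maximal ideal. -/
lemma exists_coefficientField :
    ∃ s : ∀ n, ResidueField R →+* R ⧸ maximalIdeal R ^ n,
      (∀ m n (h : m ≤ n) c, Ideal.Quotient.factorPow (maximalIdeal R) h (s n c) = s m c) ∧
      ∀ n r, ∃ r', r' - r ∈ maximalIdeal R ∧ s n (residue R r) = Ideal.Quotient.mk _ r' := by
  have := formallySmooth_rat (ResidueField R)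
  let e : ResidueField R →+* R ⧸ maximalIdeal R := RingHom.id (R ⧸ maximalIdeal R)
  obtain ⟨g, hg⟩ := Algebra.FormallySmooth.exists_adicCompletionEvalOneₐ_comp_eq
    (R := ℚ) (A := ResidueField R) (I := maximalIdeal R) e.toRatAlgHom
  refine ⟨fun n => (AdicCompletion.evalₐ (maximalIdeal R) n).toRingHom.comp g.toRingHom,
    fun m n h c => factorPow_evalₐ h (g c), fun n r => ?_⟩
  have hg' : AdicCompletion.evalOneₐ (maximalIdeal R) (g (residue R r)) =
      Ideal.Quotient.mk _ r := congr($hg (residue R r))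
  change ∃ r', _ ∧ AdicCompletion.evalₐ (maximalIdeal R) n (g (residue R r)) = _
  generalize g (residue R r) = x at hg' ⊢
  induction x using AdicCompletion.induction_on with
  | h a =>
    -- An approximation of level at least one is needed to control the residue class, even for `n =
    -- 0`.
    refine ⟨a.val (max n 1), ?_, ?_⟩
    · rw [← AdicCompletion.factorₐ_evalₐ_one, ← factorPow_evalₐ (le_max_right n 1),
        AdicCompletion.evalₐ_mk, Ideal.Quotient.factorPow, Ideal.Quotient.factor_mk,
        Ideal.Quotient.factor_mk, Ideal.Quotient.eq] at hg'
      exact hg'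
    · rw [← factorPow_evalₐ (le_max_left n 1), AdicCompletion.evalₐ_mk, Ideal.Quotient.factorPow,
        Ideal.Quotient.factor_mk]

variable [IsNoetherianRing R] {σ : Type*} [Fintype σ] {t : σ → R}

/-- Polynomials surject onto the quotient by a power of an ideal `I` if they do so modulo `I`. -/
lemma surjective_of_map_eq {P A : Type*} [CommRing P] [CommRing A] (ψ : P →+* A) (V : Ideal P)
    {n : ℕ} (hn : V.map ψ ^ n = ⊥) (h : ∀ a, ∃ p, a - ψ p ∈ V.map ψ) : Function.Surjective ψ := by
  have key : ∀ j, ∀ a ∈ V.map ψ ^ j, ∃ p ∈ V ^ j, a - ψ p ∈ V.map ψ ^ (j + 1) := by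
    intro j a ha
    rw [← Ideal.map_pow] at ha
    refine Submodule.span_induction (p := fun a _ => ∃ p ∈ V ^ j, a - ψ p ∈ V.map ψ ^ (j + 1))
      ?_ ⟨0, zero_mem _, by simp⟩ ?_ ?_ ha
    · rintro _ ⟨p, hp, rfl⟩
      exact ⟨p, hp, by simp⟩
    · rintro x y - - ⟨p, hp, hx⟩ ⟨q, hq, hy⟩
      refine ⟨p + q, add_mem hp hq, ?_⟩
      rw [map_add, add_sub_add_comm]
      exact add_mem hx hy
    · rintro c x - ⟨p, hp, hx⟩
      obtain ⟨q, hq⟩ := h c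
      refine ⟨q * p, Ideal.mul_mem_left _ _ hp, ?_⟩
      have h1 : c • x - ψ (q * p) = c * (x - ψ p) + (c - ψ q) * ψ p := by
        rw [map_mul, smul_eq_mul]; ring
      rw [h1]
      refine add_mem (Ideal.mul_mem_left _ _ hx) ?_
      rw [pow_succ']
      refine Ideal.mul_mem_mul hq ?_
      rw [← Ideal.map_pow]
      exact Ideal.mem_map_of_mem _ hp
  have key2 : ∀ j, ∀ a, ∃ p, a - ψ p ∈ V.map ψ ^ j := by
    intro j
    induction j with
    | zero => exact fun a => ⟨0, by simp⟩
    | succ j ih =>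
      intro a
      obtain ⟨p, hp⟩ := ih a
      obtain ⟨q, -, hq⟩ := key j _ hp
      exact ⟨p + q, by rwa [map_add, ← sub_sub]⟩
  intro a
  obtain ⟨p, hp⟩ := key2 n a
  rw [hn, Ideal.mem_bot, sub_eq_zero] at hp
  exact ⟨p, hp.symm⟩

/-- A polynomial over the residue field, whose image in `R / m ^ n` lies in `m ^ j`, has no
coefficients in degrees below `j`. -/
lemma coeff_eq_zero_of_eval₂_eq (ht : IsRegularSystem t) {n : ℕ}
    (s : ResidueField R →+* R ⧸ maximalIdeal R ^ n)
    (hs : ∀ r, ∃ r', r' - r ∈ maximalIdeal R ∧ s (residue R r) = Ideal.Quotient.mk _ r')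
    {P : MvPolynomial σ (ResidueField R)} {f : R} {j : ℕ} (hj : j ≤ n)
    (hP : MvPolynomial.eval₂ s (fun i => Ideal.Quotient.mk _ (t i)) P = Ideal.Quotient.mk _ f)
    (hf : f ∈ maximalIdeal R ^ j) {d : σ →₀ ℕ} (hd : d.degree < j) : P.coeff d = 0 := by
  have hlift : ∀ c : ResidueField R, ∃ r, residue R r = c ∧ s c = Ideal.Quotient.mk _ r := by
    intro c
    obtain ⟨r, rfl⟩ := residue_surjective c
    obtain ⟨r', h1, h2⟩ := hs r
    refine ⟨r', ?_, h2⟩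
    rwa [← sub_eq_zero, ← map_sub, residue_eq_zero_iff]
  choose ρ hρ1 hρ2 using hlift
  have heval : f - ∑ e ∈ P.support, ρ (P.coeff e) * tmon t e ∈ maximalIdeal R ^ n := by
    rw [← Ideal.Quotient.eq_zero_iff_mem, map_sub, ← hP, MvPolynomial.eval₂_eq', map_sum,
      sub_eq_zero]
    refine Finset.sum_congr rfl fun e _ => ?_
    rw [map_mul, ← hρ2, tmon, map_prod]
    simp only [map_pow]
  -- Induction on the degree: when the lower coefficients vanish, the degree `k` part of `P` takes a
  -- value in `m ^ (k + 1)` at `t`, and quasi-regularity kills it modulo `m`.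
  suffices H : ∀ k, ∀ e : σ →₀ ℕ, e.degree = k → k < j → P.coeff e = 0 from H _ d rfl hd
  intro k
  induction k using Nat.strong_induction_on with
  | _ k ih =>
    intro e he hkj
    by_contra hne
    set F : MvPolynomial σ R :=
      ∑ e ∈ P.support with e.degree = k, MvPolynomial.monomial e (ρ (P.coeff e)) with hF
    have hFh : F.IsHomogeneous k := by
      refine MvPolynomial.IsHomogeneous.sum _ _ _ fun e he => ?_
      exact MvPolynomial.isHomogeneous_monomial _ (Finset.mem_filter.1 he).2
    have hFe : MvPolynomial.eval t F =
        ∑ e ∈ P.support with e.degree = k, ρ (P.coeff e) * tmon t e := by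
      rw [hF, map_sum]
      refine Finset.sum_congr rfl fun e _ => ?_
      rw [MvPolynomial.eval_monomial, tmon, Finsupp.prod_fintype]
      simp
    have hmem : MvPolynomial.eval t F ∈ maximalIdeal R ^ (k + 1) := by
      have h1 : f - ∑ e ∈ P.support, ρ (P.coeff e) * tmon t e ∈ maximalIdeal R ^ (k + 1) :=
        Ideal.pow_le_pow_right (by omega) heval
      have h2 : f ∈ maximalIdeal R ^ (k + 1) := Ideal.pow_le_pow_right (by omega) hf
      have h3 : ∑ e ∈ P.support with ¬ e.degree = k, ρ (P.coeff e) * tmon t e ∈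
          maximalIdeal R ^ (k + 1) := by
        refine sum_mem fun e he => Ideal.mul_mem_left _ _ ?_
        obtain ⟨h4, h5⟩ := Finset.mem_filter.1 he
        have h6 : k + 1 ≤ e.degree := by
          by_contra h6
          exact MvPolynomial.mem_support_iff.1 h4 (ih e.degree (by omega) e rfl (by omega))
        exact Ideal.pow_le_pow_right h6 (tmon_mem_pow ht.mem_maximalIdeal e)
      rw [← Finset.sum_filter_add_sum_filter_not _ (fun e => e.degree = k), ← hFe] at h1
      have := sub_mem (sub_mem h2 h1) h3
      convert this using 1
      ring
    have h0 := congr(MvPolynomial.coeff e $(map_residue_eq_zero ht hFh hmem))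
    rw [MvPolynomial.coeff_zero, MvPolynomial.coeff_map, hF, MvPolynomial.coeff_sum] at h0
    classical
    rw [Finset.sum_eq_single e, MvPolynomial.coeff_monomial, if_pos rfl, hρ1] at h0
    · exact hne h0
    · intro b _ hb
      rw [MvPolynomial.coeff_monomial, if_neg hb]
    · intro h
      exact absurd (Finset.mem_filter.2 ⟨MvPolynomial.mem_support_iff.2 hne, he⟩) h

/-- The completion of a regular local ring of equal characteristic zero is a ring of formal power
series over the residue field. -/
theorem exists_toPowerSeries (ht : IsRegularSystem t) :
    ∃ Φ : R →+* MvPowerSeries σ (ResidueField R),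
      (∀ i, Φ (t i) = MvPowerSeries.X i) ∧
      (∀ n f, (∀ d : σ →₀ ℕ, d.degree < n → MvPowerSeries.coeff d (Φ f) = 0) ↔
        f ∈ maximalIdeal R ^ n) ∧
      ∀ n g, ∃ f, ∀ d : σ →₀ ℕ, d.degree < n →
        MvPowerSeries.coeff d (Φ f) = MvPowerSeries.coeff d g := by
  obtain ⟨s, hs1, hs2⟩ := exists_coefficientField R
  let ψ : ∀ n, MvPolynomial σ (ResidueField R) →+* R ⧸ maximalIdeal R ^ n := fun n =>
    MvPolynomial.eval₂Hom (s n) (fun i => Ideal.Quotient.mk _ (t i))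
  have hψ : ∀ m n (h : m ≤ n) P, Ideal.Quotient.factorPow (maximalIdeal R) h (ψ n P) = ψ m P := by
    intro m n h P
    have : (Ideal.Quotient.factorPow (maximalIdeal R) h).comp (ψ n) = ψ m := by
      refine MvPolynomial.ringHom_ext (fun c => ?_) (fun i => ?_)
      · simpa [ψ] using hs1 m n h c
      · simp [ψ, Ideal.Quotient.factorPow]
    exact congr($this P)
  have hsurj : ∀ n, Function.Surjective (ψ n) := by
    intro n
    have hV : (Ideal.span (Set.range (MvPolynomial.X : σ → MvPolynomial σ (ResidueField R)))).map
        (ψ n) = (maximalIdeal R).map (Ideal.Quotient.mk (maximalIdeal R ^ n)) := by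
      have h1 : (maximalIdeal R).map (Ideal.Quotient.mk (maximalIdeal R ^ n)) =
          (Ideal.span (Set.range t)).map (Ideal.Quotient.mk (maximalIdeal R ^ n)) := by rw [ht.1]
      rw [h1, Ideal.map_span, Ideal.map_span, ← Set.range_comp, ← Set.range_comp]
      congr 2
      funext i
      simp [ψ]
    refine surjective_of_map_eq (ψ n)
      (Ideal.span (Set.range (MvPolynomial.X : σ → MvPolynomial σ (ResidueField R)))) (n := n)
      ?_ ?_
    · rw [hV, ← Ideal.map_pow, Ideal.map_quotient_self]
    · intro a
      obtain ⟨r, rfl⟩ := Ideal.Quotient.mk_surjective a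
      obtain ⟨r', h1, h2⟩ := hs2 n r
      refine ⟨MvPolynomial.C (residue R r), ?_⟩
      simp only [ψ, MvPolynomial.coe_eval₂Hom, MvPolynomial.eval₂_C, h2, hV, ← map_sub]
      refine Ideal.mem_map_of_mem _ ?_
      rwa [← neg_mem_iff, neg_sub]
  have hzero : ∀ n P f j, j ≤ n → ψ n P = Ideal.Quotient.mk _ f → f ∈ maximalIdeal R ^ j →
      ∀ d : σ →₀ ℕ, d.degree < j → P.coeff d = 0 := fun n P f j hj hP hf d hd =>
    coeff_eq_zero_of_eval₂_eq ht (s n) (hs2 n) hj hP hf hd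
  have huniq : ∀ m n P Q f, m ≤ n → ψ m P = Ideal.Quotient.mk _ f → ψ n Q = Ideal.Quotient.mk _ f →
      ∀ d : σ →₀ ℕ, d.degree < m → P.coeff d = Q.coeff d := by
    intro m n P Q f h hP hQ d hd
    rw [← sub_eq_zero, ← MvPolynomial.coeff_sub]
    refine hzero m (P - Q) 0 m le_rfl ?_ (zero_mem _) d hd
    rw [map_sub, hP, ← hψ m n h, hQ, Ideal.Quotient.factorPow, Ideal.Quotient.factor_mk, sub_self,
      map_zero]
  choose p hp using fun (f : R) (n : ℕ) => hsurj n (Ideal.Quotient.mk _ f)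
  -- A coefficient in degree `d` is already determined modulo the power `d + 1` of the maximal
  -- ideal; `huniq` shows that finer approximations give the same one.
  let φ : R → MvPowerSeries σ (ResidueField R) := fun f d => (p f (d.degree + 1)).coeff d
  have hφ : ∀ f n P, ψ n P = Ideal.Quotient.mk _ f → ∀ d : σ →₀ ℕ, d.degree < n →
      MvPowerSeries.coeff d (φ f) = P.coeff d := fun f n P hP d hd =>
    huniq (d.degree + 1) n _ P f hd (hp f _) hP d (Nat.lt_succ_self _)
  let Φ : R →+* MvPowerSeries σ (ResidueField R) :=
    { toFun := φ
      map_one' := by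
        classical
        ext d
        rw [hφ 1 (d.degree + 1) 1 (by simp) d (Nat.lt_succ_self _), MvPowerSeries.coeff_one,
          MvPolynomial.coeff_one]
        simp only [eq_comm]
      map_zero' := by
        ext d
        rw [hφ 0 (d.degree + 1) 0 (by simp) d (Nat.lt_succ_self _)]
        simp
      map_add' := fun f g => by
        ext d
        rw [hφ (f + g) (d.degree + 1) (p f (d.degree + 1) + p g (d.degree + 1))
          (by rw [map_add, hp, hp, map_add]) d (Nat.lt_succ_self _), map_add,
          hφ f _ _ (hp f _) d (Nat.lt_succ_self _), hφ g _ _ (hp g _) d (Nat.lt_succ_self _),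
          MvPolynomial.coeff_add]
      map_mul' := fun f g => by
        classical
        ext d
        rw [hφ (f * g) (d.degree + 1) (p f (d.degree + 1) * p g (d.degree + 1))
          (by rw [map_mul, hp, hp, map_mul]) d (Nat.lt_succ_self _), MvPowerSeries.coeff_mul,
          MvPolynomial.coeff_mul]
        refine Finset.sum_congr rfl fun x hx => ?_
        have hx' : x.1.degree + x.2.degree = d.degree := by
          rw [← map_add, Finset.HasAntidiagonal.mem_antidiagonal.1 hx]
        rw [hφ f (d.degree + 1) _ (hp f _) x.1 (by omega),
          hφ g (d.degree + 1) _ (hp g _) x.2 (by omega)] }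
  have hΦ : ∀ f n P, ψ n P = Ideal.Quotient.mk _ f → ∀ d : σ →₀ ℕ, d.degree < n →
      MvPowerSeries.coeff d (Φ f) = P.coeff d := hφ
  refine ⟨Φ, fun i => ?_, fun n f => ⟨fun h => ?_, fun h d hd => ?_⟩, fun n g => ?_⟩
  · classical
    ext d
    rw [hΦ (t i) (d.degree + 1) (MvPolynomial.X i) (by simp [ψ]) d (Nat.lt_succ_self _),
      MvPowerSeries.coeff_X, MvPolynomial.coeff_X]
    simp only [eq_comm]
  · rw [← Ideal.Quotient.eq_zero_iff_mem, ← hp f n]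
    simp only [ψ, MvPolynomial.coe_eval₂Hom, MvPolynomial.eval₂_eq']
    refine Finset.sum_eq_zero fun d hd => ?_
    by_cases hdn : d.degree < n
    · exact absurd ((hΦ f n _ (hp f n) d hdn).symm.trans (h d hdn))
        (MvPolynomial.mem_support_iff.1 hd)
    · have h1 := Ideal.pow_le_pow_right (not_lt.1 hdn) (tmon_mem_pow ht.mem_maximalIdeal d)
      rw [← Ideal.Quotient.eq_zero_iff_mem, tmon, map_prod] at h1
      simp only [map_pow] at h1
      rw [h1, mul_zero]
  · rw [hΦ f n _ (hp f n) d hd]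
    exact hzero n _ f n le_rfl (hp f n) h d hd
  · obtain ⟨f, hf⟩ := Ideal.Quotient.mk_surjective (ψ n (MvPowerSeries.truncTotal n g))
    refine ⟨f, fun d hd => ?_⟩
    rw [hΦ f n _ hf.symm d hd, MvPowerSeries.coeff_truncTotal _ hd]

end Cohen
/-- Ideals of Noetherian local rings are closed. -/
lemma mem_of_forall_mem_sup_pow {A : Type*} [CommRing A] [IsLocalRing A] [IsNoetherianRing A]
    {J : Ideal A} {f : A} (h : ∀ k, f ∈ J ⊔ maximalIdeal A ^ k) : f ∈ J := by
  have h1 := Ideal.iInf_pow_smul_eq_bot_of_isLocalRing (M := A ⧸ J) (maximalIdeal A)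
    (Ideal.IsPrime.ne_top inferInstance)
  rw [← Ideal.Quotient.eq_zero_iff_mem, ← Submodule.mem_bot A, ← h1, Submodule.mem_iInf]
  intro k
  obtain ⟨x, hx, y, hy, rfl⟩ := Submodule.mem_sup.1 (h k)
  rw [map_add, Ideal.Quotient.eq_zero_iff_mem.2 hx, zero_add]
  have h2 : (Ideal.Quotient.mk J) y = y • (1 : A ⧸ J) := by
    rw [Algebra.smul_def, mul_one]; rfl
  rw [h2]
  exact Submodule.smul_mem_smul hy trivial

/-! ### Monomial ideals and their sets of exponents -/

section MonomialIdeal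

variable {R : Type*} [CommRing R] {σ : Type*} [Fintype σ]

/-- The ideal generated by the monomials with exponents in `U`. -/
def mono (t : σ → R) (U : Set (σ →₀ ℕ)) : Ideal R := Ideal.span (tmon t '' U)

lemma tmon_mem_mono {t : σ → R} {U : Set (σ →₀ ℕ)} {α : σ →₀ ℕ} (h : α ∈ U) :
    tmon t α ∈ mono t U := Ideal.subset_span ⟨α, h, rfl⟩

lemma mono_mono (t : σ → R) {U V : Set (σ →₀ ℕ)} (h : U ⊆ V) : mono t U ≤ mono t V :=
  Ideal.span_mono (Set.image_mono h)

lemma mono_union (t : σ → R) (U V : Set (σ →₀ ℕ)) : mono t (U ∪ V) = mono t U ⊔ mono t V := by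
  rw [mono, Set.image_union, Ideal.span_union]; rfl

lemma mono_iUnion {ι : Sort*} (t : σ → R) (U : ι → Set (σ →₀ ℕ)) :
    mono t (⋃ i, U i) = ⨆ i, mono t (U i) := by
  rw [mono, Set.image_iUnion, Ideal.span_iUnion]; rfl

lemma tmon_dvd_tmon (t : σ → R) {α β : σ →₀ ℕ} (h : α ≤ β) : tmon t α ∣ tmon t β := by
  obtain ⟨γ, rfl⟩ := exists_add_of_le h
  exact ⟨tmon t γ, tmon_add t α γ⟩

lemma mono_Ici (t : σ → R) (α : σ →₀ ℕ) : mono t (Set.Ici α) = Ideal.span {tmon t α} := by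
  refine le_antisymm (Ideal.span_le.2 ?_)
    ((Ideal.span_singleton_le_iff_mem _).2 (tmon_mem_mono (Set.self_mem_Ici)))
  rintro _ ⟨β, hβ, rfl⟩
  exact Ideal.mem_span_singleton.2 (tmon_dvd_tmon t hβ)

lemma span_image_eq_mono (t : σ → R) (τ : Set σ) :
    Ideal.span (t '' τ) = mono t {α | ∃ i ∈ τ, α i ≠ 0} := by
  have : {α : σ →₀ ℕ | ∃ i ∈ τ, α i ≠ 0} = ⋃ i : τ, Set.Ici (Finsupp.single (i : σ) 1) := by
    ext α
    simp [Finsupp.single_le_iff, Nat.one_le_iff_ne_zero]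
  rw [this, mono_iUnion]
  simp_rw [mono_Ici, tmon_single]
  rw [← Ideal.span_iUnion, Set.iUnion_singleton_eq_range]
  congr 1
  ext; simp

lemma isUpperSet_exists_ne_zero {σ : Type*} (τ : Set σ) :
    IsUpperSet {α : σ →₀ ℕ | ∃ i ∈ τ, α i ≠ 0} := by
  rintro α β h ⟨i, hi, hα⟩
  exact ⟨i, hi, by have := h i; omega⟩

lemma pow_eq_mono {t : σ → R} (n : ℕ) :
    Ideal.span (Set.range t) ^ n = mono t {α | n ≤ α.degree} := by
  refine le_antisymm ?_ (Ideal.span_le.2 ?_)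
  · intro f hf
    obtain ⟨F, hF, rfl⟩ := (Ideal.mem_span_pow_iff_exists_isHomogeneous t f).1 hf
    rw [MvPolynomial.eval_eq']
    exact sum_mem fun d hd => Ideal.mul_mem_left _ _
      (tmon_mem_mono (degree_eq_of_isHomogeneous hF hd).ge)
  · rintro _ ⟨α, hα, rfl⟩
    exact Ideal.pow_le_pow_right hα
      (tmon_mem_pow (fun i => Ideal.subset_span (Set.mem_range_self i)) α)

lemma isUpperSet_degree {σ : Type*} (n : ℕ) : IsUpperSet {α : σ →₀ ℕ | n ≤ α.degree} := by
  intro α β h hα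
  exact le_trans hα (Finsupp.degree_mono h)

lemma finite_degree_lt (n : ℕ) : {α : σ →₀ ℕ | α.degree < n}.Finite := by
  have := Finsupp.finite_of_degree_le (σ := σ) n
  exact this.subset fun α (hα : α.degree < n) => hα.le

end MonomialIdeal

/-! ### Lengths of quotients along inclusions -/

section Length

variable {A : Type*} [CommRing A]

lemma length_quotient_eq_add {I J : Ideal A} (h : I ≤ J) :
    Module.length A (A ⧸ I) =
      Module.length A (Submodule.map I.mkQ J) + Module.length A (A ⧸ J) := by
  rw [Module.length_eq_add_of_exact (Submodule.map I.mkQ J).subtype (Submodule.map I.mkQ J).mkQ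
    (Submodule.subtype_injective _) (Submodule.mkQ_surjective _)
    (LinearMap.exact_subtype_mkQ _), (Submodule.quotientQuotientEquivQuotient I J h).length_eq]

/-- The class of `x` is nonzero and killed by the maximal ideal, so it spans a copy of the residue
field. -/
lemma length_quotient_eq_succ [IsLocalRing A] {I : Ideal A} {x : A} (hx : x ∉ I)
    (hm : ∀ r ∈ maximalIdeal A, r * x ∈ I) :
    Module.length A (A ⧸ I) = Module.length A (A ⧸ (I ⊔ Ideal.span {x})) + 1 := by
  rw [length_quotient_eq_add (le_sup_left : I ≤ I ⊔ Ideal.span {x}), add_comm]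
  congr 1
  have hmap : Submodule.map I.mkQ (I ⊔ Ideal.span {x}) =
      LinearMap.range (LinearMap.toSpanSingleton A (A ⧸ I) (I.mkQ x)) := by
    rw [Submodule.map_sup, LinearMap.range_toSpanSingleton]
    have : Submodule.map I.mkQ I = ⊥ := by
      rw [eq_bot_iff, Submodule.map_le_iff_le_comap, ← LinearMap.ker, Submodule.ker_mkQ]
    rw [this, bot_sup_eq, Ideal.span, Submodule.map_span, Set.image_singleton]
  have hker : LinearMap.ker (LinearMap.toSpanSingleton A (A ⧸ I) (I.mkQ x)) =
      maximalIdeal A := by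
    have hmem : ∀ r, r ∈ LinearMap.ker (LinearMap.toSpanSingleton A (A ⧸ I) (I.mkQ x)) ↔
        r * x ∈ I := fun r => by
      rw [LinearMap.mem_ker, LinearMap.toSpanSingleton_apply, ← map_smul, Submodule.mkQ_apply,
        Submodule.Quotient.mk_eq_zero, smul_eq_mul]
    refine le_antisymm (IsLocalRing.le_maximalIdeal fun h => hx ?_) fun r hr => (hmem r).2 (hm r hr)
    have := (hmem 1).1 (h ▸ Submodule.mem_top)
    rwa [one_mul] at this
  rw [hmap, ← (LinearMap.quotKerEquivRange _).length_eq, hker, Module.length_eq_one_iff,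
    isSimpleModule_iff_quot_maximal]
  exact ⟨maximalIdeal A, inferInstance, ⟨LinearEquiv.refl _ _⟩⟩

end Length

/-! ### Monomial ideals in regular local rings: membership and counting -/

section Criterion

variable {R : Type*} [CommRing R] [IsLocalRing R] [IsNoetherianRing R] [Algebra ℚ R]
  {σ : Type*} [Fintype σ] {t : σ → R}

lemma tmon_X (κ : Type*) [Field κ] (α : σ →₀ ℕ) :
    tmon (fun i => (MvPowerSeries.X i : MvPowerSeries σ κ)) α = MvPowerSeries.monomial α 1 := by
  classical
  induction α using Finsupp.induction with
  | zero => simp [tmon]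
  | single_add a b f _ _ ih =>
    rw [tmon_add, ih]
    have : tmon (fun i => (MvPowerSeries.X i : MvPowerSeries σ κ)) (Finsupp.single a b) =
        MvPowerSeries.monomial (Finsupp.single a b) 1 := by
      rw [← MvPowerSeries.X_pow_eq, tmon, Finset.prod_eq_single a]
      · simp
      · intro j _ hj; simp [hj.symm]
      · simp
    rw [this, MvPowerSeries.monomial_mul_monomial, one_mul]

/-- Membership in a monomial ideal can be read off from the power series expansion. -/
theorem exists_mem_mono_iff (ht : IsRegularSystem t) :
    ∃ Φ : R →+* MvPowerSeries σ (ResidueField R),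
      (∀ α, Φ (tmon t α) = MvPowerSeries.monomial α 1) ∧
      ∀ U : Set (σ →₀ ℕ), IsUpperSet U → ∀ f,
        f ∈ mono t U ↔ ∀ α ∉ U, MvPowerSeries.coeff α (Φ f) = 0 := by
  classical
  obtain ⟨Φ, hX, hpow, hsurj⟩ := exists_toPowerSeries ht
  have hmon : ∀ α, Φ (tmon t α) = MvPowerSeries.monomial α 1 := by
    intro α
    rw [← tmon_X, tmon, map_prod, tmon]
    simp only [map_pow, hX]
  refine ⟨Φ, hmon, fun U hU f => ⟨fun hf => ?_, fun h => ?_⟩⟩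
  · refine Submodule.span_induction (p := fun f _ => ∀ α ∉ U, MvPowerSeries.coeff α (Φ f) = 0)
      ?_ (by simp) ?_ ?_ hf
    · rintro _ ⟨β, hβ, rfl⟩ α hα
      rw [hmon, MvPowerSeries.coeff_monomial, if_neg]
      rintro rfl; exact hα hβ
    · intro x y _ _ hx hy α hα
      rw [map_add, map_add, hx α hα, hy α hα, add_zero]
    · intro a x _ hx α hα
      rw [smul_eq_mul, map_mul, MvPowerSeries.coeff_mul]
      refine Finset.sum_eq_zero fun p hp => ?_
      rw [hx p.2, mul_zero]
      intro hp2
      refine hα (hU ?_ hp2)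
      rw [← Finset.HasAntidiagonal.mem_antidiagonal.1 hp]
      exact le_add_self
  -- Ideals are closed, so approximation suffices: subtract a lift of the truncated series, all of
  -- whose monomials lie in `U`.
  · refine mem_of_forall_mem_sup_pow fun k => ?_
    choose ρ hρ using fun c : ResidueField R => hsurj k (MvPowerSeries.C c)
    set T : Finset (σ →₀ ℕ) := (finite_degree_lt (σ := σ) k).toFinset with hT
    set P : R := ∑ α ∈ T with α ∈ U, ρ (MvPowerSeries.coeff α (Φ f)) * tmon t α with hP
    have h1 : P ∈ mono t U := sum_mem fun α hα =>
      Ideal.mul_mem_left _ _ (tmon_mem_mono (Finset.mem_filter.1 hα).2)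
    have h2 : f - P ∈ maximalIdeal R ^ k := by
      rw [← hpow]
      intro d hd
      rw [map_sub, map_sub, sub_eq_zero, hP, map_sum, map_sum]
      have h3 : ∀ α : σ →₀ ℕ, MvPowerSeries.coeff d
          (Φ (ρ (MvPowerSeries.coeff α (Φ f)) * tmon t α)) =
          if d = α then MvPowerSeries.coeff α (Φ f) else 0 := by
        intro α
        rw [map_mul, hmon, MvPowerSeries.coeff_mul_monomial, mul_one]
        split_ifs with h4 h5 h5
        · rw [h5, tsub_self, hρ _ _ (by rw [map_zero]; omega), MvPowerSeries.coeff_zero_C]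
        · have h6 : (d - α).degree < k :=
            (Finsupp.degree_mono (tsub_le_self : d - α ≤ d)).trans_lt hd
          rw [hρ _ _ h6, MvPowerSeries.coeff_C, if_neg]
          intro h7
          exact h5 (le_antisymm (tsub_eq_zero_iff_le.1 h7) h4)
        · exact absurd h5.le (fun h => h4 h5.ge)
        · rfl
      simp_rw [h3]
      rw [Finset.sum_ite_eq]
      split_ifs with h5
      · rfl
      · refine h d fun hdU => h5 (Finset.mem_filter.2 ⟨?_, hdU⟩)
        rw [hT, Set.Finite.mem_toFinset]; exact hd
    rw [← sub_add_cancel f P, add_comm]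
    exact Submodule.add_mem_sup h1 h2

lemma tmon_mem_mono_iff (ht : IsRegularSystem t) {U : Set (σ →₀ ℕ)} (hU : IsUpperSet U)
    {α : σ →₀ ℕ} : tmon t α ∈ mono t U ↔ α ∈ U := by
  classical
  obtain ⟨Φ, hmon, hΦ⟩ := exists_mem_mono_iff ht
  refine ⟨fun h => ?_, tmon_mem_mono⟩
  by_contra hα
  have := (hΦ U hU _).1 h α hα
  rw [hmon, MvPowerSeries.coeff_monomial_same] at this
  exact one_ne_zero this

/-- Membership is a condition on single coefficients, and such conditions can be intersected. Since
sums correspond to unions, monomial ideals with upper exponent sets form a distributive lattice;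
later computations with blocks depend on this. -/
lemma mono_iInter (ht : IsRegularSystem t) {ι : Sort*} {U : ι → Set (σ →₀ ℕ)}
    (hU : ∀ i, IsUpperSet (U i)) : mono t (⋂ i, U i) = ⨅ i, mono t (U i) := by
  obtain ⟨Φ, hmon, hΦ⟩ := exists_mem_mono_iff ht
  ext f
  rw [hΦ _ (isUpperSet_iInter hU), Ideal.mem_iInf]
  simp_rw [hΦ _ (hU _)]
  simp only [Set.mem_iInter, not_forall]
  exact ⟨fun h i α hα => h α ⟨i, hα⟩, fun h α ⟨i, hα⟩ => h i α hα⟩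

lemma mono_inter (ht : IsRegularSystem t) {U V : Set (σ →₀ ℕ)} (hU : IsUpperSet U)
    (hV : IsUpperSet V) : mono t (U ∩ V) = mono t U ⊓ mono t V := by
  rw [Set.inter_eq_iInter, mono_iInter ht (by rintro (_ | _) <;> assumption), iInf_bool_eq]
  rfl

lemma mono_le_mono_iff (ht : IsRegularSystem t) {U V : Set (σ →₀ ℕ)} (hV : IsUpperSet V) :
    mono t U ≤ mono t V ↔ U ⊆ V :=
  ⟨fun h _ hα => (tmon_mem_mono_iff ht hV).1 (h (tmon_mem_mono hα)), mono_mono t⟩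

/-- The length of the quotient by a monomial ideal is the number of remaining monomials. -/
lemma length_quotient_mono (ht : IsRegularSystem t) (U : Set (σ →₀ ℕ)) (hU : IsUpperSet U)
    (hfin : (Uᶜ).Finite) : Module.length R (R ⧸ mono t U) = (Uᶜ).ncard := by
  obtain ⟨n, hn⟩ : ∃ n, (Uᶜ).ncard = n := ⟨_, rfl⟩
  induction n generalizing U with
  | zero =>
    rw [Set.ncard_eq_zero hfin] at hn
    have : mono t U = ⊤ := by
      rw [Set.compl_empty_iff] at hn
      rw [Ideal.eq_top_iff_one]
      convert tmon_mem_mono (t := t) (U := U) (α := 0) (by rw [hn]; trivial)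
      simp [tmon]
    rw [this, hn]
    have : Subsingleton (R ⧸ (⊤ : Ideal R)) := Ideal.Quotient.subsingleton_iff.2 rfl
    simp
  | succ n ih =>
    -- Adjoining a maximal missing exponent adjoins a socle element of the quotient, which accounts
    -- for length one.
    obtain ⟨α, hα, hmax⟩ : ∃ α ∈ Uᶜ, ∀ β ∈ Uᶜ, α ≤ β → α = β := by
      obtain ⟨α, hα⟩ := hfin.exists_maximal (Set.nonempty_of_ncard_ne_zero (by omega))
      exact ⟨α, hα.1, fun β hβ h => le_antisymm h (hα.2 hβ h)⟩
    set V := insert α U with hV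
    have hVU : IsUpperSet V := by
      rintro β γ h (rfl | hβ)
      · by_cases hγ : γ ∈ U
        · exact Or.inr hγ
        · exact Or.inl (hmax γ hγ h).symm
      · exact Or.inr (hU h hβ)
    have hVc : Uᶜ = insert α Vᶜ := by
      ext β
      by_cases h : β = α
      · subst h; simpa using hα
      · simp [hV, h]
    have hfV : (Vᶜ).Finite := hfin.subset (by rw [hVc]; exact Set.subset_insert _ _)
    have hαV : α ∉ Vᶜ := by simp [hV]
    have hcard : (Uᶜ).ncard = (Vᶜ).ncard + 1 := by
      rw [hVc, Set.ncard_insert_of_notMem hαV hfV]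
    have hle : mono t U ≤ mono t V := mono_mono t (Set.subset_insert _ _)
    have hsup : mono t V = mono t U ⊔ Ideal.span {tmon t α} := by
      rw [hV, ← Set.union_singleton, mono_union]
      congr 1
      rw [mono, Set.image_singleton]
    have hstep : ∀ r ∈ maximalIdeal R, r * tmon t α ∈ mono t U := by
      intro r hr
      rw [← ht.1] at hr
      refine Submodule.span_induction (p := fun r _ => r * tmon t α ∈ mono t U) ?_ (by simp)
        ?_ ?_ hr
      · rintro _ ⟨i, rfl⟩
        rw [← tmon_single t, ← tmon_add]
        refine tmon_mem_mono ?_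
        by_contra hc
        have h1 := congr($(hmax _ hc le_add_self) i)
        simp at h1
      · intro x y _ _ hx hy
        rw [add_mul]; exact add_mem hx hy
      · intro a x _ hx
        rw [smul_eq_mul, mul_assoc]; exact Ideal.mul_mem_left _ _ hx
    rw [length_quotient_eq_succ (fun h => hα ((tmon_mem_mono_iff ht hU).1 h)) hstep, ← hsup,
      ih V hVU hfV (by omega), hcard]
    push_cast
    rfl

/-- The Hilbert-Samuel function of a monomial ideal counts monomials. -/
theorem hilbertSamuel_mono (ht : IsRegularSystem t) {U : Set (σ →₀ ℕ)} (hU : IsUpperSet U)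
    (k : ℕ) :
    hilbertSamuel (mono t U) k = {α : σ →₀ ℕ | α ∉ U ∧ α.degree ≤ k}.ncard := by
  have hc : (U ∪ {α : σ →₀ ℕ | k + 1 ≤ α.degree})ᶜ = {α : σ →₀ ℕ | α ∉ U ∧ α.degree ≤ k} := by
    ext α
    simp only [Set.compl_union, Set.mem_inter_iff, Set.mem_compl_iff, Set.mem_ofPred_eq, not_le,
      Nat.lt_succ_iff]
  rw [hilbertSamuel, ← ht.1, pow_eq_mono, ← mono_union,
    length_quotient_mono ht _ (hU.union (isUpperSet_degree _)), hc]
  rw [hc]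
  exact (finite_degree_lt (k + 1)).subset fun α hα => Nat.lt_succ_iff.2 hα.2

/-- A regular local ring is a domain. -/
lemma IsRegularSystem.isDomain (ht : IsRegularSystem t) : IsDomain R := by
  obtain ⟨Φ, -, hpow, -⟩ := exists_toPowerSeries ht
  have hinj : Function.Injective Φ := by
    rw [injective_iff_map_eq_zero]
    intro f hf
    have h1 : f ∈ (⨅ n, maximalIdeal R ^ n : Ideal R) := by
      rw [Ideal.mem_iInf]
      exact fun n => (hpow n f).1 fun d _ => by rw [hf, map_zero]
    rwa [Ideal.iInf_pow_eq_bot_of_isLocalRing _ (Ideal.IsPrime.ne_top inferInstance)] at h1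
  have : IsDomain (MvPowerSeries σ (ResidueField R)) := NoZeroDivisors.to_isDomain _
  exact hinj.isDomain Φ

end Criterion

/-! ### Power series ideals detected on coefficients -/

section Coefficients

variable {κ σ : Type*} [Field κ]

/-- A power series all of whose monomials are divisible by one of finitely many monomials is in the
ideal that they generate. -/
lemma mem_span_monomial_of_coeff_eq_zero (U : Finset (σ →₀ ℕ)) (f : MvPowerSeries σ κ)
    (hf : ∀ d : σ →₀ ℕ, (∀ α ∈ U, ¬ α ≤ d) → MvPowerSeries.coeff d f = 0) :
    f ∈ Ideal.span ((fun α => MvPowerSeries.monomial α (1 : κ)) '' (U : Set (σ →₀ ℕ))) := by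
  classical
  have hex : ∀ d : σ →₀ ℕ, ¬ (∀ α ∈ U, ¬ α ≤ d) → ∃ α ∈ U, α ≤ d := fun d hd => by
    by_contra! h
    exact hd h
  -- Each exponent is assigned to a single generator dividing it, so that every term of `f` is used
  -- exactly once.
  choose c hcU hc using hex
  let G : (σ →₀ ℕ) → MvPowerSeries σ κ := fun α e =>
    if h : ¬ ∀ β ∈ U, ¬ β ≤ e + α then
      if c (e + α) h = α then MvPowerSeries.coeff (e + α) f else 0 else 0
  have hG : ∀ α d, MvPowerSeries.coeff d (MvPowerSeries.monomial α (1 : κ) * G α) =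
      if h : ¬ ∀ β ∈ U, ¬ β ≤ d then if c d h = α then MvPowerSeries.coeff d f else 0 else 0 := by
    intro α d
    rw [MvPowerSeries.coeff_monomial_mul, one_mul]
    by_cases hαd : α ≤ d
    · rw [if_pos hαd]
      change (if h : ¬ ∀ β ∈ U, ¬ β ≤ d - α + α then
        if c (d - α + α) h = α then MvPowerSeries.coeff (d - α + α) f else 0 else 0) = _
      simp only [tsub_add_cancel_of_le hαd]
    · rw [if_neg hαd]
      split_ifs with h1 h2
      · rfl
      · exact absurd (h2 ▸ hc d h1) hαd
      · rfl
  have hsum : f = ∑ α ∈ U, MvPowerSeries.monomial α (1 : κ) * G α := by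
    ext d
    rw [map_sum]
    simp_rw [hG]
    by_cases hd : ∀ α ∈ U, ¬ α ≤ d
    · rw [hf d hd]
      simp only [dif_neg (not_not.2 hd), Finset.sum_const_zero]
    · simp only [dif_pos hd, Finset.sum_ite_eq, if_pos (hcU d hd)]
  rw [hsum]
  exact sum_mem fun α hα => Ideal.mul_mem_right _ _ (Ideal.subset_span ⟨α, hα, rfl⟩)

lemma coeff_mul_eq_zero_of_degree_lt {n : ℕ} {f : MvPowerSeries σ κ}
    (hf : ∀ d : σ →₀ ℕ, d.degree < n → MvPowerSeries.coeff d f = 0) (g : MvPowerSeries σ κ)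
    (d : σ →₀ ℕ) (hd : d.degree < n) : MvPowerSeries.coeff d (f * g) = 0 := by
  classical
  rw [MvPowerSeries.coeff_mul]
  refine Finset.sum_eq_zero fun p hp => ?_
  rw [hf p.1, zero_mul]
  refine lt_of_le_of_lt (Finsupp.degree_mono ?_) hd
  rw [← Finset.HasAntidiagonal.mem_antidiagonal.1 hp]
  exact le_self_add

end Coefficients

/-! ### The power series ring is complete and regular -/

section PowerSeriesRing

variable (κ : Type*) [Field κ] (σ : Type*) [Fintype σ]

variable {κ σ} in
lemma mem_span_X_of_coeff_eq_zero (τ : Set σ) (f : MvPowerSeries σ κ)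
    (hf : ∀ d : σ →₀ ℕ, (∀ i ∈ τ, d i = 0) → MvPowerSeries.coeff d f = 0) :
    f ∈ Ideal.span (MvPowerSeries.X '' τ) := by
  classical
  have h1 := mem_span_monomial_of_coeff_eq_zero (κ := κ)
    ((Finset.univ.filter (· ∈ τ)).image fun i => Finsupp.single i 1) f
      (fun d hd => hf d fun i hi => by
      by_contra h
      refine hd (Finsupp.single i 1) (by
        simp only [Finset.mem_image, Finset.mem_filter, Finset.mem_univ, true_and]
        exact ⟨i, hi, rfl⟩) ?_
      rw [Finsupp.single_le_iff]
      omega)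
  refine Ideal.span_mono ?_ h1
  rintro _ ⟨α, hα, rfl⟩
  simp only [Finset.coe_image, Finset.coe_filter, Finset.mem_univ, true_and, Set.mem_image,
    Set.mem_ofPred_eq] at hα
  obtain ⟨i, hi, rfl⟩ := hα
  exact ⟨i, hi, rfl⟩

lemma maximalIdeal_mvPowerSeries :
    maximalIdeal (MvPowerSeries σ κ) = Ideal.span (Set.range MvPowerSeries.X) := by
  refine le_antisymm (fun f hf => ?_) (Ideal.span_le.2 ?_)
  · rw [← Set.image_univ]
    refine mem_span_X_of_coeff_eq_zero _ _ fun d hd => ?_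
    have : d = 0 := Finsupp.ext fun i => hd i trivial
    subst this
    by_contra h
    exact (mem_maximalIdeal _).1 hf
      (MvPowerSeries.isUnit_iff_constantCoeff.2 (isUnit_iff_ne_zero.2 h))
  · rintro _ ⟨i, rfl⟩
    rw [SetLike.mem_coe, mem_maximalIdeal, mem_nonunits_iff, MvPowerSeries.isUnit_iff_constantCoeff]
    simp

variable {κ σ} in
lemma mem_maximalIdeal_pow_of_coeff_eq_zero {n : ℕ} {f : MvPowerSeries σ κ}
    (hf : ∀ d : σ →₀ ℕ, d.degree < n → MvPowerSeries.coeff d f = 0) :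
    f ∈ maximalIdeal (MvPowerSeries σ κ) ^ n := by
  classical
  have h1 := mem_span_monomial_of_coeff_eq_zero (κ := κ)
    ((finite_degree_lt (σ := σ) (n + 1)).toFinset.filter fun α => n ≤ α.degree) f (fun d hd =>
      hf d (by
        by_contra h
        obtain ⟨e, he, hed⟩ : ∃ e : σ →₀ ℕ, e.degree = n ∧ e ≤ d := by
          obtain ⟨e, he⟩ := Finsupp.exists_le_degree_eq d n (not_lt.1 h)
          exact ⟨e, he.2, he.1⟩
        exact hd e (by simp [he]) hed))
  refine (Ideal.span_le.2 ?_) h1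
  rintro _ ⟨α, hα, rfl⟩
  have hα' : n ≤ α.degree := (Finset.mem_filter.1 hα).2
  refine Ideal.pow_le_pow_right hα' ?_
  change MvPowerSeries.monomial α (1 : κ) ∈ _
  rw [← tmon_X]
  refine tmon_mem_pow (fun i => ?_) α
  rw [maximalIdeal_mvPowerSeries]
  exact Ideal.subset_span ⟨i, rfl⟩

instance isAdicComplete_mvPowerSeries :
    IsAdicComplete (maximalIdeal (MvPowerSeries σ κ)) (MvPowerSeries σ κ) := by
  rw [maximalIdeal_mvPowerSeries]
  infer_instance

/-- Only this bound needs an induction on the variables; the opposite one comes from the number of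
generators of the maximal ideal. -/
lemma le_ringKrullDim_mvPowerSeries_fin (n : ℕ) :
    (n : WithBot ℕ∞) ≤ ringKrullDim (MvPowerSeries (Fin n) κ) := by
  induction n with
  | zero => simpa using ringKrullDim_nonneg_of_nontrivial
  | succ n ih =>
    rw [ringKrullDim_eq_of_ringEquiv (MvPowerSeries.finSuccEquiv κ n).toRingEquiv]
    refine le_trans ?_
      (ringKrullDim_succ_le_ringKrullDim_powerseries (R := MvPowerSeries (Fin n) κ))
    push_cast
    gcongr

theorem isRegularSystem_X :
    IsRegularSystem (MvPowerSeries.X : σ → MvPowerSeries σ κ) := by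
  refine ⟨(maximalIdeal_mvPowerSeries κ σ).symm, le_antisymm ?_ ?_⟩
  · refine (ringKrullDim_le_spanFinrank_maximalIdeal _).trans ?_
    rw [maximalIdeal_mvPowerSeries]
    have h1 := Submodule.spanFinrank_span_le_ncard_of_finite (R := MvPowerSeries σ κ)
      (Set.finite_range (MvPowerSeries.X : σ → MvPowerSeries σ κ))
    have h2 : (Set.range (MvPowerSeries.X : σ → MvPowerSeries σ κ)).ncard ≤ Fintype.card σ := by
      rw [← Set.image_univ, ← Nat.card_eq_fintype_card, ← Set.ncard_univ]
      exact Set.ncard_image_le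
    exact_mod_cast h1.trans h2
  · rw [ringKrullDim_eq_of_ringEquiv
      (MvPowerSeries.renameEquiv κ (Fintype.equivFin σ)).toRingEquiv]
    exact le_ringKrullDim_mvPowerSeries_fin κ _

end PowerSeriesRing

/-- A complete regular local ring of equal characteristic zero is a ring of formal power series. -/
theorem exists_ringEquiv_mvPowerSeries {R : Type*} [CommRing R] [IsLocalRing R]
    [IsNoetherianRing R] [Algebra ℚ R] [IsAdicComplete (maximalIdeal R) R] {σ : Type*} [Fintype σ]
    {t : σ → R} (ht : IsRegularSystem t) :
    ∃ Φ : R ≃+* MvPowerSeries σ (ResidueField R), ∀ i, Φ (t i) = MvPowerSeries.X i := by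
  obtain ⟨Φ, hX, hpow, hsurj⟩ := exists_toPowerSeries ht
  refine ⟨RingEquiv.ofBijective Φ ⟨?_, fun g => ?_⟩, hX⟩
  · rw [injective_iff_map_eq_zero]
    intro f hf
    have h1 : f ∈ (⨅ n, maximalIdeal R ^ n : Ideal R) := by
      rw [Ideal.mem_iInf]
      exact fun n => (hpow n f).1 fun d _ => by rw [hf, map_zero]
    rwa [Ideal.iInf_pow_eq_bot_of_isLocalRing _ (Ideal.IsPrime.ne_top inferInstance)] at h1
  · choose f hf using fun n => hsurj n g
    obtain ⟨L, hL⟩ := IsPrecomplete.prec (I := maximalIdeal R) (M := R) inferInstance (f := f) (by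
      intro m n h
      rw [SModEq.sub_mem, smul_eq_mul, Ideal.mul_top, ← hpow]
      intro d hd
      rw [map_sub, map_sub, hf m d hd, hf n d (hd.trans_le h), sub_self])
    refine ⟨L, ?_⟩
    ext d
    have h1 := hL (d.degree + 1)
    rw [SModEq.sub_mem, smul_eq_mul, Ideal.mul_top, ← hpow] at h1
    have h2 := h1 d (Nat.lt_succ_self _)
    rw [map_sub, map_sub, sub_eq_zero, hf _ d (Nat.lt_succ_self _)] at h2
    exact h2.symm

/-! ### Products of primes -/

section Factorization

/-- `a` is a product of primes. -/
def HasPrimeFactors {A : Type*} [CommMonoidWithZero A] (a : A) : Prop :=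
  ∃ s : Multiset A, (∀ b ∈ s, Prime b) ∧ Associated s.prod a

variable {A : Type*} [CommMonoidWithZero A]

lemma HasPrimeFactors.mul {a b : A} (ha : HasPrimeFactors a) (hb : HasPrimeFactors b) :
    HasPrimeFactors (a * b) := by
  obtain ⟨s, hs, hsa⟩ := ha
  obtain ⟨r, hr, hrb⟩ := hb
  refine ⟨s + r, fun c hc => (Multiset.mem_add.1 hc).elim (hs c) (hr c), ?_⟩
  rw [Multiset.prod_add]
  exact hsa.mul_mul hrb

lemma hasPrimeFactors_of_isUnit {a : A} (ha : IsUnit a) : HasPrimeFactors a :=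
  ⟨0, by simp, by simpa using (associated_one_iff_isUnit.2 ha).symm⟩

lemma Prime.hasPrimeFactors {a : A} (ha : Prime a) : HasPrimeFactors a :=
  ⟨{a}, by simpa using ha, by simp⟩

lemma HasPrimeFactors.of_mulEquiv {B : Type*} [CommMonoidWithZero B] (e : A ≃* B) {a : A}
    (h : HasPrimeFactors (e a)) : HasPrimeFactors a := by
  obtain ⟨s, hs, hsa⟩ := h
  refine ⟨s.map e.symm, fun b hb => ?_, ?_⟩
  · obtain ⟨c, hc, rfl⟩ := Multiset.mem_map.1 hb
    exact (MulEquiv.prime_iff e.symm).2 (hs c hc)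
  · have h1 := hsa.map e.symm
    rwa [e.symm_apply_apply, map_multiset_prod] at h1

end Factorization

/-! ### Prime factorization by Weierstrass preparation -/

section Weierstrass

open Polynomial

variable {A : Type*} [CommRing A] [IsLocalRing A]

/-- Modulo the maximal ideal `f` is a power of `X`, and a monic divisor of a power of `X` over a
field is again a power of `X`. -/
lemma isDistinguishedAt_of_dvd {f p : A[X]} (hf : f.IsDistinguishedAt (maximalIdeal A))
    (hp : p.Monic) (hpf : p ∣ f) : p.IsDistinguishedAt (maximalIdeal A) := by
  have h1 : p.map (residue A) ∣ X ^ f.natDegree := by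
    have h2 := Polynomial.map_dvd (residue A) hpf
    rwa [show f.map (residue A) = X ^ f.natDegree from hf.map_eq_X_pow] at h2
  obtain ⟨i, -, hi⟩ := (dvd_prime_pow Polynomial.prime_X _).1 h1
  have h3 : p.map (residue A) = X ^ i :=
    eq_of_monic_of_associated (hp.map _) (monic_X_pow i) hi
  have h4 : i = p.natDegree := by
    rw [← hp.natDegree_map (residue A), h3, natDegree_X_pow]
  refine ⟨⟨fun {n} hn => ?_⟩, hp⟩
  rw [← residue_eq_zero_iff, ← coeff_map, h3, coeff_X_pow, if_neg (by omega)]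

variable [IsAdicComplete (maximalIdeal A) A]

/-- Weierstrass division identifies the quotients of the polynomial ring and of the power series
ring by a distinguished polynomial, so both are domains. -/
lemma prime_coe_of_isDistinguishedAt {p : A[X]} (hp : p.IsDistinguishedAt (maximalIdeal A))
    (hprime : Prime p) : Prime (p : PowerSeries A) := by
  have h0 : (p : PowerSeries A) ≠ 0 := by simpa using hprime.ne_zero
  rw [← Ideal.span_singleton_prime h0, ← Ideal.Quotient.isDomain_iff_prime]
  have : IsDomain (A[X] ⧸ Ideal.span {p}) :=
    (Ideal.Quotient.isDomain_iff_prime _).2 ((Ideal.span_singleton_prime hprime.ne_zero).2 hprime)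
  exact (hp.algEquivQuotient (I := maximalIdeal A)).symm.toMulEquiv.isDomain _

variable [IsDomain A] [UniqueFactorizationMonoid A]

/-- Induction on the degree. An irreducible factor in the factorial ring `A[X]`, rescaled to be
monic, is prime and distinguished, so it remains prime among power series. -/
lemma hasPrimeFactors_coe_of_isDistinguishedAt (f : A[X])
    (hf : f.IsDistinguishedAt (maximalIdeal A)) : HasPrimeFactors (f : PowerSeries A) := by
  obtain ⟨n, hn⟩ : ∃ n, f.natDegree = n := ⟨_, rfl⟩
  induction n using Nat.strong_induction_on generalizing f with
  | _ n ih =>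
    rcases Nat.eq_zero_or_pos n with rfl | hpos
    · rw [hf.monic.natDegree_eq_zero.1 hn]
      exact hasPrimeFactors_of_isUnit (by simp)
    · have hfu : ¬ IsUnit f := fun h => by
        rw [hf.monic.isUnit_iff] at h
        simp [h] at hn; omega
      obtain ⟨p, hp, q, hq⟩ := WfDvdMonoid.exists_irreducible_factor hfu hf.monic.ne_zero
      have hlead : p.leadingCoeff * q.leadingCoeff = 1 := by
        rw [← leadingCoeff_mul, ← hq]; exact hf.monic
      have hlead' : IsUnit p.leadingCoeff := .of_mul_eq_one _ hlead
      have hfac : f = (C q.leadingCoeff * p) * (C p.leadingCoeff * q) := by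
        calc f = C (p.leadingCoeff * q.leadingCoeff) * (p * q) := by rw [hlead, C_1, one_mul, hq]
          _ = _ := by rw [C_mul]; ring
      have hpm : (C q.leadingCoeff * p).Monic := by
        rw [Monic, leadingCoeff_mul, leadingCoeff_C, mul_comm, hlead]
      have hqm : (C p.leadingCoeff * q).Monic := by
        rw [Monic, leadingCoeff_mul, leadingCoeff_C, hlead]
      have hpp : Prime (C q.leadingCoeff * p) := by
        have hass : Associated p (C q.leadingCoeff * p) := by
          rw [mul_comm]
          exact (associated_mul_unit_left _ _
            (isUnit_C.2 (.of_mul_eq_one p.leadingCoeff (by rw [mul_comm, hlead])))).symm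
        exact hass.prime hp.prime
      have hpdeg : (C q.leadingCoeff * p).natDegree ≠ 0 := fun h =>
        hpp.not_isUnit (by rw [hpm.natDegree_eq_zero.1 h]; exact isUnit_one)
      have hdeg : (C q.leadingCoeff * p).natDegree + (C p.leadingCoeff * q).natDegree = n := by
        rw [← hpm.natDegree_mul hqm, ← hfac, hn]
      rw [hfac, Polynomial.coe_mul]
      refine HasPrimeFactors.mul ?_ (ih _ (by omega) _
        (isDistinguishedAt_of_dvd hf hqm (hfac ▸ dvd_mul_left _ _)) rfl)
      exact Prime.hasPrimeFactors (prime_coe_of_isDistinguishedAt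
        (isDistinguishedAt_of_dvd hf hpm (Dvd.intro _ hfac.symm)) hpp)

/-- By Weierstrass preparation the series is a distinguished polynomial up to a unit. -/
lemma hasPrimeFactors_of_map_residue_ne_zero {g : PowerSeries A}
    (hg : g.map (residue A) ≠ 0) : HasPrimeFactors g := by
  obtain ⟨f, h, H⟩ := PowerSeries.exists_isWeierstrassFactorization hg
  rw [H.eq_mul]
  exact (hasPrimeFactors_coe_of_isDistinguishedAt f H.isDistinguishedAt).mul
    (hasPrimeFactors_of_isUnit H.isUnit)

end Weierstrass

/-! ### Factoriality of regular local rings containing the rationals -/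

section UniqueFactorization

instance isDomain_mvPowerSeries (κ : Type*) [Field κ] (σ : Type*) : IsDomain (MvPowerSeries σ κ) :=
  NoZeroDivisors.to_isDomain _

/-- Rings of formal power series over fields of characteristic zero are factorial. -/
theorem uniqueFactorizationMonoid_mvPowerSeries_fin (n : ℕ) : ∀ (κ : Type u) [Field κ] [CharZero κ],
    UniqueFactorizationMonoid (MvPowerSeries (Fin n) κ) := by
  induction n with
  | zero =>
    intro κ _ _
    exact (MvPowerSeries.isEmptyEquiv (Fin 0) κ).toMulEquiv.symm.uniqueFactorizationMonoid
      inferInstance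
  | succ n ih =>
    intro κ _ _
    refine .of_exists_prime_factors fun f hf0 => ?_
    change HasPrimeFactors f
    by_cases hfu : IsUnit f
    · exact hasPrimeFactors_of_isUnit hfu
    -- Weierstrass preparation needs a variable on whose axis `f` is nonzero. A general linear
    -- change of coordinates provides it, and the swap below puts it first.
    obtain ⟨t', i, ht', hft'⟩ := exists_isRegularSystem_notMem (isRegularSystem_X κ (Fin (n + 1)))
      hf0 ((mem_maximalIdeal f).2 hfu)
    have ht'' : IsRegularSystem (t' ∘ Equiv.swap 0 i) :=
      ⟨by rw [Set.range_comp, Equiv.range_eq_univ, Set.image_univ, ht'.1], ht'.2⟩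
    -- The new coordinates become variables over the residue field, a type different from `κ`; hence
    -- the induction hypothesis must cover all fields.
    obtain ⟨Φ, hΦ⟩ := exists_ringEquiv_mvPowerSeries ht''
    set κ' := ResidueField (MvPowerSeries (Fin (n + 1)) κ)
    have := ih κ'
    refine .of_mulEquiv (Φ.toMulEquiv.trans (MvPowerSeries.finSuccEquiv κ' n).toMulEquiv) ?_
    refine hasPrimeFactors_of_map_residue_ne_zero (A := MvPowerSeries (Fin n) κ') fun h0 => hft' ?_
    have h1 : Φ f ∈ Ideal.span (MvPowerSeries.X '' {j : Fin (n + 1) | j ≠ 0}) := by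
      refine mem_span_X_of_coeff_eq_zero _ _ fun d hd => ?_
      obtain ⟨k, hk⟩ : ∃ k : ℕ, d = (0 : Fin n →₀ ℕ).cons k := by
        refine ⟨d 0, ?_⟩
        ext j
        refine Fin.cases ?_ (fun k => ?_) j
        · simp
        · simp [hd k.succ (Fin.succ_ne_zero k)]
      rw [hk, ← MvPowerSeries.coeff_coeff_finSuccEquiv]
      have h2 := congr(PowerSeries.coeff k $h0)
      rw [PowerSeries.coeff_map, map_zero, residue_eq_zero_iff, mem_maximalIdeal, mem_nonunits_iff,
        MvPowerSeries.isUnit_iff_constantCoeff, isUnit_iff_ne_zero, not_not] at h2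
      exact h2
    have h3 := Ideal.mem_map_of_mem Φ.symm.toRingHom h1
    rw [Ideal.map_span] at h3
    have h4 : Φ.symm.toRingHom (Φ f) = f := Φ.symm_apply_apply f
    rw [h4] at h3
    refine Ideal.span_mono ?_ h3
    rintro _ ⟨_, ⟨j, hj, rfl⟩, rfl⟩
    refine ⟨Equiv.swap 0 i j, fun h => hj ?_, ?_⟩
    · rw [← Equiv.swap_apply_left 0 i] at h
      exact (Equiv.swap 0 i).injective h
    · change _ = Φ.symm (MvPowerSeries.X j)
      rw [← hΦ, Φ.symm_apply_apply]
      rfl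

theorem uniqueFactorizationMonoid_mvPowerSeries (κ : Type*) [Field κ] [CharZero κ] (σ : Type*)
    [Fintype σ] : UniqueFactorizationMonoid (MvPowerSeries σ κ) :=
  (MvPowerSeries.renameEquiv κ (Fintype.equivFin σ)).toMulEquiv.symm.uniqueFactorizationMonoid
    (uniqueFactorizationMonoid_mvPowerSeries_fin _ κ)

/-- A regular local ring of equal characteristic zero is factorial: irreducible elements are prime
since ideal quotients extend to the completion. -/
theorem IsRegularSystem.irreducible_iff_prime {R : Type*} [CommRing R] [IsLocalRing R]
    [IsNoetherianRing R] [Algebra ℚ R] {σ : Type*} [Fintype σ] {t : σ → R}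
    (ht : IsRegularSystem t) {p : R} (hp : Irreducible p) : Prime p := by
  have := ht.isDomain
  refine ⟨hp.ne_zero, hp.not_isUnit, fun a b hab => ?_⟩
  by_cases hpa : p ∣ a
  · exact Or.inl hpa
  right
  obtain ⟨Φ, hX, hpow, hsurj⟩ := exists_toPowerSeries ht
  have := uniqueFactorizationMonoid_mvPowerSeries (ResidueField R) σ
  have hinj : ∀ r, Φ r = 0 → r = 0 := by
    intro f hf
    have h1 : f ∈ (⨅ n, maximalIdeal R ^ n : Ideal R) := by
      rw [Ideal.mem_iInf]
      exact fun n => (hpow n f).1 fun d _ => by rw [hf, map_zero]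
    rwa [Ideal.iInf_pow_eq_bot_of_isLocalRing _ (Ideal.IsPrime.ne_top inferInstance)] at h1
  have hp0 : Φ p ≠ 0 := fun h => hp.ne_zero (hinj p h)
  -- In the completion, `h` is `p` divided by its greatest common divisor with `a`. It turns out to
  -- generate the extension of the ideal quotient `(p : a)`.
  obtain ⟨h, a₁, c, hrel, hch, hca⟩ :=
    UniqueFactorizationMonoid.exists_reduced_factors (Φ p) hp0 (Φ a)
  have hc0 : c ≠ 0 := by rintro rfl; simp at hch; exact hp0 hch.symm
  have hh0 : h ≠ 0 := by rintro rfl; simp at hch; exact hp0 hch.symm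
  let I : Ideal R := (Ideal.span {p}).colon {a}
  have hI : ∀ r, r ∈ I ↔ ∃ r', r * a = r' * p := by
    intro r
    rw [Submodule.mem_colon_singleton, smul_eq_mul, Ideal.mem_span_singleton']
    simp only [eq_comm]
  have hIh : ∀ r ∈ I, h ∣ Φ r := by
    intro r hr
    obtain ⟨r', hr'⟩ := (hI r).1 hr
    have h1 := congr(Φ $hr')
    rw [map_mul, map_mul, ← hca, ← hch] at h1
    have h2 : Φ r * a₁ = h * Φ r' := mul_left_cancel₀ hc0 (by linear_combination h1)
    exact hrel.dvd_of_dvd_mul_right (Dvd.intro _ h2.symm)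
  -- The relation `h * a = a₁ * p` in the completion is approximated in `R`. By Artin-Rees the error
  -- is a combination of `a` and `p` with coefficients in `m ^ k`, and correcting by these puts an
  -- approximation of `h` into `I`.
  have hhI : h ∈ I.map Φ := by
    refine mem_of_forall_mem_sup_pow fun k => ?_
    obtain ⟨m, hm⟩ := Ideal.exists_pow_inf_eq_pow_smul (maximalIdeal R) (Ideal.span {a, p})
    obtain ⟨u, hu⟩ := hsurj (k + m) h
    obtain ⟨u', hu'⟩ := hsurj (k + m) a₁
    have h1 : u * a - u' * p ∈ maximalIdeal R ^ (k + m) := by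
      rw [← hpow]
      intro d hd
      have h2 : Φ (u * a - u' * p) = (Φ u - h) * Φ a - (Φ u' - a₁) * Φ p := by
        rw [map_sub, map_mul, map_mul, ← hca, ← hch]; ring
      rw [h2, map_sub, coeff_mul_eq_zero_of_degree_lt
        (fun e he => by rw [map_sub, hu e he, sub_self]) _ d hd, coeff_mul_eq_zero_of_degree_lt
        (fun e he => by rw [map_sub, hu' e he, sub_self]) _ d hd, sub_self]
    have h2 : u * a - u' * p ∈ maximalIdeal R ^ k * Ideal.span {a, p} := by
      have h3 := hm (k + m) (Nat.le_add_left _ _)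
      rw [Nat.add_sub_cancel, smul_eq_mul, Ideal.mul_top] at h3
      have h4 : u * a - u' * p ∈ maximalIdeal R ^ (k + m) ⊓ Ideal.span {a, p} := by
        refine ⟨h1, sub_mem (Ideal.mul_mem_left _ _ (Ideal.subset_span (by simp)))
          (Ideal.mul_mem_left _ _ (Ideal.subset_span (by simp)))⟩
      rw [h3] at h4
      exact Ideal.mul_mono le_rfl inf_le_right h4
    rw [Ideal.span_insert, Ideal.mul_sup, Submodule.mem_sup] at h2
    obtain ⟨_, hx, _, hy, hxy⟩ := h2
    obtain ⟨e, he, rfl⟩ := Ideal.mem_mul_span_singleton.1 hx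
    obtain ⟨e', he', rfl⟩ := Ideal.mem_mul_span_singleton.1 hy
    have h5 : u - e ∈ I := (hI _).2 ⟨u' + e', by linear_combination -hxy⟩
    have h6 : h = Φ (u - e) + (Φ e + (h - Φ u)) := by rw [map_sub]; ring
    rw [h6]
    refine Submodule.add_mem_sup (Ideal.mem_map_of_mem _ h5) (add_mem ?_ ?_)
    · exact mem_maximalIdeal_pow_of_coeff_eq_zero ((hpow k e).2 he)
    · exact mem_maximalIdeal_pow_of_coeff_eq_zero
        fun d hd => by rw [map_sub, hu d (by omega), sub_self]
  -- Otherwise `I` extends into `h` times the maximal ideal; as `h` lies in the extension,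
  -- cancelling `h` would put `1` in the maximal ideal.
  obtain ⟨r, hrI, v, hv, hrv⟩ : ∃ r ∈ I, ∃ v, IsUnit v ∧ Φ r = h * v := by
    by_contra! hcon
    have h1 : I.map Φ ≤ Ideal.span {h} * maximalIdeal _ := by
      rw [Ideal.map_le_iff_le_comap]
      intro r hr
      obtain ⟨v, hv⟩ := hIh r hr
      rw [Ideal.mem_comap, hv]
      exact Ideal.mul_mem_mul (Ideal.mem_span_singleton_self h)
        ((IsLocalRing.mem_maximalIdeal v).2 fun hu => hcon r hr v hu hv)
    obtain ⟨z, hz, hz'⟩ := Ideal.mem_span_singleton_mul.1 (h1 hhI)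
    have h2 : z = 1 := mul_left_cancel₀ hh0 (by rw [hz', mul_one])
    exact (IsLocalRing.mem_maximalIdeal z).1 hz (h2 ▸ isUnit_one)
  have hIr : ∀ x ∈ I, r ∣ x := by
    intro x hx
    rw [← Ideal.mem_span_singleton]
    refine mem_of_forall_mem_sup_pow fun k => ?_
    obtain ⟨w, hw⟩ : Φ r ∣ Φ x := by
      rw [hrv]
      exact ((IsUnit.mul_right_dvd hv).2 dvd_rfl).trans (hIh x hx)
    obtain ⟨y, hy⟩ := hsurj k w
    have h1 : x - r * y ∈ maximalIdeal R ^ k := by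
      rw [← hpow]
      intro d hd
      have h2 : Φ (x - r * y) = (w - Φ y) * Φ r := by rw [map_sub, map_mul, hw]; ring
      rw [h2]
      exact coeff_mul_eq_zero_of_degree_lt (fun e he => by rw [map_sub, hy e he, sub_self]) _ d hd
    rw [← add_sub_cancel (r * y) x]
    exact Submodule.add_mem_sup (Ideal.mul_mem_right _ _ (Ideal.mem_span_singleton_self r)) h1
  obtain ⟨y, hy⟩ := hIr p ((hI p).2 ⟨a, mul_comm _ _⟩)
  have hbI : b ∈ I := by
    obtain ⟨z, hz⟩ := hab
    exact (hI b).2 ⟨z, by rw [mul_comm, hz, mul_comm]⟩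
  -- Now `r` generates `(p : a)`, and `p = r * y`. If `r` is a unit, then `p` divides `a`; if `y` is
  -- a unit, then `p` divides every element of the quotient, in particular `b`.
  rcases hp.isUnit_or_isUnit hy with hu | hu
  · have h1 : (1 : R) ∈ I := by
      obtain ⟨i, hi⟩ := hu.exists_left_inv
      rw [← hi]
      exact Ideal.mul_mem_left _ _ hrI
    obtain ⟨z, hz⟩ := (hI 1).1 h1
    exact absurd ⟨z, by rw [← one_mul a, hz, mul_comm]⟩ hpa
  · rw [hy]
    exact (hu.mul_right_dvd).2 (hIr b hbI)

/-- In a regular local ring of equal characteristic zero, a nonzero prime ideal, with no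
primes strictly between zero and it, is principal. -/
theorem IsRegularSystem.exists_eq_span_singleton {R : Type*} [CommRing R] [IsLocalRing R]
    [IsNoetherianRing R] [Algebra ℚ R] {σ : Type*} [Fintype σ] {t : σ → R}
    (ht : IsRegularSystem t) {P : Ideal R} (hP : P.IsPrime) (hP0 : P ≠ ⊥)
    (hmin : ∀ Q : Ideal R, Q.IsPrime → Q ≠ ⊥ → Q ≤ P → Q = P) :
    ∃ p, Prime p ∧ P = Ideal.span {p} := by
  have := ht.isDomain
  have hU : UniqueFactorizationMonoid R :=
    { irreducible_iff_prime := ⟨ht.irreducible_iff_prime, Prime.irreducible⟩ }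
  obtain ⟨p, hpP, hp⟩ := Ideal.IsPrime.exists_mem_prime_of_ne_bot hP hP0
  refine ⟨p, hp, (hmin _ ((Ideal.span_singleton_prime hp.ne_zero).2 hp) ?_ ?_).symm⟩
  · simpa using hp.ne_zero
  · exact (Ideal.span_singleton_le_iff_mem _).2 hpP

end UniqueFactorization

/-! ### Linear independence in the cotangent space, relative to an ideal -/

section IndepMod

variable {A : Type*} [CommRing A] [IsLocalRing A] {ι : Type*} [Fintype ι]

/-- The elements `y` of the maximal ideal are linearly independent modulo its square and `S`. If
`A ⧸ S` is regular, this means that they are part of a regular system of coordinates of it. -/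
def IndepMod (S : Ideal A) (y : ι → A) : Prop :=
  (∀ j, y j ∈ maximalIdeal A) ∧
    ∀ c : ι → A, ∑ j, c j * y j ∈ maximalIdeal A ^ 2 ⊔ S → ∀ j, c j ∈ maximalIdeal A

lemma IndepMod.comp {S : Ideal A} {y : ι → A} (h : IndepMod S y) {ι' : Type*} [Fintype ι']
    {f : ι' → ι} (hf : Function.Injective f) : IndepMod S (y ∘ f) := by
  refine ⟨fun j => h.1 _, fun c hc j => ?_⟩
  have h1 : ∑ j, Function.extend f c 0 j * y j = ∑ j, c j * (y ∘ f) j := by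
    refine (Fintype.sum_of_injective f hf _ _ (fun i hi => ?_) fun i => ?_).symm
    · rw [Function.extend_apply' _ _ _ (by simpa using hi)]; simp
    · rw [hf.extend_apply]; rfl
  have := h.2 _ (h1 ▸ hc) (f j)
  rwa [hf.extend_apply] at this

lemma IndepMod.congr {S : Ideal A} (hS : S ≤ maximalIdeal A) {y y' u : ι → A} (h : IndepMod S y)
    (hu : ∀ j, IsUnit (u j)) (hy : ∀ j, y' j - u j * y j ∈ maximalIdeal A ^ 2 ⊔ S) :
    IndepMod S y' := by
  have hle : maximalIdeal A ^ 2 ⊔ S ≤ maximalIdeal A :=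
    sup_le (Ideal.pow_le_self two_ne_zero) hS
  refine ⟨fun j => ?_, fun c hc j => ?_⟩
  · rw [← sub_add_cancel (y' j) (u j * y j)]
    exact add_mem (hle (hy j)) (Ideal.mul_mem_left _ _ (h.1 j))
  · have h1 : ∑ j, (c j * u j) * y j =
        ∑ j, c j * y' j - ∑ j, c j * (y' j - u j * y j) := by
      rw [← Finset.sum_sub_distrib]
      exact Finset.sum_congr rfl fun j _ => by ring
    have h2 := h.2 (fun j => c j * u j)
      (h1 ▸ sub_mem hc (Ideal.sum_mem _ fun j _ => Ideal.mul_mem_left _ _ (hy j))) j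
    exact (Ideal.IsPrime.mem_or_mem inferInstance h2).resolve_right
      fun h3 => (mem_maximalIdeal _).1 h3 (hu j)

/-- Independent elements are pairwise non-associated, modulo the square of the maximal ideal. -/
lemma IndepMod.eq_of_sub_mem {S : Ideal A} {y : ι → A} (h : IndepMod S y) {u v : A}
    (hu : IsUnit u) {j k : ι} (hjk : u * y j - v * y k ∈ maximalIdeal A ^ 2 ⊔ S) : j = k := by
  classical
  by_contra hne
  have h1 := h.2 (fun i => if i = j then u else if i = k then -v else 0) (by
    rw [Finset.sum_eq_add j k hne]
    · simpa [Ne.symm hne, sub_eq_add_neg] using hjk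
    · rintro i - ⟨hi, hi'⟩
      simp [hi, hi']
    · simp
    · simp) j
  simp only [if_true] at h1
  exact (mem_maximalIdeal _).1 h1 hu

lemma IndepMod.mem_of_mul_mem {S : Ideal A} {y : ι → A} (h : IndepMod S y) {u : A} {j : ι}
    (hj : u * y j ∈ maximalIdeal A ^ 2 ⊔ S) : u ∈ maximalIdeal A := by
  classical
  have h1 := h.2 (fun i => if i = j then u else 0) (by simpa using hj) j
  simpa using h1

lemma map_maximalIdeal_of_surjective {B : Type*} [CommRing B] [IsLocalRing B] {ρ : A →+* B}
    (hρ : Function.Surjective ρ) : (maximalIdeal A).map ρ = maximalIdeal B := by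
  have := hρ.isLocalHom
  have h : (maximalIdeal B).comap ρ = maximalIdeal A :=
    ((IsLocalRing.local_hom_TFAE ρ).out 0 4).1 this
  rw [← h]
  exact Ideal.map_comap_of_surjective _ hρ _

lemma comap_maximalIdeal_pow_sup {B : Type*} [CommRing B] [IsLocalRing B] {ρ : A →+* B}
    (hρ : Function.Surjective ρ) (n : ℕ) (S : Ideal B) :
    (maximalIdeal B ^ n ⊔ S).comap ρ = maximalIdeal A ^ n ⊔ S.comap ρ := by
  rw [← map_maximalIdeal_of_surjective hρ, ← Ideal.map_pow]
  conv_lhs => rw [← Ideal.map_comap_of_surjective ρ hρ S, ← Ideal.map_sup,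
    Ideal.comap_map_of_surjective _ hρ]
  rw [sup_assoc]
  congr 1
  exact sup_eq_left.2 (Ideal.comap_mono bot_le)

lemma comap_maximalIdeal_of_surjective {B : Type*} [CommRing B] [IsLocalRing B] {ρ : A →+* B}
    (hρ : Function.Surjective ρ) : (maximalIdeal B).comap ρ = maximalIdeal A := by
  have := hρ.isLocalHom
  exact ((IsLocalRing.local_hom_TFAE ρ).out 0 4).1 this

lemma indepMod_comap_iff {B : Type*} [CommRing B] [IsLocalRing B] {ρ : A →+* B}
    (hρ : Function.Surjective ρ) {S : Ideal B} {y : ι → A} :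
    IndepMod (S.comap ρ) y ↔ IndepMod S (ρ ∘ y) := by
  have hm : ∀ r, ρ r ∈ maximalIdeal B ↔ r ∈ maximalIdeal A := fun r => by
    rw [← comap_maximalIdeal_of_surjective hρ, Ideal.mem_comap]
  have hS : ∀ r, ρ r ∈ maximalIdeal B ^ 2 ⊔ S ↔ r ∈ maximalIdeal A ^ 2 ⊔ S.comap ρ := fun r => by
    rw [← comap_maximalIdeal_pow_sup hρ, Ideal.mem_comap]
  refine and_congr (forall_congr' fun j => (hm _).symm) ⟨fun h c hc j => ?_, fun h c hc j => ?_⟩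
  · choose d hd using fun j => hρ (c j)
    rw [← hd, hm]
    refine h d ?_ j
    rw [← hS]
    simpa [hd] using hc
  · rw [← hm]
    refine h (ρ ∘ c) ?_ j
    rw [← hS] at hc
    simpa using hc

/-- A relation is first read modulo `u`, which puts the coefficients of `v` in the maximal ideal.
The terms in `v` then lie in its square, and the relation becomes one among the `u` alone. -/
lemma indepMod_sumElim {κ : Type*} [Fintype κ] {S : Ideal A} {u : ι → A} {v : κ → A} :
    IndepMod S (Sum.elim u v) ↔
      IndepMod S u ∧ IndepMod (S ⊔ Ideal.span (Set.range u)) v := by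
  constructor
  · refine fun h => ⟨h.comp Sum.inl_injective, fun j => h.1 (Sum.inr j), fun c hc j => ?_⟩
    rw [← sup_assoc] at hc
    obtain ⟨p, hp, q, hq, hpq⟩ := Submodule.mem_sup.1 hc
    obtain ⟨d, rfl⟩ := (Ideal.mem_span_range_iff_exists_fun).1 hq
    refine h.2 (Sum.elim (fun i => - d i) c) ?_ (Sum.inr j)
    simp only [Fintype.sum_sum_type, Sum.elim_inl, Sum.elim_inr, neg_mul, Finset.sum_neg_distrib]
    rwa [← hpq, add_comm, add_neg_cancel_right]
  · rintro ⟨h1, h2⟩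
    refine ⟨Sum.rec h1.1 h2.1, fun c hc => ?_⟩
    have h3 : ∀ j, c (Sum.inr j) ∈ maximalIdeal A := by
      refine h2.2 (fun j => c (Sum.inr j)) ?_
      simp only [Fintype.sum_sum_type, Sum.elim_inl, Sum.elim_inr] at hc
      rw [← add_sub_cancel_left (∑ x, c (Sum.inl x) * u x) (∑ j, c (Sum.inr j) * v j), ← sup_assoc]
      exact sub_mem (Ideal.mem_sup_left hc)
        (Ideal.mem_sup_right (Ideal.sum_mem _ fun i _ =>
          Ideal.mul_mem_left _ _ (Ideal.subset_span ⟨i, rfl⟩)))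
    refine Sum.rec ?_ h3
    refine h1.2 (fun j => c (Sum.inl j)) ?_
    simp only [Fintype.sum_sum_type, Sum.elim_inl, Sum.elim_inr] at hc
    rw [← add_sub_cancel_right (∑ x, c (Sum.inl x) * u x) (∑ j, c (Sum.inr j) * v j)]
    refine sub_mem hc (Ideal.mem_sup_left (Ideal.sum_mem _ fun i _ => ?_))
    rw [pow_two]
    exact Ideal.mul_mem_mul (h3 i) (h2.1 i)

end IndepMod

/-! ### Quotients by coordinates and extension to coordinate systems -/

section RegularSystem

variable {R : Type*} [CommRing R] [IsLocalRing R] [IsNoetherianRing R]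
  {σ : Type*} [Fintype σ] {t : σ → R}

lemma IsRegularSystem.comp_equiv {R : Type*} [CommRing R] [IsLocalRing R] {t : σ → R}
    (ht : IsRegularSystem t) {κ : Type*} [Fintype κ] (e : κ ≃ σ) : IsRegularSystem (t ∘ e) :=
  ⟨by rw [e.surjective.range_comp]; exact ht.1, by rw [ht.2, Fintype.card_congr e]⟩

lemma spanFinrank_span_range_le {A : Type*} [CommRing A] (v : σ → A) :
    (Ideal.span (Set.range v)).spanFinrank ≤ Fintype.card σ := by
  refine (Submodule.spanFinrank_span_le_ncard_of_finite (Set.finite_range v)).trans ?_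
  rw [← Nat.card_eq_fintype_card, ← Set.image_univ, ← Set.ncard_univ]
  exact Set.ncard_image_le Set.finite_univ

lemma ringKrullDim_le_card (h : Ideal.span (Set.range t) = maximalIdeal R) :
    ringKrullDim R ≤ (Fintype.card σ : ℕ) := by
  refine (ringKrullDim_le_spanFinrank_maximalIdeal R).trans ?_
  rw [← h]
  exact_mod_cast spanFinrank_span_range_le t

lemma IsRegularSystem.spanFinrank_eq (ht : IsRegularSystem t) :
    (maximalIdeal R).spanFinrank = Fintype.card σ := by
  refine le_antisymm (by rw [← ht.1]; exact spanFinrank_span_range_le t) ?_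
  have := ringKrullDim_le_spanFinrank_maximalIdeal R
  rw [ht.2] at this
  exact_mod_cast this

/-- The images of `v` generate the maximal ideal, which bounds the dimension from above; dividing by
`u` lowers the dimension by at most the number of its elements, which bounds it from below. -/
lemma IsRegularSystem.of_surjective {ι κ : Type*} [Fintype ι] [Fintype κ] {u : ι → R} {v : κ → R}
    (ht : IsRegularSystem (Sum.elim u v)) {A : Type*} [CommRing A] [IsLocalRing A] {π : R →+* A}
    (hπ : Function.Surjective π) (hker : RingHom.ker π = Ideal.span (Set.range u)) :
    IsRegularSystem (π ∘ v) := by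
  have : IsNoetherianRing A := isNoetherianRing_of_surjective _ _ π hπ
  have h1 : Ideal.span (Set.range (π ∘ v)) = maximalIdeal A := by
    rw [← map_maximalIdeal_of_surjective hπ, ← ht.1, Ideal.map_span, Set.Sum.elim_range,
      Set.image_union, Ideal.span_union, ← Set.range_comp, ← Set.range_comp]
    refine (sup_eq_right.2 ?_).symm
    rw [Ideal.span_le]
    rintro _ ⟨i, rfl⟩
    have : π (u i) = 0 := by
      rw [← RingHom.mem_ker, hker]; exact Ideal.subset_span ⟨i, rfl⟩
    simp [this]
  refine ⟨h1, (ringKrullDim_le_card h1).antisymm ?_⟩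
  have h2 := ringKrullDim_le_ringKrullDim_quotient_add_spanFinrank (Ideal.span (Set.range u)) (by
    rw [IsLocalRing.ringJacobson_eq_maximalIdeal, Ideal.span_le]
    rintro _ ⟨i, rfl⟩
    exact ht.mem_maximalIdeal (Sum.inl i))
  rw [ht.2, Fintype.card_sum, ← hker,
    ringKrullDim_eq_of_ringEquiv (RingHom.quotientKerEquivOfSurjective hπ)] at h2
  rw [hker] at h2
  have h3 := spanFinrank_span_range_le u
  have h4 : ((Fintype.card ι + Fintype.card κ : ℕ) : WithBot ℕ∞) ≤
      ringKrullDim A + (Fintype.card ι : ℕ) := h2.trans (by gcongr)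
  obtain ⟨d, hd⟩ : ∃ d : ℕ, ringKrullDim A = d := by
    have h5 : ringKrullDim A ≠ ⊤ := ringKrullDim_ne_top
    have h6 : (0 : WithBot ℕ∞) ≤ ringKrullDim A := ringKrullDim_nonneg_of_nontrivial
    generalize ringKrullDim A = D at h5 h6
    induction D with
    | bot => simp at h6
    | coe D =>
      induction D with
      | top => exact absurd rfl h5
      | coe d => exact ⟨d, rfl⟩
  rw [hd] at h4 ⊢
  norm_cast at h4 ⊢
  omega

/-- This is quasi-regularity in degree one. -/
lemma IsRegularSystem.indepMod [Algebra ℚ R] (ht : IsRegularSystem t) : IndepMod ⊥ t := by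
  refine ⟨ht.mem_maximalIdeal, fun c hc => ?_⟩
  rw [sup_bot_eq] at hc
  have h1 := map_residue_eq_zero ht (F := ∑ j, MvPolynomial.C (c j) * MvPolynomial.X j) (j := 1)
    (MvPolynomial.IsHomogeneous.sum _ _ _ fun i _ => by
      simpa using (MvPolynomial.isHomogeneous_C σ (c i)).mul (MvPolynomial.isHomogeneous_X R i))
    (by simpa using hc)
  intro j
  classical
  have h2 := congrArg (MvPolynomial.coeff (Finsupp.single j 1)) h1
  simp only [map_sum, map_mul, MvPolynomial.map_C, MvPolynomial.map_X, MvPolynomial.coeff_sum,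
    MvPolynomial.coeff_C_mul, MvPolynomial.coeff_X, MvPolynomial.coeff_zero] at h2
  rw [Finset.sum_eq_single j] at h2
  · simpa [residue_eq_zero_iff] using h2
  · intro i _ hij
    rw [if_neg, mul_zero]
    intro h
    exact hij (Finsupp.single_left_injective one_ne_zero h)
  · simp

lemma linearIndependent_toCotangent {R : Type*} [CommRing R] [IsLocalRing R] {ι : Type*}
    [Fintype ι] {y : ι → R} (hy : IndepMod ⊥ y) : LinearIndependent (ResidueField R)
      fun j => (maximalIdeal R).toCotangent ⟨y j, hy.1 j⟩ := by
  rw [Fintype.linearIndependent_iff]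
  intro g hg j
  choose c hc using fun j => residue_surjective (g j)
  rw [← hc, residue_eq_zero_iff]
  refine hy.2 c ?_ j
  rw [sup_bot_eq]
  have h1 : (maximalIdeal R).toCotangent (∑ j, c j • ⟨y j, hy.1 j⟩) = 0 := by
    rw [map_sum, ← hg]
    refine Finset.sum_congr rfl fun j _ => ?_
    rw [← hc, map_smul]
    exact (algebraMap_smul (ResidueField R) (c j) _).symm
  rw [Ideal.toCotangent_eq_zero] at h1
  simpa using h1

/-- Independent elements of a regular local ring extend to a regular system of coordinates. -/
theorem IsRegularSystem.exists_extension (ht : IsRegularSystem t) {ι : Type*} [Fintype ι]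
    {y : ι → R} (hy : IndepMod ⊥ y) :
    ∃ (s : ℕ) (w : Fin s → R), IsRegularSystem (Sum.elim y w) := by
  have hli := linearIndependent_toCotangent hy
  set V := CotangentSpace R
  set W : Submodule (ResidueField R) V := Submodule.span (ResidueField R)
    (Set.range fun j => (maximalIdeal R).toCotangent ⟨y j, hy.1 j⟩) with hW
  -- Lifts of a basis of the cotangent space modulo the span of `y` complete `y`; by Nakayama they
  -- generate the maximal ideal together.
  let b := Module.finBasis (ResidueField R) (V ⧸ W)
  choose v hv using fun k => W.mkQ_surjective (b k)
  choose w hw using fun k => (maximalIdeal R).toCotangent_surjective (v k)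
  refine ⟨_, fun k => w k, ?_⟩
  have hspan : Ideal.span (Set.range (Sum.elim y fun k => (w k : R))) = maximalIdeal R := by
    have h1 : Submodule.span (ResidueField R) ((maximalIdeal R).toCotangent ''
        Set.range (Sum.elim (fun j => (⟨y j, hy.1 j⟩ : maximalIdeal R)) w)) = ⊤ := by
      have h2 : (maximalIdeal R).toCotangent ''
          Set.range (Sum.elim (fun j => (⟨y j, hy.1 j⟩ : maximalIdeal R)) w) =
          (Set.range fun j => (maximalIdeal R).toCotangent ⟨y j, hy.1 j⟩) ∪ Set.range v := by
        rw [Set.Sum.elim_range, Set.image_union, ← Set.range_comp, ← Set.range_comp]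
        congr 2
        exact funext hw
      have h3 : (Submodule.span (ResidueField R) (Set.range v)).map W.mkQ = ⊤ := by
        rw [Submodule.map_span, ← Set.range_comp, ← b.span_eq]
        congr 2
        exact funext hv
      have h4 := Submodule.comap_map_eq W.mkQ (Submodule.span (ResidueField R) (Set.range v))
      rw [h3, Submodule.comap_top, W.ker_mkQ] at h4
      rw [h2, Submodule.span_union, ← hW, sup_comm, ← h4]
    rw [CotangentSpace.span_image_eq_top_iff] at h1
    have h3 := congrArg (Submodule.map (maximalIdeal R).subtype) h1
    rw [Submodule.map_top, Submodule.range_subtype, Submodule.map_span, ← Set.range_comp] at h3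
    convert! h3 using 3
    funext k
    rcases k with k | k <;> rfl
  refine ⟨hspan, (ringKrullDim_le_card hspan).antisymm ?_⟩
  have h4 := finrank_span_eq_card hli
  have h5 := W.finrank_quotient_add_finrank
  rw [ht.2, ← ht.spanFinrank_eq, spanFinrank_maximalIdeal_eq_finrank_cotangentSpace, ← h5, hW, h4,
    Fintype.card_sum, Fintype.card_fin, add_comm]

lemma isRegularSystem_comp_equiv_iff {R : Type*} [CommRing R] [IsLocalRing R] {t : σ → R}
    {κ : Type*} [Fintype κ] (e : κ ≃ σ) : IsRegularSystem (t ∘ e) ↔ IsRegularSystem t :=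
  ⟨fun h => by simpa [Function.comp_assoc] using h.comp_equiv e.symm, fun h => h.comp_equiv e⟩

open Classical in
lemma IsRegularSystem.of_surjective_of_ker_eq (ht : IsRegularSystem t) (τ : Set σ)
    {A : Type*} [CommRing A] [IsLocalRing A] {π : R →+* A}
    (hπ : Function.Surjective π) (hker : RingHom.ker π = Ideal.span (t '' τ)) :
    IsRegularSystem fun k : {k // k ∉ τ} => π (t k) := by
  have h1 := ht.comp_equiv (Equiv.sumCompl (· ∈ τ))
  have h2 : t ∘ Equiv.sumCompl (· ∈ τ) =
      Sum.elim (fun k : {k // k ∈ τ} => t k) (fun k : {k // k ∉ τ} => t k) := by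
    funext k
    rcases k with k | k <;> simp
  rw [h2] at h1
  refine h1.of_surjective hπ (hker.trans ?_)
  rw [Set.image_eq_range]

lemma IsRegularSystem.span_image_ne_top {R : Type*} [CommRing R] [IsLocalRing R] {t : σ → R}
    (ht : IsRegularSystem t) (τ : Set σ) :
    Ideal.span (t '' τ) ≠ ⊤ := by
  refine ne_top_of_le_ne_top (Ideal.IsPrime.ne_top inferInstance) (Ideal.span_le.2 ?_ :
    _ ≤ maximalIdeal R)
  rintro _ ⟨i, -, rfl⟩
  exact ht.mem_maximalIdeal i

/-- The remaining coordinates make the quotient regular, hence a domain. -/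
lemma IsRegularSystem.isPrime_span_image [Algebra ℚ R] (ht : IsRegularSystem t) (τ : Set σ) :
    (Ideal.span (t '' τ)).IsPrime := by
  classical
  have := Ideal.Quotient.nontrivial_iff.2 (ht.span_image_ne_top τ)
  have : IsLocalRing (R ⧸ Ideal.span (t '' τ)) :=
    .of_surjective' _ Ideal.Quotient.mk_surjective
  have h1 := ht.of_surjective_of_ker_eq τ Ideal.Quotient.mk_surjective Ideal.mk_ker
  rw [← Ideal.Quotient.isDomain_iff_prime]
  exact h1.isDomain

lemma span_image_le_iff [Algebra ℚ R] (ht : IsRegularSystem t) {τ τ' : Set σ} :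
    Ideal.span (t '' τ) ≤ Ideal.span (t '' τ') ↔ τ ⊆ τ' := by
  refine ⟨fun h i hi => ?_, fun h => Ideal.span_mono (Set.image_mono h)⟩
  rw [span_image_eq_mono, span_image_eq_mono,
    mono_le_mono_iff ht (isUpperSet_exists_ne_zero _)] at h
  obtain ⟨k, hk, hk'⟩ := h (show Finsupp.single i 1 ∈ _ from ⟨i, hi, by simp⟩)
  rw [Finsupp.single_apply_ne_zero] at hk'
  exact hk'.1 ▸ hk

end RegularSystem

/-! ### Exact sequences for intersections, sums and ideal quotients -/

section Length

variable {A : Type*} [CommRing A]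

lemma length_quotient_anti {I J : Ideal A} (h : I ≤ J) :
    Module.length A (A ⧸ J) ≤ Module.length A (A ⧸ I) := by
  rw [length_quotient_eq_add h]
  exact le_add_self

lemma length_quotient_lt {I J : Ideal A} (h : I < J) (hfin : Module.length A (A ⧸ I) ≠ ⊤) :
    Module.length A (A ⧸ J) < Module.length A (A ⧸ I) := by
  refine lt_of_le_of_ne (length_quotient_anti h.le) fun heq => ?_
  have h1 := length_quotient_eq_add h.le
  rw [heq] at h1
  have h2 : Module.length A (Submodule.map I.mkQ J) = 0 := by
    nth_rw 1 [← zero_add (Module.length A (A ⧸ I))] at h1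
    exact (WithTop.add_right_cancel hfin h1).symm
  rw [Module.length_eq_zero_iff, Submodule.subsingleton_iff_eq_bot] at h2
  refine h.not_ge fun r hr => (Submodule.Quotient.mk_eq_zero I).1 ?_
  have h3 : I.mkQ r ∈ Submodule.map I.mkQ J := ⟨r, hr, rfl⟩
  rwa [h2] at h3

/-- Additivity along the sequence from `A ⧸ (I ⊓ J)` through the product of `A ⧸ I` and `A ⧸ J` to
`A ⧸ (I ⊔ J)`, with the difference as second map. -/
lemma length_quotient_inf_add_sup (I J : Ideal A) :
    Module.length A (A ⧸ (I ⊓ J)) + Module.length A (A ⧸ (I ⊔ J)) =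
      Module.length A (A ⧸ I) + Module.length A (A ⧸ J) := by
  refine Eq.trans (Module.length_eq_add_of_exact
    (((I ⊓ J).factor inf_le_left).prod ((I ⊓ J).factor inf_le_right))
    ((I.factor le_sup_left).coprod (-(J.factor le_sup_right))) ?_ ?_ ?_).symm
    (Module.length_prod A (A ⧸ I) (A ⧸ J))
  · rw [← LinearMap.ker_eq_bot, LinearMap.ker_eq_bot']
    intro m hm
    obtain ⟨r, rfl⟩ := Submodule.mkQ_surjective _ m
    rw [Submodule.mkQ_apply, Submodule.Quotient.mk_eq_zero]
    exact ⟨(Submodule.Quotient.mk_eq_zero _).1 (congrArg Prod.fst hm),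
      (Submodule.Quotient.mk_eq_zero _).1 (congrArg Prod.snd hm)⟩
  · intro m
    obtain ⟨r, rfl⟩ := Submodule.mkQ_surjective _ m
    exact ⟨(I.mkQ r, 0), by simp⟩
  · rintro ⟨m, n⟩
    obtain ⟨r, rfl⟩ := Submodule.mkQ_surjective _ m
    obtain ⟨s, rfl⟩ := Submodule.mkQ_surjective _ n
    constructor
    · intro h
      have h1 : (I ⊔ J).mkQ (r - s) = 0 := by
        rw [map_sub, sub_eq_add_neg]
        exact h
      rw [Submodule.mkQ_apply, Submodule.Quotient.mk_eq_zero] at h1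
      obtain ⟨i, hi, j, hj, hij⟩ := Submodule.mem_sup.1 h1
      refine ⟨(I ⊓ J).mkQ (r - i), Prod.ext ?_ ?_⟩
      · refine (Submodule.Quotient.eq _).2 ?_
        simpa using neg_mem hi
      · refine (Submodule.Quotient.eq _).2 ?_
        have : r - i - s = j := by rw [← add_sub_cancel_left i j, hij]; ring
        exact this ▸ hj
    · rintro ⟨k, hk⟩
      obtain ⟨k, rfl⟩ := Submodule.mkQ_surjective _ k
      rw [← hk]
      change (I ⊔ J).mkQ k + -(I ⊔ J).mkQ k = 0
      simp

/-- Multiplication by `g` embeds the quotient by the colon ideal in `A ⧸ I`, and the cokernel is the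
other term. -/
lemma length_quotient_eq_add_colon (I : Ideal A) (g : A) :
    Module.length A (A ⧸ I) = Module.length A (A ⧸ I.colon {g}) +
      Module.length A (A ⧸ (I ⊔ Ideal.span {g})) := by
  have hle : I.colon {g} ≤ Submodule.comap (LinearMap.mulRight A g) I := fun r hr => by
    simpa [Submodule.mem_colon_singleton] using hr
  refine Module.length_eq_add_of_exact
    (Submodule.mapQ (I.colon {g}) I (LinearMap.mulRight A g) hle)
    (I.factor le_sup_left) ?_ (Submodule.factor_surjective _) ?_
  · rw [← LinearMap.ker_eq_bot, LinearMap.ker_eq_bot']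
    intro m hm
    obtain ⟨r, rfl⟩ := Submodule.mkQ_surjective _ m
    rw [Submodule.mkQ_apply, Submodule.mapQ_apply, Submodule.Quotient.mk_eq_zero] at hm
    rw [Submodule.mkQ_apply, Submodule.Quotient.mk_eq_zero, Submodule.mem_colon_singleton]
    exact hm
  · intro m
    obtain ⟨r, rfl⟩ := Submodule.mkQ_surjective _ m
    change Submodule.Quotient.mk r = 0 ↔ Submodule.Quotient.mk r ∈ _
    rw [Submodule.Quotient.mk_eq_zero]
    constructor
    · intro h
      obtain ⟨i, hi, j, hj, hij⟩ := Submodule.mem_sup.1 h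
      obtain ⟨c, rfl⟩ := Ideal.mem_span_singleton'.1 hj
      refine ⟨Submodule.Quotient.mk c, ?_⟩
      rw [Submodule.mapQ_apply]
      refine (Submodule.Quotient.eq _).2 ?_
      rw [LinearMap.mulRight_apply, ← hij, sub_add_cancel_right]
      exact neg_mem hi
    · rintro ⟨k, hk⟩
      obtain ⟨k, rfl⟩ := Submodule.mkQ_surjective _ k
      rw [Submodule.mkQ_apply, Submodule.mapQ_apply, Submodule.Quotient.eq] at hk
      rw [← sub_sub_cancel (k * g) r]
      exact sub_mem (Ideal.mem_sup_right (Ideal.mul_mem_left _ _ (Ideal.mem_span_singleton_self g)))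
        (Ideal.mem_sup_left hk)

end Length

/-! ### Hilbert-Samuel functions of divisors on unions of coordinate subspaces -/

section Blocks

variable {R : Type*} [CommRing R] {p s J : Type*} [Fintype p] [Fintype s] {x : p → R} {w : s → R}

lemma span_image_eq_mono_inl (x : p → R) (w : s → R) (τ : Set p) :
    Ideal.span (x '' τ) = mono (Sum.elim x w) {α | ∃ k ∈ τ, α (Sum.inl k) ≠ 0} := by
  have h := span_image_eq_mono (Sum.elim x w) (Sum.inl '' τ)
  rw [← Set.image_comp, Sum.elim_comp_inl] at h
  rw [h]
  congr 1
  ext; simp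

open Classical in
/-- The exponent of the product of the coordinates `w l` for `l ∈ B`. -/
noncomputable def prodExp (p : Type*) [Fintype p] (B : Finset s) : (p ⊕ s) →₀ ℕ :=
  Finsupp.equivFunOnFinite.symm (Sum.elim 0 fun l => if l ∈ B then 1 else 0)

lemma tmon_prodExp (x : p → R) (w : s → R) (B : Finset s) :
    tmon (Sum.elim x w) (prodExp p B) = ∏ l ∈ B, w l := by
  classical
  simp [tmon, prodExp, Finset.prod_ite_mem, pow_ite]

lemma degree_prodExp (B : Finset s) : (prodExp p B).degree = B.card := by
  classical
  simp [prodExp, Finsupp.degree_eq_sum]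

lemma prodExp_le_iff {B : Finset s} {α : (p ⊕ s) →₀ ℕ} :
    prodExp p B ≤ α ↔ ∀ l ∈ B, α (Sum.inr l) ≠ 0 := by
  classical
  rw [Finsupp.le_def, Sum.forall]
  simp only [prodExp, Finsupp.coe_equivFunOnFinite_symm, Sum.elim_inl, Pi.zero_apply, zero_le,
    implies_true, true_and, Sum.elim_inr]
  refine forall_congr' fun l => ?_
  split_ifs with h <;> simp [h, Nat.one_le_iff_ne_zero]

lemma span_prod_eq_mono (x : p → R) (w : s → R) (B : Finset s) :
    Ideal.span {∏ l ∈ B, w l} =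
      mono (Sum.elim x w) {α | ∀ l ∈ B, α (Sum.inr l) ≠ 0} := by
  rw [← tmon_prodExp x w, ← mono_Ici]
  congr 1
  ext α
  exact prodExp_le_iff

/-- The exponents of the monomials in the ideal of the divisor `∏ l ∈ B, w l` on the union of the
subspaces where the coordinates `x` of one block vanish. -/
def divisorExp (b : p → J) (B : Finset s) : Set ((p ⊕ s) →₀ ℕ) :=
  {α | ∀ i, (∃ k, b k = i ∧ α (Sum.inl k) ≠ 0) ∨ ∀ l ∈ B, α (Sum.inr l) ≠ 0}

lemma isUpperSet_inl {p s : Type*} (τ : Set p) :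
    IsUpperSet {α : (p ⊕ s) →₀ ℕ | ∃ k ∈ τ, α (Sum.inl k) ≠ 0} := by
  rintro α β h ⟨k, hk, hα⟩
  exact ⟨k, hk, fun h0 => hα (Nat.le_zero.1 (h0 ▸ h (Sum.inl k)))⟩

lemma isUpperSet_inr {p s : Type*} (B : Finset s) :
    IsUpperSet {α : (p ⊕ s) →₀ ℕ | ∀ l ∈ B, α (Sum.inr l) ≠ 0} :=
  fun _ _ h hα l hl h0 => hα l hl (Nat.le_zero.1 (h0 ▸ h (Sum.inr l)))

lemma isUpperSet_divisorExp {p s J : Type*} (b : p → J) (B : Finset s) :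
    IsUpperSet (divisorExp b B) :=
  fun _ _ h hα i => (hα i).imp (fun hk => isUpperSet_inl {k | b k = i} h hk) (isUpperSet_inr B h)

variable [IsLocalRing R] [IsNoetherianRing R] [Algebra ℚ R]

lemma iInf_sup_eq_mono (ht : IsRegularSystem (Sum.elim x w)) (b : p → J) (B : Finset s) :
    ⨅ i, (Ideal.span (x '' {k | b k = i}) ⊔ Ideal.span {∏ l ∈ B, w l}) =
      mono (Sum.elim x w) (divisorExp b B) := by
  simp_rw [span_image_eq_mono_inl x w, span_prod_eq_mono x w, ← mono_union]
  rw [← mono_iInter ht fun i => (isUpperSet_inl _).union (isUpperSet_inr B)]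
  congr 1
  ext α
  simp [divisorExp]

/-- The Hilbert-Samuel function of a normal crossings divisor on a union of coordinate subspaces. -/
theorem hilbertSamuel_eq_modelIdeal (K : Type u) [Field K] [CharZero K]
    (ht : IsRegularSystem (Sum.elim x w)) {N : ℕ} (b : p → Fin N) (c : Fin N → ℕ)
    (hc : ∀ i, Nat.card {k // b k = i} = c i) (e : ℕ) (he : Fintype.card p + Fintype.card s = e)
    (B : Finset s) :
    hilbertSamuel (⨅ i, (Ideal.span (x '' {k | b k = i}) ⊔ Ideal.span {∏ l ∈ B, w l})) =
      hilbertSamuel (modelIdeal K e c B.card) := by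
  classical
  -- Relabel the `x` by block and position, and below move `B` to an initial segment. Both ideals
  -- then have the same exponents, so the counts agree although the residue fields may differ.
  obtain ⟨E₁, hE₁⟩ : ∃ E : p ≃ Σ i, Fin (c i), ∀ k, (E k).1 = b k :=
    ⟨(Equiv.sigmaFiberEquiv b).symm.trans (Equiv.sigmaCongrRight fun i =>
      Finite.equivFinOfCardEq (hc i)), fun k => rfl⟩
  have hcard : Fintype.card s = e - ∑ i, c i := by
    have := Fintype.card_congr E₁
    simp only [Fintype.card_sigma, Fintype.card_fin] at this
    omega
  obtain ⟨E₂, hE₂⟩ : ∃ E : s ≃ Fin (e - ∑ i, c i), ∀ l, l ∈ B ↔ (E l).val < B.card := by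
    let E := Fintype.equivFinOfCardEq hcard
    have hB : B.card ≤ e - ∑ i, c i := hcard ▸ B.card_le_univ
    have h1 : Fintype.card {i // E.symm i ∈ B} =
        Fintype.card {i : Fin (e - ∑ i, c i) // i.val < B.card} := by
      rw [Fintype.card_congr (E.symm.subtypeEquiv (p := fun i => E.symm i ∈ B) (q := (· ∈ B))
        fun i => Iff.rfl), Fintype.card_coe, Fintype.card_subtype, Fin.card_filter_val_lt,
        min_eq_right hB]
    let F := (Fintype.equivOfCardEq h1).extendSubtype
    refine ⟨E.trans F, fun l => ?_⟩
    constructor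
    · intro hl
      exact (Fintype.equivOfCardEq h1).extendSubtype_mem (E l) (by simpa using hl)
    · intro hl
      by_contra hcon
      exact (Fintype.equivOfCardEq h1).extendSubtype_not_mem (E l) (by simpa using hcon) hl
  set B' : Finset (Fin (e - ∑ i, c i)) := Finset.univ.filter (fun l => l.val < B.card) with hB'
  have h1 : modelIdeal K e c B.card = ⨅ i, (Ideal.span
      ((fun k => (MvPowerSeries.X (Sum.inl k) :
        MvPowerSeries ((Σ i : Fin N, Fin (c i)) ⊕ Fin (e - ∑ i, c i)) K)) '' {k | k.1 = i}) ⊔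
      Ideal.span {∏ l ∈ B', MvPowerSeries.X (Sum.inr l)}) := by
    refine iInf_congr fun i => ?_
    rw [← Ideal.span_union]
    congr 2
    ext f
    constructor
    · rintro ⟨j, rfl⟩
      exact ⟨⟨i, j⟩, rfl, rfl⟩
    · rintro ⟨⟨_, j⟩, rfl, rfl⟩
      exact ⟨j, rfl⟩
  have h2 : (⨅ i, (Ideal.span (x '' {k | b k = i}) ⊔ Ideal.span {∏ l ∈ B, w l})) =
      ⨅ i, (Ideal.span ((x ∘ E₁.symm) '' {k | k.1 = i}) ⊔
        Ideal.span {∏ l ∈ B', (w ∘ E₂.symm) l}) := by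
    refine iInf_congr fun i => ?_
    congr 3
    · ext f
      constructor
      · rintro ⟨k, rfl, rfl⟩
        exact ⟨E₁ k, hE₁ k, by simp⟩
      · rintro ⟨k, rfl, rfl⟩
        exact ⟨E₁.symm k, by simp [← hE₁], rfl⟩
    · refine Finset.prod_equiv E₂ (fun l => ?_) fun l _ => by simp
      simp [hB', hE₂]
  have ht' : IsRegularSystem (Sum.elim (x ∘ E₁.symm) (w ∘ E₂.symm)) := by
    convert! ht.comp_equiv (Equiv.sumCongr E₁.symm E₂.symm) using 1
    funext k
    rcases k with k | k <;> rfl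
  have hX : IsRegularSystem (Sum.elim
      (fun k => (MvPowerSeries.X (Sum.inl k) :
        MvPowerSeries ((Σ i : Fin N, Fin (c i)) ⊕ Fin (e - ∑ i, c i)) K))
      fun l => MvPowerSeries.X (Sum.inr l)) := by
    convert! isRegularSystem_X K ((Σ i : Fin N, Fin (c i)) ⊕ Fin (e - ∑ i, c i)) using 1
    funext k
    rcases k with k | k <;> rfl
  rw [h1, h2, iInf_sup_eq_mono ht', iInf_sup_eq_mono hX]
  funext k
  rw [hilbertSamuel_mono ht' (isUpperSet_divisorExp _ _),
    hilbertSamuel_mono hX (isUpperSet_divisorExp _ _)]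

lemma length_quotient_maximalIdeal_pow_ne_top (ht : IsRegularSystem (Sum.elim x w)) (n : ℕ) :
    Module.length R (R ⧸ maximalIdeal R ^ n) ≠ ⊤ := by
  rw [← ht.1, pow_eq_mono, length_quotient_mono ht _ (isUpperSet_degree n)]
  · exact ENat.natCast_ne_top _
  · exact (finite_degree_lt n).subset fun α hα => not_le.1 (id hα : ¬ n ≤ α.degree)

/-- A product of few elements of the maximal ideal on one component, where the divisor has more
branches on the other components, gives a larger Hilbert-Samuel function than normal crossings. -/
theorem hilbertSamuel_lt (ht : IsRegularSystem (Sum.elim x w)) (b : p → J)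
    (hb : ∀ i, ∃ k, b k = i) (m i₀ : J) (hi₀ : i₀ ≠ m) (B B' : Finset s) (hB : B'.card < B.card)
    (g : R) (hg : g ∈ maximalIdeal R ^ B'.card) (I : Ideal R)
    (hI : ∀ i ≠ m, I ≤ Ideal.span (x '' {k | b k = i}) ⊔ Ideal.span {∏ l ∈ B, w l})
    (hIm : I ≤ Ideal.span (x '' {k | b k = m}) ⊔ Ideal.span {g}) :
    hilbertSamuel (⨅ i, (Ideal.span (x '' {k | b k = i}) ⊔ Ideal.span {∏ l ∈ B', w l}))
      (B'.card + 1) < hilbertSamuel I (B'.card + 1) := by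
  classical
  set q := B'.card
  set t := Sum.elim x w with htdef
  set M := ⨅ i, (Ideal.span (x '' {k | b k = i}) ⊔ Ideal.span {∏ l ∈ B', w l}) with hM
  set V : J → Set ((p ⊕ s) →₀ ℕ) := fun i => {α | ∃ k ∈ {k | b k = i}, α (Sum.inl k) ≠ 0} with hV
  set Y : Finset s → Set ((p ⊕ s) →₀ ℕ) := fun B => {α | ∀ l ∈ B, α (Sum.inr l) ≠ 0} with hY
  set Q : Set ((p ⊕ s) →₀ ℕ) := {α | q + 2 ≤ α.degree} with hQ
  have hVup : ∀ i, IsUpperSet (V i) := fun i => isUpperSet_inl _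
  have hYup : ∀ B, IsUpperSet (Y B) := fun B => isUpperSet_inr B
  have hQup : IsUpperSet Q := isUpperSet_degree _
  have hpow : ∀ n, maximalIdeal R ^ n = mono t {α | n ≤ α.degree} := fun n => by
    rw [← ht.1, pow_eq_mono]
  -- Lengths modulo `m ^ (q + 2)` are compared through the intersection and the sum with the ideal
  -- `𝔟` of the component `m`. The sums give a weak inequality, the intersections a strict one.
  set 𝔟 : Ideal R := mono t (V m ∪ Q) with h𝔟
  set N : Ideal R := mono t ((⋂ i, V i) ∪ Q) with hN
  have hfin : ∀ I : Ideal R, maximalIdeal R ^ (q + 2) ≤ I → Module.length R (R ⧸ I) ≠ ⊤ :=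
    fun I hI => ne_top_of_le_ne_top (length_quotient_maximalIdeal_pow_ne_top ht (q + 2))
      (length_quotient_anti hI)
  have hm𝔟 : maximalIdeal R ^ (q + 2) ≤ 𝔟 := by
    rw [hpow]; exact mono_mono t Set.subset_union_right
  have hmN : maximalIdeal R ^ (q + 2) ≤ N := by
    rw [hpow]; exact mono_mono t Set.subset_union_right
  have h1 : Module.length R (R ⧸ (𝔟 ⊔ Ideal.span {∏ l ∈ B', w l})) ≤
      Module.length R (R ⧸ (𝔟 ⊔ Ideal.span {g})) := by
    have e1 := length_quotient_eq_add_colon 𝔟 (∏ l ∈ B', w l)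
    have e2 := length_quotient_eq_add_colon 𝔟 g
    -- An element carried into `𝔟` by the monomial of degree `q` must lie in the ideal of the
    -- component plus `m ^ 2`. All of that is carried into `𝔟` by any `g` of order at least `q`, so
    -- the colon by `g` is at least as large.
    have h2 : 𝔟.colon {∏ l ∈ B', w l} ≤ mono t (V m ∪ {α | 2 ≤ α.degree}) := by
      obtain ⟨Φ, hΦ, hΦ'⟩ := exists_mem_mono_iff ht
      intro f hf
      rw [Submodule.mem_colon_singleton, smul_eq_mul, h𝔟, hΦ' _ ((hVup m).union hQup),
        ← tmon_prodExp x w, map_mul, hΦ] at hf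
      rw [hΦ' _ ((hVup m).union (isUpperSet_degree 2))]
      intro α hα
      have h3 := hf (α + prodExp p B') ?_
      · rw [MvPowerSeries.coeff_add_mul_monomial, mul_one] at h3
        exact h3
      · intro h4
        refine hα (h4.imp ?_ ?_)
        · rintro ⟨k, hk, hk'⟩
          exact ⟨k, hk, by simpa [prodExp] using hk'⟩
        · intro h5
          have h6 : q + 2 ≤ (α + prodExp p B').degree := h5
          rw [map_add, degree_prodExp] at h6
          change 2 ≤ α.degree
          omega
    have h3 : mono t (V m ∪ {α | 2 ≤ α.degree}) ≤ 𝔟.colon {g} := by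
      rw [mono_union, ← hpow]
      refine sup_le (fun f hf => ?_) fun f hf => ?_
      · rw [Submodule.mem_colon_singleton]
        exact Ideal.mul_mem_right _ _ (mono_mono t Set.subset_union_left hf)
      · rw [Submodule.mem_colon_singleton]
        refine hm𝔟 ?_
        rw [add_comm, pow_add]
        exact Ideal.mul_mem_mul hf hg
    have h4 := length_quotient_anti (h2.trans h3)
    rw [e1] at e2
    have f1 : Module.length R (R ⧸ 𝔟.colon {g}) ≠ ⊤ := hfin _ (hm𝔟.trans fun f hf => by
      rw [Submodule.mem_colon_singleton]; exact Ideal.mul_mem_right _ _ hf)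
    have f2 : Module.length R (R ⧸ 𝔟.colon {∏ l ∈ B', w l}) ≠ ⊤ := hfin _ (hm𝔟.trans fun f hf => by
      rw [Submodule.mem_colon_singleton]; exact Ideal.mul_mem_right _ _ hf)
    refine (ENat.add_le_add_iff_left f1).1 ?_
    calc _ ≤ _ := add_le_add_left h4 _
      _ = _ := e2
  have h2 : (I ⊔ maximalIdeal R ^ (q + 2)) ⊓ 𝔟 ≤ N := by
    have h3 : I ⊔ maximalIdeal R ^ (q + 2) ≤ mono t ((⋂ i : {i // i ≠ m}, (V i ∪ Y B)) ∪ Q) := by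
      rw [mono_union, hpow]
      refine sup_le_sup_right ?_ _
      rw [mono_iInter ht fun i : {i // i ≠ m} => (hVup i).union (hYup B)]
      refine le_iInf fun i => ?_
      rw [mono_union, hV, hY]
      dsimp only
      rw [← span_image_eq_mono_inl, ← span_prod_eq_mono]
      exact hI i i.2
    refine (inf_le_inf_right _ h3).trans ?_
    rw [h𝔟, ← mono_inter ht ((isUpperSet_iInter fun i : {i // i ≠ m} =>
      (hVup i).union (hYup B)).union hQup) ((hVup m).union hQup)]
    refine mono_mono t ?_
    rintro α ⟨hα | hα, hα' | hα'⟩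
    · by_cases hq : q + 2 ≤ α.degree
      · exact Or.inr hq
      refine Or.inl (Set.mem_iInter.2 fun i => ?_)
      by_cases him : i = m
      · exact him ▸ hα'
      refine (Set.mem_iInter.1 hα ⟨i, him⟩).resolve_right fun hαB => hq ?_
      -- Such a monomial is divisible by all `w l` with `l ∈ B` and by a coordinate of the block
      -- `m`. Since `B` has more than `q` elements, the degree is at least `q + 2`.
      obtain ⟨k, -, hk⟩ := hα'
      have h4 : prodExp p B + Finsupp.single (Sum.inl k) 1 ≤ α := by
        rw [Finsupp.le_def]
        rintro (l | l)
        · simp only [Finsupp.add_apply, prodExp, Finsupp.coe_equivFunOnFinite_symm, Sum.elim_inl,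
            Pi.zero_apply, zero_add]
          exact Finsupp.le_def.1 (Finsupp.single_le_iff.2 (Nat.one_le_iff_ne_zero.2 hk)) _
        · have := Finsupp.le_def.1 (prodExp_le_iff.2 hαB) (Sum.inr l)
          simpa using this
      have h5 := Finsupp.degree_mono h4
      rw [map_add, degree_prodExp, Finsupp.degree_single] at h5
      omega
    · exact Or.inr hα'
    · exact Or.inr hα
    · exact Or.inr hα
  have hMmono : M = mono t (divisorExp b B') := iInf_sup_eq_mono ht b B'
  have h3 : N < (M ⊔ maximalIdeal R ^ (q + 2)) ⊓ 𝔟 := by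
    rw [hMmono, hpow, ← mono_union, h𝔟, ← mono_inter ht ((isUpperSet_divisorExp b B').union hQup)
      ((hVup m).union hQup), lt_iff_le_not_ge, hN, mono_le_mono_iff ht
      ((isUpperSet_iInter hVup).union hQup)]
    refine ⟨mono_mono t (Set.union_subset (fun α hα => ⟨Or.inl fun i => ?_, Or.inl ?_⟩)
      fun α hα => ⟨Or.inr hα, Or.inr hα⟩), fun h => ?_⟩
    · exact Or.inl (Set.mem_iInter.1 hα i)
    · exact Set.mem_iInter.1 hα m
    -- Strictness is witnessed in degree `q + 1` by a coordinate of the block `m` times the product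
    -- over `B'`: it does not vanish on the component `i₀`.
    · obtain ⟨k, hk⟩ := hb m
      rcases @h (prodExp p B' + Finsupp.single (Sum.inl k) 1)
        ⟨Or.inl fun i => Or.inr (prodExp_le_iff.1 le_self_add), Or.inl ⟨k, hk, by simp [prodExp]⟩⟩
        with h4 | h4
      · obtain ⟨k', hk', h5⟩ := Set.mem_iInter.1 h4 i₀
        have : k = k' := by
          by_contra hne
          simp [prodExp, hne] at h5
        exact hi₀ (by rw [← hk, this, ← hk'])
      · have h5 : q + 2 ≤ (prodExp p B' + Finsupp.single (Sum.inl k) 1).degree := h4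
        rw [map_add, degree_prodExp, Finsupp.degree_single] at h5
        omega
  have e1 := length_quotient_inf_add_sup (I ⊔ maximalIdeal R ^ (q + 2)) 𝔟
  have e2 := length_quotient_inf_add_sup (M ⊔ maximalIdeal R ^ (q + 2)) 𝔟
  have g1 := length_quotient_anti h2
  have g2 := length_quotient_lt h3 (hfin _ hmN)
  have g3 : Module.length R (R ⧸ (𝔟 ⊔ Ideal.span {g})) ≤
      Module.length R (R ⧸ (I ⊔ maximalIdeal R ^ (q + 2) ⊔ 𝔟)) := by
    refine length_quotient_anti (sup_le (sup_le (hIm.trans ?_) (hm𝔟.trans le_sup_left)) le_sup_left)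
    refine sup_le_sup_right ?_ _
    rw [span_image_eq_mono_inl x w]
    exact mono_mono t Set.subset_union_left
  have g4 : Module.length R (R ⧸ (M ⊔ maximalIdeal R ^ (q + 2) ⊔ 𝔟)) ≤
      Module.length R (R ⧸ (𝔟 ⊔ Ideal.span {∏ l ∈ B', w l})) :=
    length_quotient_anti (sup_le le_sup_right
      (((le_iInf fun i => le_sup_right).trans le_sup_left).trans le_sup_left))
  have fI := hfin (I ⊔ maximalIdeal R ^ (q + 2)) le_sup_right
  have fM := hfin (M ⊔ maximalIdeal R ^ (q + 2)) le_sup_right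
  have fb := hfin 𝔟 hm𝔟
  change Module.length R (R ⧸ (M ⊔ maximalIdeal R ^ (q + 2))) <
    Module.length R (R ⧸ (I ⊔ maximalIdeal R ^ (q + 2)))
  refine (ENat.add_lt_add_iff_right fb).1 ?_
  rw [← e1, ← e2]
  refine ENat.add_lt_add_of_lt_of_le ?_ (g2.trans_le g1) (g4.trans (h1.trans g3))
  exact hfin _ (le_sup_of_le_left le_sup_right)

end Blocks

/-! ### Ideals pulled back along a surjection -/

section Comap

variable {R O : Type*} [CommRing R] [CommRing O] {ρ : R →+* O}

lemma comap_sup_of_surjective (hρ : Function.Surjective ρ) (A B : Ideal O) :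
    (A ⊔ B).comap ρ = A.comap ρ ⊔ B.comap ρ := by
  conv_lhs => rw [← Ideal.map_comap_of_surjective ρ hρ A, ← Ideal.map_comap_of_surjective ρ hρ B,
    ← Ideal.map_sup, Ideal.comap_map_of_surjective _ hρ]
  exact sup_eq_left.2 (le_sup_of_le_left (Ideal.comap_mono bot_le))

lemma comap_iSup_of_surjective (hρ : Function.Surjective ρ) {ι : Type*} [Nonempty ι]
    (A : ι → Ideal O) : (⨆ i, A i).comap ρ = ⨆ i, (A i).comap ρ := by
  have h : ⨆ i, A i = (⨆ i, (A i).comap ρ).map ρ := by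
    rw [Ideal.map_iSup]
    exact iSup_congr fun i => (Ideal.map_comap_of_surjective ρ hρ _).symm
  rw [h, Ideal.comap_map_of_surjective _ hρ]
  exact sup_eq_left.2 (le_iSup_of_le (Classical.arbitrary ι) (Ideal.comap_mono bot_le))

lemma comap_sup_span (hρ : Function.Surjective ρ) (A : Ideal O) (s : Set R) :
    (A ⊔ Ideal.span (ρ '' s)).comap ρ = A.comap ρ ⊔ Ideal.span s := by
  rw [comap_sup_of_surjective hρ, ← Ideal.map_span, Ideal.comap_map_of_surjective _ hρ,
    ← sup_assoc, sup_right_comm]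
  exact congrArg (· ⊔ _) (sup_eq_left.2 (Ideal.comap_mono bot_le))

lemma comap_le_comap_iff (hρ : Function.Surjective ρ) {A B : Ideal O} :
    A.comap ρ ≤ B.comap ρ ↔ A ≤ B :=
  Ideal.comap_le_comap_iff_of_surjective ρ hρ A B

lemma isPrime_of_isPrime_comap (hρ : Function.Surjective ρ) {A : Ideal O}
    (h : (A.comap ρ).IsPrime) : A.IsPrime := by
  rw [← Ideal.map_comap_of_surjective ρ hρ A]
  exact Ideal.map_isPrime_of_surjective hρ (Ideal.comap_mono bot_le)

lemma sup_span_singleton_congr {A : Ideal O} {f g : O} (h : f - g ∈ A) :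
    A ⊔ Ideal.span {f} = A ⊔ Ideal.span {g} := by
  have key : ∀ {f g : O}, f - g ∈ A → A ⊔ Ideal.span {f} ≤ A ⊔ Ideal.span {g} := fun {f g} h => by
    refine sup_le le_sup_left ((Ideal.span_singleton_le_iff_mem _).2 ?_)
    rw [← sub_add_cancel f g]
    exact add_mem (Ideal.mem_sup_left h) (Ideal.mem_sup_right (Ideal.mem_span_singleton_self g))
  exact le_antisymm (key h) (key (by rw [← neg_sub]; exact neg_mem h))

/-- The intersection of distinct principal primes modulo a prime is generated by the product. -/
lemma mem_sup_span_prod {P : Ideal O} {ι : Type*} (s : Finset ι) (y : ι → O)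
    (hy : ∀ j, (P ⊔ Ideal.span {y j}).IsPrime)
    (hne : ∀ j k, j ≠ k → y k ∉ P ⊔ Ideal.span {y j}) {f : O}
    (hf : ∀ j ∈ s, f ∈ P ⊔ Ideal.span {y j}) : f ∈ P ⊔ Ideal.span {∏ j ∈ s, y j} := by
  classical
  induction s using Finset.induction_on with
  | empty => simp
  | insert j s hj ih =>
    obtain ⟨p, hp, q, hq, hpq⟩ := Submodule.mem_sup.1
      (ih fun k hk => hf k (Finset.mem_insert_of_mem hk))
    obtain ⟨c, rfl⟩ := Ideal.mem_span_singleton'.1 hq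
    have h1 : c * ∏ k ∈ s, y k ∈ P ⊔ Ideal.span {y j} := by
      rw [← add_sub_cancel_left p (c * ∏ k ∈ s, y k), hpq]
      exact sub_mem (hf j (Finset.mem_insert_self _ _)) (Ideal.mem_sup_left hp)
    have hyj := hy j
    have h2 : c ∈ P ⊔ Ideal.span {y j} := by
      refine (hyj.mem_or_mem h1).resolve_right fun h3 => ?_
      obtain ⟨k, hk, hk'⟩ := Ideal.IsPrime.prod_mem_iff.1 h3
      exact hne j k (by rintro rfl; exact hj hk) hk'
    obtain ⟨p', hp', q', hq', rfl⟩ := Submodule.mem_sup.1 h2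
    obtain ⟨d, rfl⟩ := Ideal.mem_span_singleton'.1 hq'
    rw [← hpq, Finset.prod_insert hj, add_mul, ← add_assoc]
    refine Submodule.add_mem_sup (add_mem hp (Ideal.mul_mem_right _ _ hp'))
      (Ideal.mem_span_singleton'.2 ⟨d, by ring⟩)

end Comap

/-! ### Charts: component ideals given by blocks of coordinates -/

section Chart

variable {R O : Type*} [CommRing R] [CommRing O] [IsLocalRing R]
  {p s J : Type*} [Fintype p] [Fintype s]

/-- The ideals `I i` in the local ring `O` are, in a quotient of a regular local ring with
coordinates `x` and `w`, the ideals of the coordinate subspaces given by the blocks of a partition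
of the coordinates `x`. -/
structure IsSncChart (ρ : R →+* O) (x : p → R) (w : s → R) (b : p → J) (I : J → Ideal O) :
    Prop where
  surj : Function.Surjective ρ
  isRegularSystem : IsRegularSystem (Sum.elim x w)
  comap_eq : ∀ i, (I i).comap ρ = Ideal.span (x '' {k | b k = i})

variable {ρ : R →+* O} {x : p → R} {w : s → R} {b : p → J} {I : J → Ideal O}

namespace IsSncChart

lemma comap_iSup (h : IsSncChart ρ x w b I) {T : Set J} (hT : T.Nonempty) :
    (⨆ i : T, I i).comap ρ = Ideal.span (x '' {k | b k ∈ T}) := by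
  have := hT.to_subtype
  rw [comap_iSup_of_surjective h.surj]
  simp_rw [h.comap_eq, ← Ideal.span_iUnion, ← Set.image_iUnion]
  congr 2
  ext k
  simp

lemma comap_iSup_univ [Nonempty J] (h : IsSncChart ρ x w b I) :
    (⨆ i, I i).comap ρ = Ideal.span (Set.range x) := by
  rw [comap_iSup_of_surjective h.surj]
  simp_rw [h.comap_eq, ← Ideal.span_iUnion, ← Set.image_iUnion]
  rw [← Set.image_univ]
  congr 2
  ext k
  simp

lemma comap_coord (h : IsSncChart ρ x w b I) {T : Set J} (hT : T.Nonempty) (L : Set s) :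
    ((⨆ i : T, I i) ⊔ Ideal.span ((ρ ∘ w) '' L)).comap ρ =
      Ideal.span (Sum.elim x w '' {k | Sum.elim (fun k => b k ∈ T) (· ∈ L) k}) := by
  rw [Set.image_comp, comap_sup_span h.surj, h.comap_iSup hT, ← Ideal.span_union]
  congr 1
  ext f
  constructor
  · rintro (⟨k, hk, rfl⟩ | ⟨k, hk, rfl⟩)
    exacts [⟨Sum.inl k, hk, rfl⟩, ⟨Sum.inr k, hk, rfl⟩]
  · rintro ⟨k | k, hk, rfl⟩
    exacts [Or.inl ⟨k, hk, rfl⟩, Or.inr ⟨k, hk, rfl⟩]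

variable [IsNoetherianRing R] [Algebra ℚ R]

lemma isPrime_coord (h : IsSncChart ρ x w b I) {T : Set J} (hT : T.Nonempty) (L : Set s) :
    ((⨆ i : T, I i) ⊔ Ideal.span ((ρ ∘ w) '' L)).IsPrime := by
  refine isPrime_of_isPrime_comap h.surj ?_
  rw [h.comap_coord hT]
  exact h.isRegularSystem.isPrime_span_image _

lemma coord_le_coord_iff (h : IsSncChart ρ x w b I) {T T' : Set J} (hT : T.Nonempty)
    (hT' : T'.Nonempty) (L L' : Set s) :
    (⨆ i : T, I i) ⊔ Ideal.span ((ρ ∘ w) '' L) ≤ (⨆ i : T', I i) ⊔ Ideal.span ((ρ ∘ w) '' L') ↔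
      (∀ k, b k ∈ T → b k ∈ T') ∧ L ⊆ L' := by
  rw [← comap_le_comap_iff h.surj, h.comap_coord hT, h.comap_coord hT',
    span_image_le_iff h.isRegularSystem]
  constructor
  · exact fun hs => ⟨fun k hk => hs (a := Sum.inl k) hk, fun l hl => hs (a := Sum.inr l) hl⟩
  · rintro ⟨h1, h2⟩ (k | l) hk
    exacts [h1 k hk, h2 hk]

/-- Distributivity of the lattice of monomial ideals. It replaces congruences modulo one component
at a time by a single congruence, for gluing equations. -/
lemma iInf_coord_sup_le (h : IsSncChart ρ x w b I) (m : J) (l : s) {f : O}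
    (hf : ∀ i : {i // i ≠ m}, f ∈ I i ⊔ (I m ⊔ Ideal.span {ρ (w l)})) :
    f ∈ (⨅ i : {i // i ≠ m}, I i) ⊔ (I m ⊔ Ideal.span {ρ (w l)}) := by
  obtain ⟨r, rfl⟩ := h.surj f
  have h1 : (I m ⊔ Ideal.span {ρ (w l)}).comap ρ =
      mono (Sum.elim x w) ({α | ∃ k ∈ {k | b k = m}, α (Sum.inl k) ≠ 0} ∪
        {α | ∀ l' ∈ ({l} : Finset s), α (Sum.inr l') ≠ 0}) := by
    rw [← Set.image_singleton, comap_sup_span h.surj, h.comap_eq, mono_union,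
      ← span_image_eq_mono_inl, ← span_prod_eq_mono, Finset.prod_singleton]
  have h2 : ∀ i, (I i).comap ρ =
      mono (Sum.elim x w) {α | ∃ k ∈ {k | b k = i}, α (Sum.inl k) ≠ 0} := fun i => by
    rw [h.comap_eq, ← span_image_eq_mono_inl]
  have h3 : r ∈ (⨅ i : {i // i ≠ m}, (I i).comap ρ) ⊔ (I m ⊔ Ideal.span {ρ (w l)}).comap ρ := by
    simp_rw [h1, h2]
    rw [← mono_iInter h.isRegularSystem fun i : {i // i ≠ m} => isUpperSet_inl {k | b k = i},
      ← mono_union]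
    have h4 : r ∈ ⨅ i : {i // i ≠ m}, (mono (Sum.elim x w)
        ({α | ∃ k ∈ {k | b k = i}, α (Sum.inl k) ≠ 0} ∪
          ({α | ∃ k ∈ {k | b k = m}, α (Sum.inl k) ≠ 0} ∪
          {α | ∀ l' ∈ ({l} : Finset s), α (Sum.inr l') ≠ 0}))) := by
      rw [Submodule.mem_iInf]
      intro i
      rw [mono_union, ← h1, ← h2, ← comap_sup_of_surjective h.surj]
      exact hf i
    rw [← mono_iInter h.isRegularSystem fun i : {i // i ≠ m} => (isUpperSet_inl {k | b k = i}).union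
      ((isUpperSet_inl _).union (isUpperSet_inr _)), ← Set.iInter_union] at h4
    exact h4
  obtain ⟨u, hu, v, hv, rfl⟩ := Submodule.mem_sup.1 h3
  rw [map_add]
  refine Submodule.add_mem_sup ?_ hv
  rw [Submodule.mem_iInf] at hu ⊢
  exact hu

variable [IsLocalRing O]

lemma indepMod [Nonempty J] (h : IsSncChart ρ x w b I) : IndepMod (⨆ i, I i) (ρ ∘ w) := by
  rw [← indepMod_comap_iff h.surj, h.comap_iSup_univ]
  have := (indepMod_sumElim.1 h.isRegularSystem.indepMod).2
  rwa [bot_sup_eq] at this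

/-- Lifts of `y` are independent of the block coordinates, by testing independence in two stages,
and therefore extend with them to a coordinate system; the blocks do not change. -/
lemma exists_chart [Nonempty J] (h : IsSncChart ρ x w b I) {ι : Type*} [Fintype ι] {y : ι → O}
    (hy : IndepMod (⨆ i, I i) y) :
    ∃ (s' : ℕ) (v : ι → R) (w' : Fin s' → R), ρ ∘ v = y ∧
      IsSncChart ρ x (Sum.elim v w') b I := by
  choose v hv using fun j => h.surj (y j)
  have hv' : ρ ∘ v = y := funext hv
  rw [← hv', ← indepMod_comap_iff h.surj, h.comap_iSup_univ] at hy
  have h1 : IndepMod ⊥ (Sum.elim x v) := by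
    rw [indepMod_sumElim, bot_sup_eq]
    exact ⟨(indepMod_sumElim.1 h.isRegularSystem.indepMod).1, hy⟩
  obtain ⟨s', w', h2⟩ := h.isRegularSystem.exists_extension h1
  refine ⟨s', v, w', hv', h.surj, ?_, h.comap_eq⟩
  rw [← isRegularSystem_comp_equiv_iff (Equiv.sumAssoc p ι (Fin s'))]
  convert! h2 using 1
  funext k
  rcases k with (k | k) | k <;> rfl

lemma ringKrullDim_quotient (h : IsSncChart ρ x w b I) (i : J) :
    ringKrullDim (O ⧸ I i) + (Nat.card {k // b k = i} : ℕ) =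
      (Fintype.card p + Fintype.card s : ℕ) := by
  classical
  have hP : (I i).IsPrime := by
    refine isPrime_of_isPrime_comap h.surj ?_
    rw [h.comap_eq, span_image_eq_mono_inl x w]
    have := h.isRegularSystem.isPrime_span_image (Sum.inl '' {k | b k = i})
    rwa [← Set.image_comp, Sum.elim_comp_inl, span_image_eq_mono_inl x w] at this
  have : IsLocalRing (O ⧸ I i) := .of_surjective' _ Ideal.Quotient.mk_surjective
  have h1 := h.isRegularSystem.of_surjective_of_ker_eq (Sum.inl '' {k | b k = i})
    (π := (Ideal.Quotient.mk (I i)).comp ρ) (Ideal.Quotient.mk_surjective.comp h.surj) (by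
      rw [← RingHom.comap_ker, Ideal.mk_ker, h.comap_eq, ← Set.image_comp, Sum.elim_comp_inl])
  rw [h1.2, ← Nat.cast_add]
  have h2 := Nat.card_congr (Equiv.sumCompl (· ∈ (Sum.inl '' {k | b k = i} : Set (p ⊕ s))))
  rw [Nat.card_sum, Nat.card_congr (Equiv.Set.image (Sum.inl : p → p ⊕ s) {k | b k = i}
    Sum.inl_injective).symm, Nat.card_sum, Nat.card_eq_fintype_card (α := p),
    Nat.card_eq_fintype_card (α := s), add_comm, Nat.card_eq_fintype_card] at h2
  exact congrArg _ h2

/-- A prime of codimension one on one component is principal there. -/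
lemma exists_eq_sup_span [Nonempty J] (h : IsSncChart ρ x w b I) (i : J) {P : Ideal O}
    (hP : P.IsPrime) (hle : I i ≤ P) (hne : P ≠ I i)
    (hmin : ∀ Q : Ideal O, Q.IsPrime → I i ≤ Q → Q ≠ I i → Q ≤ P → Q = P) :
    ∃ g, P = I i ⊔ Ideal.span {g} := by
  classical
  have hItop : I i ≠ ⊤ := ne_top_of_le_ne_top hP.ne_top hle
  have := Ideal.Quotient.nontrivial_iff.2 hItop
  have : IsLocalRing (O ⧸ I i) := .of_surjective' _ Ideal.Quotient.mk_surjective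
  have h1 := h.isRegularSystem.of_surjective_of_ker_eq (Sum.inl '' {k | b k = i})
    (π := (Ideal.Quotient.mk (I i)).comp ρ) (Ideal.Quotient.mk_surjective.comp h.surj) (by
      rw [← RingHom.comap_ker, Ideal.mk_ker, h.comap_eq, ← Set.image_comp, Sum.elim_comp_inl])
  have : IsNoetherianRing (O ⧸ I i) := isNoetherianRing_of_surjective _ _
    ((Ideal.Quotient.mk (I i)).comp ρ) (Ideal.Quotient.mk_surjective.comp h.surj)
  let _ : Algebra ℚ (O ⧸ I i) :=
    (((Ideal.Quotient.mk (I i)).comp ρ).comp (algebraMap ℚ R)).toAlgebra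
  have hker : RingHom.ker (Ideal.Quotient.mk (I i)) ≤ P := by rwa [Ideal.mk_ker]
  have hcm : (P.map (Ideal.Quotient.mk (I i))).comap (Ideal.Quotient.mk (I i)) = P := by
    rw [Ideal.comap_map_of_surjective _ Ideal.Quotient.mk_surjective, ← RingHom.ker_eq_comap_bot]
    exact sup_eq_left.2 hker
  have h0 : P.map (Ideal.Quotient.mk (I i)) ≠ ⊥ := fun h0 => by
    rw [Ideal.map_eq_bot_iff_le_ker, Ideal.mk_ker] at h0
    exact hne (le_antisymm h0 hle)
  have h2 : ∀ Q : Ideal (O ⧸ I i), Q.IsPrime → Q ≠ ⊥ → Q ≤ P.map (Ideal.Quotient.mk (I i)) →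
      Q = P.map (Ideal.Quotient.mk (I i)) := fun Q hQ hQ0 hQP => by
    rw [← hmin (Q.comap (Ideal.Quotient.mk (I i))) inferInstance ?_ ?_ ?_]
    · exact (Ideal.map_comap_of_surjective _ Ideal.Quotient.mk_surjective _).symm
    · exact fun z hz => by
        rw [Ideal.mem_comap, Ideal.Quotient.eq_zero_iff_mem.2 hz]; exact Q.zero_mem
    · intro h0
      refine hQ0 (eq_bot_iff.2 ?_)
      rw [← Ideal.map_comap_of_surjective _ Ideal.Quotient.mk_surjective Q, h0]
      exact (Ideal.map_eq_bot_iff_le_ker _).2 Ideal.mk_ker.ge |>.le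
    · rw [← hcm]
      exact Ideal.comap_mono hQP
  obtain ⟨g', -, hg'⟩ := h1.exists_eq_span_singleton
    (Ideal.map_isPrime_of_surjective Ideal.Quotient.mk_surjective hker) h0 h2
  obtain ⟨g, rfl⟩ := Ideal.Quotient.mk_surjective g'
  refine ⟨g, ?_⟩
  rw [← hcm, hg', ← Set.image_singleton, ← Ideal.map_span,
    Ideal.comap_map_of_surjective _ Ideal.Quotient.mk_surjective, ← RingHom.ker_eq_comap_bot,
    Ideal.mk_ker, sup_comm]

/-- The exponent of the product has degree exactly `B.card` and involves no block coordinate. This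
bounds the number of factors of a divisor by its trace on the intersection of all components. -/
lemma prod_notMem [Nonempty J] (h : IsSncChart ρ x w b I) (B : Finset s) :
    ∏ l ∈ B, ρ (w l) ∉ maximalIdeal O ^ (B.card + 1) ⊔ ⨆ i, I i := by
  rw [← map_prod, ← Ideal.mem_comap, comap_maximalIdeal_pow_sup h.surj, h.comap_iSup_univ,
    ← h.isRegularSystem.1, pow_eq_mono, ← Set.image_univ, span_image_eq_mono_inl x w, ← mono_union,
    ← tmon_prodExp x w, tmon_mem_mono_iff h.isRegularSystem
      ((isUpperSet_degree _).union (isUpperSet_inl _))]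
  rintro (h1 | ⟨k, -, h1⟩)
  · have h2 : B.card + 1 ≤ (prodExp p B).degree := h1
    rw [degree_prodExp] at h2
    omega
  · simp [prodExp] at h1

end IsSncChart

lemma hilbertSamuel_comap [IsLocalRing O] (hρ : Function.Surjective ρ) (A : Ideal O) :
    hilbertSamuel (A.comap ρ) = hilbertSamuel A := by
  funext k
  rw [hilbertSamuel, hilbertSamuel, sup_comm, ← comap_maximalIdeal_pow_sup hρ, sup_comm]
  let _ : Algebra R O := ρ.toAlgebra
  have h1 : Module.length R (O ⧸ (A ⊔ maximalIdeal O ^ (k + 1))) =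
      Module.length O (O ⧸ (A ⊔ maximalIdeal O ^ (k + 1))) :=
    Module.length_eq_of_surjective hρ
  rw [← h1]
  let F : R →ₗ[R] O ⧸ (A ⊔ maximalIdeal O ^ (k + 1)) :=
    ((A ⊔ maximalIdeal O ^ (k + 1)).mkQ.restrictScalars R).comp (Algebra.linearMap R O)
  have hF : Function.Surjective F := (Submodule.mkQ_surjective _).comp hρ
  have hker : (A ⊔ maximalIdeal O ^ (k + 1)).comap ρ = LinearMap.ker F := by
    ext r
    exact (Submodule.Quotient.mk_eq_zero (A ⊔ maximalIdeal O ^ (k + 1))).symm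
  exact ((Submodule.quotEquivOfEq _ _ hker).trans (F.quotKerEquivOfSurjective hF)).length_eq

lemma spanFinrank_maximalIdeal_of_indepMod [IsNoetherianRing R] {y : s → R} (hy : IndepMod ⊥ y)
    (hspan : Ideal.span (Set.range y) = maximalIdeal R) :
    (maximalIdeal R).spanFinrank = Fintype.card s := by
  refine le_antisymm (by rw [← hspan]; exact spanFinrank_span_range_le y) ?_
  rw [spanFinrank_maximalIdeal_eq_finrank_cotangentSpace,
    ← finrank_span_eq_card (linearIndependent_toCotangent hy)]
  exact Submodule.finrank_le _

/-- A monomial vanishing on two components involves coordinates from two distinct blocks, so the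
intersection lies in the square of the maximal ideal and no coordinate of the chart is superfluous.
-/
lemma IsSncChart.embDim_iInf [IsLocalRing O] [IsNoetherianRing R] [Algebra ℚ R]
    (h : IsSncChart ρ x w b I) {i j : J} (hij : i ≠ j) :
    embDim (⨅ i, I i) = Fintype.card p + Fintype.card s := by
  have hle : (⨅ i, I i).comap ρ ≤ maximalIdeal R ^ 2 := by
    refine (Ideal.comap_mono (le_inf (iInf_le _ i) (iInf_le _ j))).trans ?_
    rw [Ideal.comap_inf, h.comap_eq, h.comap_eq, span_image_eq_mono_inl x w,
      span_image_eq_mono_inl x w, ← mono_inter h.isRegularSystem (isUpperSet_inl _)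
      (isUpperSet_inl _), ← h.isRegularSystem.1, pow_eq_mono]
    refine mono_mono _ ?_
    rintro α ⟨⟨k, hk, hk'⟩, l, hl, hl'⟩
    have hkl : k ≠ l := by
      rintro rfl
      exact hij (hk.symm.trans hl)
    classical
    change 2 ≤ α.degree
    rw [Finsupp.degree_eq_sum]
    calc 2 ≤ α (Sum.inl k) + α (Sum.inl l) := by omega
      _ = ∑ i ∈ {Sum.inl k, Sum.inl l}, α i := by
        rw [Finset.sum_pair (by simpa using hkl)]
      _ ≤ _ := Finset.sum_le_sum_of_subset (Finset.subset_univ _)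
  have htop : (⨅ i, I i) ≠ ⊤ := by
    intro h0
    rw [h0, Ideal.comap_top, top_le_iff] at hle
    exact Ideal.IsPrime.ne_top inferInstance
      (top_le_iff.1 (hle.symm.le.trans (Ideal.pow_le_self two_ne_zero)))
  have := Ideal.Quotient.nontrivial_iff.2 htop
  have : IsLocalRing (O ⧸ ⨅ i, I i) := .of_surjective' _ Ideal.Quotient.mk_surjective
  have hsurj : Function.Surjective ((Ideal.Quotient.mk (⨅ i, I i)).comp ρ) :=
    Ideal.Quotient.mk_surjective.comp h.surj
  have : IsNoetherianRing (O ⧸ ⨅ i, I i) := isNoetherianRing_of_surjective _ _ _ hsurj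
  rw [embDim, map_maximalIdeal_of_surjective Ideal.Quotient.mk_surjective,
    spanFinrank_maximalIdeal_of_indepMod
      (y := (Ideal.Quotient.mk (⨅ i, I i)).comp ρ ∘ Sum.elim x w), Fintype.card_sum]
  · rw [← indepMod_comap_iff hsurj]
    refine ⟨h.isRegularSystem.mem_maximalIdeal, fun c hc => h.isRegularSystem.indepMod.2 c ?_⟩
    rw [← RingHom.ker_eq_comap_bot, ← RingHom.comap_ker, Ideal.mk_ker, sup_eq_left.2 hle] at hc
    rwa [sup_bot_eq]
  · rw [Set.range_comp, ← Ideal.map_span, h.isRegularSystem.1,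
      map_maximalIdeal_of_surjective hsurj]

/-- If a divisor has the same number of branches on the component `m` as on all the other
components, where it has normal crossings, and the same trace on the intersections, then it can be
given by equations that are independent on the intersection of all components. -/
theorem IsSncChart.exists_matching [IsLocalRing O] [IsNoetherianRing R] [Algebra ℚ R]
    {ι s' γ : Type*} [Fintype ι] [Fintype s'] [Fintype γ] {v : ι → R} {w' : s' → R}
    (h : IsSncChart ρ x (Sum.elim v w') b I) (m i₀ : J) (hi₀ : i₀ ≠ m) (g : γ → O)
    (hgm : ∀ j, g j ∈ maximalIdeal O)
    (hg : ∀ i ≠ m, I m ⊔ Ideal.span {∏ j, g j} ⊔ I i = I m ⊔ I i ⊔ Ideal.span {∏ l, ρ (v l)})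
    (hcard : Fintype.card ι = Fintype.card γ) :
    ∃ (σ : ι → γ) (f : ι → O), Function.Bijective σ ∧ IndepMod (⨆ i, I i) f ∧
      ∀ l, I m ⊔ Ideal.span {f l} = I m ⊔ Ideal.span {g (σ l)} ∧
        ∀ i ≠ m, I i ⊔ Ideal.span {f l} = I i ⊔ Ideal.span {ρ (v l)} := by
  classical
  have : Nonempty J := ⟨m⟩
  set S := ⨆ i, I i with hS
  have hIS : ∀ i, I i ≤ S := le_iSup I
  have hind : IndepMod S fun l => ρ (v l) := h.indepMod.comp Sum.inl_injective
  have hSm : S ≤ maximalIdeal O := by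
    refine iSup_le fun i => ?_
    refine le_maximalIdeal fun h0 => ?_
    have h1 := h.comap_eq i
    rw [h0, Ideal.comap_top] at h1
    have := h.isRegularSystem.span_image_ne_top (Sum.inl '' {k | b k = i})
    rw [← Set.image_comp, Sum.elim_comp_inl] at this
    exact this h1.symm
  have hpair : ∀ i, (⨆ k : ({i, m} : Set J), I k) = I i ⊔ I m := fun i => by
    rw [iSup_subtype (f := fun k : ({i, m} : Set J) => I k), iSup_pair]
  have hprime : ∀ i l, (I i ⊔ I m ⊔ Ideal.span {ρ (v l)}).IsPrime := fun i l => by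
    have := h.isPrime_coord (T := {i, m}) ⟨i, by simp⟩ {Sum.inl l}
    rwa [hpair, Set.image_singleton] at this
  -- The product of the `g j` lies in the prime of `v l` on the intersection of two components, so
  -- some `g j` is there a multiple of `v l`. If the multiplier were not a unit, `∏ g`, and with it
  -- `∏ v`, would have order above the number of factors modulo `S`.
  have hex : ∀ i ≠ m, ∀ l, ∃ j u, IsUnit u ∧ g j - u * ρ (v l) ∈ I i ⊔ I m := by
    intro i hi l
    have hP := hprime i l
    have h1 : ∏ j, g j ∈ I i ⊔ I m ⊔ Ideal.span {ρ (v l)} := by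
      have h2 : ∏ j, g j ∈ I m ⊔ Ideal.span {∏ j, g j} ⊔ I i :=
        Ideal.mem_sup_left (Ideal.mem_sup_right (Ideal.mem_span_singleton_self _))
      rw [hg i hi, sup_comm (I m)] at h2
      have h3 : Ideal.span {∏ l, ρ (v l)} ≤ Ideal.span {ρ (v l)} :=
        Ideal.span_singleton_le_span_singleton.2
          (Finset.dvd_prod_of_mem (fun l => ρ (v l)) (Finset.mem_univ l))
      exact (sup_le_sup_left h3 (I i ⊔ I m) : _ ≤ _) h2
    obtain ⟨j, -, hj⟩ := Ideal.IsPrime.prod_mem_iff.1 h1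
    obtain ⟨s₁, hs₁, s₂, hs₂, hj'⟩ := Submodule.mem_sup.1 hj
    obtain ⟨u, rfl⟩ := Ideal.mem_span_singleton'.1 hs₂
    refine ⟨j, u, ?_, by rw [← hj']; simpa using hs₁⟩
    by_contra hu
    have hum : u ∈ maximalIdeal O := (mem_maximalIdeal u).2 hu
    have h2 : ∏ l, ρ (v l) ∈ I m ⊔ Ideal.span {∏ j, g j} ⊔ I i := by
      rw [hg i hi]
      exact Ideal.mem_sup_right (Ideal.mem_span_singleton_self _)
    have h3 : g j ∈ maximalIdeal O ^ 2 ⊔ S := by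
      rw [← hj', pow_two]
      exact add_mem (Ideal.mem_sup_right (sup_le (hIS i) (hIS m) hs₁))
        (Ideal.mem_sup_left (Ideal.mul_mem_mul hum (hind.1 l)))
    have h4 : ∏ j, g j ∈ maximalIdeal O ^ (Fintype.card ι + 1) ⊔ S := by
      rw [← Finset.mul_prod_erase _ _ (Finset.mem_univ j)]
      have h5 : ∏ k ∈ Finset.univ.erase j, g k ∈ maximalIdeal O ^ (Fintype.card γ - 1) := by
        have := Ideal.prod_mem_prod (s := Finset.univ.erase j) (I := fun _ => maximalIdeal O)
          (x := g) fun k _ => hgm k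
        rwa [Finset.prod_const, Finset.card_erase_of_mem (Finset.mem_univ j),
          Finset.card_univ] at this
      obtain ⟨a, ha, c, hc, hac⟩ := Submodule.mem_sup.1 h3
      rw [← hac, add_mul]
      refine add_mem (Ideal.mem_sup_left ?_) (Ideal.mem_sup_right (Ideal.mul_mem_right _ _ hc))
      have hpos : 0 < Fintype.card γ := Fintype.card_pos_iff.2 ⟨j⟩
      have h6 : Fintype.card ι + 1 = 2 + (Fintype.card γ - 1) := by omega
      rw [h6, pow_add]
      exact Ideal.mul_mem_mul ha h5
    have h7 := h.prod_notMem ((Finset.univ : Finset ι).map Function.Embedding.inl)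
    rw [Finset.prod_map, Finset.card_map, Finset.card_univ] at h7
    refine h7 (sup_le (sup_le ((hIS m).trans le_sup_right) ?_) ((hIS i).trans le_sup_right) h2)
    rwa [Ideal.span_singleton_le_iff_mem]
  choose τ u hu hτ using hex
  have hτS : ∀ i hi l, g (τ i hi l) - u i hi l * ρ (v l) ∈ maximalIdeal O ^ 2 ⊔ S := fun i hi l =>
    Ideal.mem_sup_right (sup_le (hIS i) (hIS m) (hτ i hi l))
  have hτeq : ∀ i hi i' hi' l l', τ i hi l = τ i' hi' l' → l = l' := by
    intro i hi i' hi' l l' heq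
    refine hind.eq_of_sub_mem (v := u i' hi' l') (hu i hi l) ?_
    have h1 := hτS i hi l
    rw [heq] at h1
    have h2 := sub_mem (hτS i' hi' l') h1
    convert h2 using 1
    ring
  -- Independence of the `v l` gives injectivity, the equality of cardinalities the rest. The same
  -- independence then shows that the matching does not depend on the component.
  have hbij : Function.Bijective (τ i₀ hi₀) :=
    (Fintype.bijective_iff_injective_and_card _).2 ⟨fun l l' => hτeq _ _ _ _ l l', hcard⟩
  have hτi : ∀ i hi l, τ i hi l = τ i₀ hi₀ l := by
    intro i hi l
    obtain ⟨l', hl'⟩ := hbij.2 (τ i hi l)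
    rw [← hl', hτeq _ _ _ _ _ _ hl']
  have hg' : ∀ l, ∃ n ∈ ⨅ i : {i // i ≠ m}, I i, ∃ a ∈ I m, ∃ e, IsUnit e ∧
      g (τ i₀ hi₀ l) = n + (a + e * ρ (v l)) := by
    intro l
    have h1 : g (τ i₀ hi₀ l) ∈ (⨅ i : {i // i ≠ m}, I i) ⊔ (I m ⊔ Ideal.span {ρ (v l)}) := by
      refine h.iInf_coord_sup_le m (Sum.inl l) fun i => ?_
      rw [← sup_assoc, ← hτi i i.2, ← sub_add_cancel (g (τ i i.2 l)) (u i i.2 l * ρ (v l))]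
      exact add_mem (Ideal.mem_sup_left (hτ i i.2 l))
        (Ideal.mem_sup_right (Ideal.mul_mem_left _ _ (Ideal.mem_span_singleton_self _)))
    obtain ⟨n, hn, n', hn', h2⟩ := Submodule.mem_sup.1 h1
    obtain ⟨a, ha, n'', hn'', rfl⟩ := Submodule.mem_sup.1 hn'
    obtain ⟨e, rfl⟩ := Ideal.mem_span_singleton'.1 hn''
    refine ⟨n, hn, a, ha, e, ?_, h2.symm⟩
    have hnS : n ∈ S := hIS i₀ ((Submodule.mem_iInf _).1 hn ⟨i₀, hi₀⟩)
    have h3 : u i₀ hi₀ l - e ∈ maximalIdeal O := by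
      refine hind.mem_of_mul_mem (j := l) ?_
      have h4 := hτS i₀ hi₀ l
      rw [← h2] at h4
      have h5 := sub_mem (add_mem (Ideal.mem_sup_right hnS)
        (Ideal.mem_sup_right (hIS m ha))) h4
      convert h5 using 1
      ring
    by_contra he
    have h6 := add_mem h3 ((mem_maximalIdeal e).2 he)
    rw [sub_add_cancel] at h6
    exact (mem_maximalIdeal _).1 h6 (hu i₀ hi₀ l)
  choose n hn a ha e he hgl using hg'
  -- The omitted summand `a l` vanishes on the component `m`, and `n l` vanishes on all the others,
  -- so this element restricts correctly to every component.
  refine ⟨τ i₀ hi₀, fun l => n l + e l * ρ (v l), hbij, ?_, fun l => ⟨?_, fun i hi => ?_⟩⟩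
  · refine hind.congr hSm he fun l => Ideal.mem_sup_right ?_
    rw [add_sub_cancel_right]
    exact hIS i₀ ((Submodule.mem_iInf _).1 (hn l) ⟨i₀, hi₀⟩)
  · refine sup_span_singleton_congr ?_
    rw [hgl]
    have : n l + e l * ρ (v l) - (n l + (a l + e l * ρ (v l))) = - a l := by ring
    rw [this]
    exact neg_mem (ha l)
  · rw [sup_span_singleton_congr (g := e l * ρ (v l)), Ideal.span_singleton_mul_left_unit (he l)]
    rw [add_sub_cancel_right]
    exact (Submodule.mem_iInf _).1 (hn l) ⟨i, hi⟩

/-- The number of branches on the component `m` is the number of branches on the other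
components, if the Hilbert-Samuel function is that of normal crossings. -/
theorem IsSncChart.card_eq_of_hilbertSamuel [IsLocalRing O] [IsNoetherianRing R] [Algebra ℚ R]
    (K : Type u) [Field K] [CharZero K]
    {ι s' γ : Type*} [Fintype ι] [Fintype s'] [Fintype γ] {v : ι → R} {w' : s' → R}
    (h : IsSncChart ρ x (Sum.elim v w') b I) (hb : ∀ i, ∃ k, b k = i)
    (m i₀ : J) (hi₀ : i₀ ≠ m) (g : γ → O)
    (hgm : ∀ j, g j ∈ maximalIdeal O)
    (hg : I m ⊔ Ideal.span {∏ j, g j} ⊔ I i₀ = I m ⊔ I i₀ ⊔ Ideal.span {∏ l, ρ (v l)})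
    (ID : Ideal O) (hID : ∀ i ≠ m, ID ≤ I i ⊔ Ideal.span {∏ l, ρ (v l)})
    (hIDm : ID ≤ I m ⊔ Ideal.span {∏ j, g j}) {N : ℕ} (φ : Fin N ≃ J) (c : Fin N → ℕ)
    (hc : ∀ j, Nat.card {k // b k = φ j} = c j) (e : ℕ)
    (he : Fintype.card p + (Fintype.card ι + Fintype.card s') = e)
    (hHS : hilbertSamuel ID =
      hilbertSamuel (modelIdeal K e c (min (Fintype.card ι) (Fintype.card γ)))) :
    Fintype.card ι = Fintype.card γ := by
  classical
  have : Nonempty J := ⟨m⟩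
  have hgpow : ∏ j, g j ∈ maximalIdeal O ^ Fintype.card γ := by
    have := Ideal.prod_mem_prod (s := Finset.univ) (I := fun _ => maximalIdeal O)
      (x := g) fun k _ => hgm k
    rwa [Finset.prod_const, Finset.card_univ] at this
  refine le_antisymm ?_ ?_
  -- Too few branches on `m`: the Hilbert-Samuel function would exceed the model in degree
  -- `Fintype.card γ + 1`.
  · by_contra! hlt
    rw [min_eq_right hlt.le] at hHS
    obtain ⟨B', -, hB'⟩ := Finset.exists_subset_card_eq
      (s := (Finset.univ : Finset ι).map (Function.Embedding.inl (β := s'))) (n := Fintype.card γ)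
      (by rw [Finset.card_map, Finset.card_univ]; exact hlt.le)
    set B := (Finset.univ : Finset ι).map (Function.Embedding.inl (β := s')) with hB
    have hBcard : B.card = Fintype.card ι := by rw [hB, Finset.card_map, Finset.card_univ]
    have hprod : ∏ l ∈ B, Sum.elim v w' l = ∏ l, v l := by rw [hB, Finset.prod_map]; rfl
    have hgR : ∃ r ∈ maximalIdeal R ^ B'.card, ρ r = ∏ j, g j := by
      rw [← map_maximalIdeal_of_surjective h.surj, ← Ideal.map_pow, ← hB'] at hgpow
      exact (Ideal.mem_map_iff_of_surjective ρ h.surj).1 hgpow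
    obtain ⟨r, hr, hr'⟩ := hgR
    have h1 := hilbertSamuel_lt h.isRegularSystem b hb m i₀ hi₀ B B' (by omega) r hr
      (ID.comap ρ) (fun i hi => ?_) ?_
    · rw [← hB', ← hilbertSamuel_comap h.surj ID, ← hilbertSamuel_eq_modelIdeal K
        h.isRegularSystem (φ.symm ∘ b) c (fun j => ?_) e (by rw [Fintype.card_sum]; exact he) B']
        at hHS
      · have h2 : ⨅ i, (Ideal.span (x '' {k | (φ.symm ∘ b) k = i}) ⊔
            Ideal.span {∏ l ∈ B', Sum.elim v w' l}) = ⨅ i, (Ideal.span (x '' {k | b k = i}) ⊔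
            Ideal.span {∏ l ∈ B', Sum.elim v w' l}) := by
          rw [← φ.iInf_comp]
          simp [Equiv.symm_apply_eq]
        rw [hHS, h2] at h1
        exact lt_irrefl _ h1
      · rw [← hc]
        simp [Equiv.symm_apply_eq]
    · rw [hprod, ← h.comap_eq, ← comap_sup_span h.surj, Set.image_singleton, map_prod]
      exact Ideal.comap_mono (hID i hi)
    · rw [← h.comap_eq, ← comap_sup_span h.surj, Set.image_singleton, hr']
      exact Ideal.comap_mono hIDm
  -- Too many branches on `m`: equality of the traces alone would give `∏ v` too large an order
  -- modulo `S`.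
  · by_contra! hlt
    have h7 := h.prod_notMem ((Finset.univ : Finset ι).map Function.Embedding.inl)
    rw [Finset.prod_map, Finset.card_map, Finset.card_univ] at h7
    have hIS : ∀ i, I i ≤ ⨆ i, I i := le_iSup I
    have h2 : ∏ l, ρ (v l) ∈ I m ⊔ Ideal.span {∏ j, g j} ⊔ I i₀ := by
      rw [hg]
      exact Ideal.mem_sup_right (Ideal.mem_span_singleton_self _)
    refine h7 (sup_le (sup_le ((hIS m).trans le_sup_right) ?_) ((hIS i₀).trans le_sup_right) h2)
    rw [Ideal.span_singleton_le_iff_mem]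
    exact Ideal.mem_sup_left (Ideal.pow_le_pow_right hlt hgpow)

end Chart

/-! ### Generizations of a point as primes of its local ring -/

section Stalks

variable {X : Scheme.{u}} {a η η' : X}

/-- The prime ideal of the local ring at `a` given by a generization of `a`. -/
noncomputable def primeAt (h : η ⤳ a) : Ideal (X.presheaf.stalk a) :=
  (maximalIdeal (X.presheaf.stalk η)).comap (X.presheaf.stalkSpecializes h).hom

instance isPrime_primeAt (h : η ⤳ a) : (primeAt h).IsPrime := by
  unfold primeAt; infer_instance

lemma fromSpecStalk_primeAt (h : η ⤳ a) :
    X.fromSpecStalk a (⟨primeAt h, inferInstance⟩ : PrimeSpectrum (X.presheaf.stalk a)) = η := by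
  have h1 := Scheme.fromSpecStalk_closedPoint (X := X) (x := η)
  rw [← Scheme.SpecMap_stalkSpecializes_fromSpecStalk h] at h1
  exact h1

/-- The spectrum of the local ring embeds topologically in `X`, and its own specialization order is
inclusion of primes. -/
lemma primeAt_le_primeAt_iff (h : η ⤳ a) (h' : η' ⤳ a) : primeAt h ≤ primeAt h' ↔ η ⤳ η' := by
  have h1 := (IsPreimmersion.isEmbedding (X.fromSpecStalk a)).isInducing.specializes_iff
    (x := (⟨primeAt h, inferInstance⟩ : PrimeSpectrum (X.presheaf.stalk a)))
    (y := (⟨primeAt h', inferInstance⟩ : PrimeSpectrum (X.presheaf.stalk a)))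
  rw [fromSpecStalk_primeAt, fromSpecStalk_primeAt] at h1
  rw [h1]
  exact PrimeSpectrum.le_iff_specializes (⟨primeAt h, inferInstance⟩ :
    PrimeSpectrum (X.presheaf.stalk a)) ⟨primeAt h', inferInstance⟩

lemma eq_of_primeAt_eq (h : η ⤳ a) (h' : η' ⤳ a) (he : primeAt h = primeAt h') : η = η' :=
  ((primeAt_le_primeAt_iff h h').1 he.le).antisymm ((primeAt_le_primeAt_iff h' h).1 he.ge) |>.eq

lemma exists_primeAt_eq (P : Ideal (X.presheaf.stalk a)) (hP : P.IsPrime) :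
    ∃ (η : X) (h : η ⤳ a), primeAt h = P := by
  have h1 : X.fromSpecStalk a (⟨P, hP⟩ : PrimeSpectrum (X.presheaf.stalk a)) ∈ {y | y ⤳ a} := by
    rw [← Scheme.range_fromSpecStalk]
    exact ⟨_, rfl⟩
  refine ⟨_, h1, ?_⟩
  have h2 := (IsPreimmersion.isEmbedding (X.fromSpecStalk a)).injective (fromSpecStalk_primeAt h1)
  exact congrArg PrimeSpectrum.asIdeal h2

lemma primeAt_le_maximalIdeal (h : η ⤳ a) : primeAt h ≤ maximalIdeal _ :=
  le_maximalIdeal (Ideal.IsPrime.ne_top inferInstance)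

lemma idealAt_def (S : Set X) : idealAt S a = ⨅ (η : X) (_ : η ∈ S) (h : η ⤳ a), primeAt h := rfl

lemma idealAt_le_primeAt {S : Set X} (hη : η ∈ S) (h : η ⤳ a) : idealAt S a ≤ primeAt h :=
  iInf_le_of_le η (iInf_le_of_le hη (iInf_le _ h))

lemma idealAt_closure_singleton (h : η ⤳ a) : idealAt (closure {η}) a = primeAt h := by
  refine le_antisymm (idealAt_le_primeAt (subset_closure (Set.mem_singleton η)) h) ?_
  refine le_iInf fun ζ => le_iInf fun hζ => le_iInf fun hζa => ?_
  exact (primeAt_le_primeAt_iff h hζa).2 (specializes_iff_mem_closure.2 hζ)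

lemma idealAt_eq_top {S : Set X} (hS : IsClosed S) (ha : a ∉ S) : idealAt S a = ⊤ := by
  rw [idealAt_def]
  simp only [iInf_eq_top]
  exact fun ζ hζ h => absurd (h.mem_closed hS hζ) ha

lemma idealAt_iUnion {ι : Sort*} (S : ι → Set X) :
    idealAt (⋃ i, S i) a = ⨅ i, idealAt (S i) a := by
  refine le_antisymm (le_iInf fun i => le_iInf fun ζ => le_iInf fun hζ => le_iInf fun h =>
    idealAt_le_primeAt (Set.mem_iUnion.2 ⟨i, hζ⟩) h) ?_
  refine le_iInf fun ζ => le_iInf fun hζ => le_iInf fun h => ?_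
  obtain ⟨i, hi⟩ := Set.mem_iUnion.1 hζ
  exact (iInf_le _ i).trans (idealAt_le_primeAt hi h)

lemma idealAt_supp (D : X → ℚ) :
    idealAt (supp D) a = ⨅ (η : X) (_ : D η ≠ 0) (h : η ⤳ a), primeAt h := by
  rw [supp, idealAt_iUnion]
  refine iInf_congr fun η => ?_
  rw [idealAt_iUnion]
  refine iInf_congr fun hη => ?_
  by_cases h : η ⤳ a
  · rw [idealAt_closure_singleton h]
    simp [h]
  · rw [idealAt_eq_top isClosed_closure (fun h' => h (specializes_iff_mem_closure.2 h'))]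
    simp [h]

lemma exists_closure_eq {C : Set X} (hC : C ∈ irreducibleComponents X) :
    ∃ ξ : X, C = closure {ξ} := by
  obtain ⟨ξ, hξ⟩ := QuasiSober.sober hC.1
    (isClosed_of_mem_irreducibleComponents C hC)
  exact ⟨ξ, hξ.symm⟩

lemma exists_primeAt_eq_idealAt {C : Set X} (hC : C ∈ irreducibleComponents X) (ha : a ∈ C) :
    ∃ (ξ : X) (h : ξ ⤳ a), C = closure {ξ} ∧ idealAt C a = primeAt h := by
  obtain ⟨ξ, rfl⟩ := exists_closure_eq hC
  exact ⟨ξ, specializes_iff_mem_closure.2 ha, rfl, idealAt_closure_singleton _⟩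

lemma mem_iff_idealAt_le {C : Set X} (hC : C ∈ irreducibleComponents X) (h : η ⤳ a) :
    η ∈ C ↔ idealAt C a ≤ primeAt h := by
  refine ⟨fun hη => idealAt_le_primeAt hη h, fun hle => ?_⟩
  by_cases ha : a ∈ C
  · obtain ⟨ξ, hξ, rfl, h1⟩ := exists_primeAt_eq_idealAt hC ha
    rw [h1, primeAt_le_primeAt_iff] at hle
    exact specializes_iff_mem_closure.1 hle
  · rw [idealAt_eq_top (isClosed_of_mem_irreducibleComponents C hC) ha, top_le_iff] at hle
    exact absurd hle (Ideal.IsPrime.ne_top inferInstance)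

lemma eq_of_idealAt_le {C C' : Set X} (hC : C ∈ irreducibleComponents X)
    (hC' : C' ∈ irreducibleComponents X) (ha : a ∈ C) (hle : idealAt C' a ≤ idealAt C a) :
    C = C' := by
  obtain ⟨ξ, hξ, rfl, h1⟩ := exists_primeAt_eq_idealAt hC ha
  rw [h1, ← mem_iff_idealAt_le hC'] at hle
  have h2 : closure {ξ} ⊆ C' :=
    (isClosed_of_mem_irreducibleComponents C' hC').closure_subset_iff.2 (by simpa using hle)
  exact h2.antisymm (hC.2 hC'.1 h2)

/-- A component of a Weil divisor has codimension one in the components that contain it. -/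
lemma ne_and_eq_of_le {C : Set X} (hC : C ∈ irreducibleComponents X) (h : η ⤳ a) (hη : η ∈ C)
    (hdim : ringKrullDim (X.presheaf.stalk η ⧸ idealAt C η) = 1) :
    primeAt h ≠ idealAt C a ∧ ∀ Q : Ideal (X.presheaf.stalk a), Q.IsPrime → idealAt C a ≤ Q →
      Q ≠ idealAt C a → Q ≤ primeAt h → Q = primeAt h := by
  obtain ⟨ξ, hξ, rfl, h1⟩ := exists_primeAt_eq_idealAt hC hη
  have hξa : ξ ⤳ a := hξ.trans h
  rw [idealAt_closure_singleton hξa]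
  rw [h1] at hdim
  constructor
  · intro he
    obtain rfl := eq_of_primeAt_eq _ _ he
    have h2 : primeAt hξ = maximalIdeal (X.presheaf.stalk η) := by
      refine le_antisymm (primeAt_le_maximalIdeal _) ?_
      obtain ⟨ζ, hζ, h3⟩ := exists_primeAt_eq (maximalIdeal (X.presheaf.stalk η)) inferInstance
      rw [← h3, primeAt_le_primeAt_iff]
      exact hζ
    have h3 : IsField (X.presheaf.stalk η ⧸ primeAt hξ) := by
      rw [← Ideal.Quotient.maximal_ideal_iff_isField_quotient, h2]
      infer_instance
    rw [ringKrullDim_eq_zero_of_isField h3] at hdim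
    exact zero_ne_one hdim
  · intro Q hQ hle hne hQle
    -- The intermediate prime is moved to the local ring at `η`, whose quotient by the component is
    -- a domain of dimension one; a nonzero prime there is maximal.
    obtain ⟨ζ, hζ, rfl⟩ := exists_primeAt_eq Q hQ
    rw [primeAt_le_primeAt_iff] at hle hQle
    have h4 : primeAt hξ ≤ primeAt hQle := (primeAt_le_primeAt_iff _ _).2 hle
    by_cases h5 : primeAt hQle = maximalIdeal (X.presheaf.stalk η)
    · have h6 : η ⤳ ζ := by
        rw [← primeAt_le_primeAt_iff (specializes_refl η) hQle, h5]
        exact primeAt_le_maximalIdeal _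
      exact le_antisymm ((primeAt_le_primeAt_iff _ _).2 hQle) ((primeAt_le_primeAt_iff _ _).2 h6)
    · exfalso
      have h7 : Ring.KrullDimLE 1 (X.presheaf.stalk η ⧸ primeAt hξ) :=
        (Order.krullDimLE_iff _ _).2 hdim.le
      have : IsDomain (X.presheaf.stalk η ⧸ primeAt hξ) := Ideal.Quotient.isDomain _
      have hker : RingHom.ker (Ideal.Quotient.mk (primeAt hξ)) ≤ primeAt hQle := by
        rwa [Ideal.mk_ker]
      have h8 : ((primeAt hQle).map (Ideal.Quotient.mk (primeAt hξ))).IsPrime :=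
        Ideal.map_isPrime_of_surjective Ideal.Quotient.mk_surjective hker
      have h9 : (primeAt hQle).map (Ideal.Quotient.mk (primeAt hξ)) ≠ ⊥ := by
        rw [Ne, Ideal.map_eq_bot_iff_le_ker, Ideal.mk_ker]
        intro h10
        obtain rfl := eq_of_primeAt_eq _ _ (le_antisymm h10 h4)
        exact hne rfl
      have h10 := h8.isMaximal_of_ne_bot h9
      have h11 := Ideal.comap_isMaximal_of_surjective
        (Ideal.Quotient.mk (primeAt hξ)) Ideal.Quotient.mk_surjective 
        (K := (primeAt hQle).map (Ideal.Quotient.mk (primeAt hξ)))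
      rw [Ideal.comap_map_of_surjective _ Ideal.Quotient.mk_surjective, ← RingHom.ker_eq_comap_bot,
        sup_eq_left.2 hker] at h11
      exact h5 (eq_maximalIdeal h11)

end Stalks

/-! ### Local embeddings, regular points and supports -/

section Embedding

variable {K : Type u} [Field K] {X : Scheme.{u}} {f : X ⟶ Spec (.of K)} {a : X}

lemma LocalEmbedding.restr_surjective (L : LocalEmbedding f a) : Function.Surjective L.restr := by
  have := L.closedImmersion
  intro y
  obtain ⟨z, rfl⟩ := (ConcreteCategory.bijective_of_isIso (L.U.stalkIso ⟨a, L.mem⟩).hom).2 y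
  obtain ⟨w, rfl⟩ := L.i.stalkMap_surjective ⟨a, L.mem⟩ z
  exact ⟨w, rfl⟩

lemma LocalEmbedding.isNoetherianRing (L : LocalEmbedding f a) : IsNoetherianRing L.ring := by
  have := L.smooth
  have : IsLocallyNoetherian L.Z := LocallyOfFiniteType.isLocallyNoetherian L.g
  infer_instance

/-- The structure of `ℚ`-algebra on the local rings of a scheme over a field of
characteristic zero. -/
@[reducible]
noncomputable def stalkAlgebraRat [CharZero K] {Z : Scheme.{u}} (g : Z ⟶ Spec (.of K)) (z : Z) :
    Algebra ℚ (Z.presheaf.stalk z) :=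
  (((Scheme.ΓSpecIso (.of K)).inv ≫ g.appTop ≫
    Z.presheaf.germ ⊤ z trivial).hom.comp (algebraMap ℚ K)).toAlgebra

lemma isDomain_of_isRegularLocalRing (R : Type*) [CommRing R] [Algebra ℚ R]
    [IsRegularLocalRing R] : IsDomain R := by
  have hfg : Submodule.FG (maximalIdeal R) := (maximalIdeal R).fg_of_isNoetherianRing
  have hfin := hfg.finite_generators
  let _ : Fintype (Submodule.generators (maximalIdeal R)) := hfin.fintype
  refine IsRegularSystem.isDomain (t := fun k : (Submodule.generators (maximalIdeal R)) => (k : R))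
    ⟨?_, ?_⟩
  · rw [Subtype.range_coe]
    exact Submodule.span_generators (maximalIdeal R)
  · rw [← IsRegularLocalRing.spanFinrank_maximalIdeal, ← hfg.generators_ncard,
      ← Nat.card_coe_set_eq, Nat.card_eq_fintype_card]

/-- The local ring at a regular point is a domain, so it has a single minimal prime. -/
lemma eq_of_mem_of_isRegularLocalRing [CharZero K] (f : X ⟶ Spec (.of K)) {η : X}
    (hη : η ∉ singLocus X) {C C' : Set X} (hC : C ∈ irreducibleComponents X)
    (hC' : C' ∈ irreducibleComponents X) (h : η ∈ C) (h' : η ∈ C') : C = C' := by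
  have : IsRegularLocalRing (X.presheaf.stalk η) := not_not.1 hη
  let _ := stalkAlgebraRat f η
  have := isDomain_of_isRegularLocalRing (X.presheaf.stalk η)
  obtain ⟨ζ, hζ, h1⟩ := exists_primeAt_eq (⊥ : Ideal (X.presheaf.stalk η)) inferInstance
  have key : ∀ C ∈ irreducibleComponents X, η ∈ C → C = closure {ζ} := fun C hC h => by
    obtain ⟨ξ, hξ, rfl, -⟩ := exists_primeAt_eq_idealAt hC h
    have h2 : ζ ⤳ ξ := by
      rw [← primeAt_le_primeAt_iff hζ hξ, h1]
      exact bot_le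
    have h3 : closure {ξ} ⊆ closure {ζ} := h2.closure_subset
    exact h3.antisymm (hC.2 isIrreducible_singleton.closure h3)
  rw [key C hC h, key C' hC' h']

lemma stalkIdeal_eq_top {I : X.IdealSheafData} {η : X} (h : η ∉ (I.support : Set X)) :
    stalkIdeal I η = ⊤ := by
  obtain ⟨_, ⟨V, hV, rfl⟩, hηV, -⟩ :=
    X.isBasis_affineOpens.exists_subset_of_mem_open (Set.mem_univ η) isOpen_univ
  have h1 := (I.mem_support_iff_of_mem (U := ⟨V, hV⟩) hηV).not.1 h
  rw [Scheme.mem_zeroLocus_iff] at h1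
  push Not at h1
  obtain ⟨s, hs, hηs⟩ := h1
  rw [Scheme.mem_basicOpen _ _ _ hηV] at hηs
  refine Ideal.eq_top_of_isUnit_mem _ ?_ hηs
  exact (le_iSup_of_le ⟨V, hV⟩ (le_iSup_of_le hηV le_rfl) :
    (I.ideal ⟨V, hV⟩).map (X.presheaf.germ V η hηV).hom ≤ stalkIdeal I η)
    (Ideal.mem_map_of_mem _ hs)

lemma OrderedSncDivisor.toDivisor_eq_zero (E : OrderedSncDivisor f) {η : X}
    (h : η ∉ E.support) : E.toDivisor η = 0 := by
  refine Finset.sum_eq_zero fun k _ => ?_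
  have h1 : stalkIdeal (E.H k) η = ⊤ :=
    stalkIdeal_eq_top fun hk => h (Set.mem_iUnion.2 ⟨k, hk⟩)
  rw [cycle, h1]
  simp

end Embedding

/-! ### Equations up to units modulo the component ideals -/

section ChartLemmas

variable {O : Type*} [CommRing O] {ι κ : Type*} [Fintype ι] [Fintype κ]

/-- Elements that are associated modulo `S`. -/
def AssocMod (S : Ideal O) (f g : O) : Prop := ∃ u, IsUnit u ∧ g - u * f ∈ S

lemma AssocMod.symm {S : Ideal O} {f g : O} (h : AssocMod S f g) : AssocMod S g f := by
  obtain ⟨u, hu, h⟩ := h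
  obtain ⟨v, hv⟩ := hu.exists_left_inv
  refine ⟨v, IsUnit.of_mul_eq_one u hv, ?_⟩
  have h1 : f - v * g = -(v * (g - u * f)) + (1 - v * u) * f := by ring
  rw [h1, hv, sub_self, zero_mul, add_zero]
  exact neg_mem (Ideal.mul_mem_left _ _ h)

lemma AssocMod.trans {S : Ideal O} {f g k : O} (h : AssocMod S f g) (h' : AssocMod S g k) :
    AssocMod S f k := by
  obtain ⟨u, hu, h⟩ := h
  obtain ⟨v, hv, h'⟩ := h'
  refine ⟨v * u, hv.mul hu, ?_⟩
  have h1 : k - v * u * f = (k - v * g) + v * (g - u * f) := by ring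
  rw [h1]
  exact add_mem h' (Ideal.mul_mem_left _ _ h)

variable [IsLocalRing O]

lemma IndepMod.eq_of_assocMod {S : Ideal O} {y : ι → O} (h : IndepMod S y) {j k : ι}
    (hjk : AssocMod S (y j) (y k)) : j = k := by
  obtain ⟨u, -, hu⟩ := hjk
  refine (h.eq_of_sub_mem (u := 1) isUnit_one (v := u) (Ideal.mem_sup_right ?_)).symm
  rwa [one_mul]

/-- Each generator is a multiple of the other modulo `S`, and independence forces the product of the
multipliers to be `1` modulo the maximal ideal. This is how a branch on one component determines an
equation. -/
lemma IndepMod.assocMod_of_sup_span_eq {S I I' : Ideal O} {y : ι → O}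
    (h : IndepMod S y) (hI : I ≤ S) (hI' : I' ≤ S) {j : ι} {g : O}
    (heq : I ⊔ Ideal.span {y j} = I' ⊔ Ideal.span {g}) : AssocMod S (y j) g := by
  have h1 : g ∈ I ⊔ Ideal.span {y j} :=
    heq ▸ Ideal.mem_sup_right (Ideal.mem_span_singleton_self _)
  have h2 : y j ∈ I' ⊔ Ideal.span {g} :=
    heq ▸ Ideal.mem_sup_right (Ideal.mem_span_singleton_self _)
  obtain ⟨p, hp, q, hq, rfl⟩ := Submodule.mem_sup.1 h1
  obtain ⟨u, rfl⟩ := Ideal.mem_span_singleton'.1 hq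
  obtain ⟨p', hp', q', hq', h3⟩ := Submodule.mem_sup.1 h2
  obtain ⟨v, rfl⟩ := Ideal.mem_span_singleton'.1 hq'
  refine ⟨u, ?_, by rw [add_sub_cancel_right]; exact hI hp⟩
  have h4 : 1 - v * u ∈ maximalIdeal O := by
    refine h.mem_of_mul_mem (j := j) (Ideal.mem_sup_right ?_)
    have h5 : (1 - v * u) * y j = p' + v * p := by
      rw [sub_mul, one_mul]
      nth_rw 1 [← h3]
      ring
    rw [h5]
    exact add_mem (hI' hp') (Ideal.mul_mem_left _ _ (hI hp))
  by_contra hu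
  have h6 := add_mem h4 (Ideal.mul_mem_left _ v ((mem_maximalIdeal u).2 hu))
  rw [sub_add_cancel] at h6
  exact (mem_maximalIdeal _).1 h6 isUnit_one

lemma IndepMod.eq_of_sup_span_eq {S I I' : Ideal O} {y : ι → O}
    (h : IndepMod S y) (hI : I ≤ S) (hI' : I' ≤ S) {j k : ι}
    (heq : I ⊔ Ideal.span {y j} = I' ⊔ Ideal.span {y k}) : j = k :=
  h.eq_of_assocMod (h.assocMod_of_sup_span_eq hI hI' heq)

lemma IndepMod.congr_of_assocMod {S : Ideal O} (hS : S ≤ maximalIdeal O) {y : ι → O}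
    (h : IndepMod S y) {y' : κ → O} {τ : κ → ι} (hτ : Function.Injective τ)
    (hy : ∀ k, AssocMod S (y (τ k)) (y' k)) : IndepMod S y' := by
  choose u hu huy using hy
  exact (h.comp hτ).congr hS hu fun k => Ideal.mem_sup_right (huy k)

variable {R : Type*} [CommRing R] [IsLocalRing R] {p s J : Type*} [Fintype p] [Fintype s]
  {ρ : R →+* O} {x : p → R} {w : s → R} {b : p → J} {I : J → Ideal O}

namespace IsSncChart

/-- An empty block would make the ideal of the component contained in all the others. -/
lemma exists_block {O : Type*} [CommRing O] {ρ : R →+* O} {I : J → Ideal O}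
    (h : IsSncChart ρ x w b I) {i i' : J} (hii' : ¬ I i ≤ I i') :
    ∃ k, b k = i := by
  by_contra! hcon
  refine hii' ((comap_le_comap_iff h.surj).1 ?_)
  rw [h.comap_eq, Set.eq_empty_of_forall_notMem (s := {k | b k = i}) hcon]
  simp

lemma iSup_le_maximalIdeal (h : IsSncChart ρ x w b I) : ⨆ i, I i ≤ maximalIdeal O := by
  refine iSup_le fun i => le_maximalIdeal fun h0 => ?_
  have h1 := h.comap_eq i
  rw [h0, Ideal.comap_top] at h1
  have := h.isRegularSystem.span_image_ne_top (Sum.inl '' {k | b k = i})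
  rw [← Set.image_comp, Sum.elim_comp_inl] at this
  exact this h1.symm

variable [IsNoetherianRing R] [Algebra ℚ R]

lemma isPrime_sup_span (h : IsSncChart ρ x w b I) {y : ι → O} (hy : IndepMod (⨆ i, I i) y)
    (i : J) (j : ι) : (I i ⊔ Ideal.span {y j}).IsPrime := by
  have : Nonempty J := ⟨i⟩
  obtain ⟨s', v, w', rfl, h'⟩ := h.exists_chart hy
  have h1 := h'.isPrime_coord (T := {i}) (Set.singleton_nonempty i) {Sum.inl j}
  rwa [iSup_unique, Set.image_singleton] at h1

lemma eq_of_le_sup_span (h : IsSncChart ρ x w b I) {y : ι → O}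
    (hy : IndepMod (⨆ i, I i) y) {i i' : J} (hb : ∃ k, b k = i') {j : ι}
    (hle : I i' ≤ I i ⊔ Ideal.span {y j}) :
    i' = i := by
  have : Nonempty J := ⟨i⟩
  obtain ⟨s', v, w', rfl, h'⟩ := h.exists_chart hy
  have h1 := (h'.coord_le_coord_iff (T := {i'}) (T' := {i}) (Set.singleton_nonempty i')
    (Set.singleton_nonempty i) ∅ {Sum.inl j}).1 (by
      rw [iSup_unique, iSup_unique, Set.image_singleton, Set.image_empty, Ideal.span_empty,
        sup_bot_eq]
      exact hle)
  obtain ⟨k, hk⟩ := hb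
  exact hk.symm.trans (h1.1 k hk)

/-- The intersection of the ideals of the branches on one component. -/
lemma iInf_sup_span (h : IsSncChart ρ x w b I) {y : ι → O} (hy : IndepMod (⨆ i, I i) y) (i : J) :
    ⨅ j, (I i ⊔ Ideal.span {y j}) = I i ⊔ Ideal.span {∏ j, y j} := by
  refine le_antisymm (fun f hf => ?_) (le_iInf fun j => sup_le_sup_left ?_ _)
  · refine mem_sup_span_prod _ _ (fun j => h.isPrime_sup_span hy i j) (fun j k hjk hk => hjk ?_)
      fun j _ => (Submodule.mem_iInf _).1 hf j
    obtain ⟨p, hp, q, hq, hpq⟩ := Submodule.mem_sup.1 hk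
    obtain ⟨c, rfl⟩ := Ideal.mem_span_singleton'.1 hq
    refine (hy.eq_of_sub_mem (u := 1) (v := c) isUnit_one (Ideal.mem_sup_right ?_)).symm
    rw [one_mul, ← hpq, add_sub_cancel_right]
    exact le_iSup I i hp
  · exact Ideal.span_singleton_le_span_singleton.2 (Finset.dvd_prod_of_mem y (Finset.mem_univ j))

end IsSncChart

end ChartLemmas

/-! ### Coordinate-free characterization of stable normal crossings -/

section Characterization

variable {K : Type u} [Field K] {X : Scheme.{u}} {f : X ⟶ Spec (.of K)} {a : X}

/-- The irreducible components through a point. -/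
abbrev Comps (a : X) := {C : Set X // C ∈ irreducibleComponents X ∧ a ∈ C}

/-- The ideal of a component. -/
noncomputable abbrev compIdeal (C : Comps a) : Ideal (X.presheaf.stalk a) := idealAt C.1 a

instance nonempty_comps (a : X) : Nonempty (Comps a) :=
  ⟨⟨irreducibleComponent a, irreducibleComponent_mem_irreducibleComponents a,
    mem_irreducibleComponent⟩⟩

/-- Every prime of the local ring contains one of the component ideals, so their intersection lies
in the nilradical, which is zero. -/
lemma iInf_compIdeal [IsReduced X] : ⨅ C : Comps a, compIdeal C = ⊥ := by
  rw [eq_bot_iff, ← Ideal.zero_eq_bot, ← nilradical_eq_zero (X.presheaf.stalk a),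
    nilradical_eq_sInf]
  refine le_sInf fun P hP => ?_
  obtain ⟨η, hη, rfl⟩ := exists_primeAt_eq P hP
  have h1 := isClosed_of_mem_irreducibleComponents _
    (irreducibleComponent_mem_irreducibleComponents η)
  exact (iInf_le _ (⟨irreducibleComponent η, irreducibleComponent_mem_irreducibleComponents η,
    hη.mem_closed h1 mem_irreducibleComponent⟩ : Comps a)).trans
    (idealAt_le_primeAt mem_irreducibleComponent hη)

/-- The divisor `D` is, near `a`, the sum with coefficients `α` of the hypersurfaces `y`, which have
normal crossings on the intersection of all components. -/
structure IsSncDivisor (D : X → ℚ) (a : X) {ι : Type*} [Fintype ι] (y : ι → X.presheaf.stalk a)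
    (α : ι → ℚ) : Prop where
  indep : IndepMod (⨆ C : Comps a, compIdeal C) y
  eq : ∀ (C : Comps a) (j : ι) (η : X) (h : η ⤳ a),
    primeAt h = compIdeal C ⊔ Ideal.span {y j} → D η = α j
  exists_eq : ∀ (η : X) (h : η ⤳ a), D η ≠ 0 →
    ∃ (C : Comps a) (j : ι), primeAt h = compIdeal C ⊔ Ideal.span {y j}

lemma StableSncAt.zero {D : X → ℚ} (h : StableSncAt f D a) : StableSncAt f 0 a := by
  obtain ⟨L, p, q, r, s, x, y, z, w, blk, α, h1, h2, h3, -⟩ := h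
  exact ⟨L, p, q, r, s, x, y, z, w, blk, 0, h1, h2, h3, by simp⟩

lemma comap_restr_iSup (L : LocalEmbedding f a) {p r : ℕ} {x : Fin p → L.ring} {z : Fin r → L.ring}
    {blk : Fin p → Set X} (hblk : ∀ k, blk k ∈ irreducibleComponents X ∧ a ∈ blk k)
    (hC : ∀ C ∈ irreducibleComponents X, a ∈ C →
      (idealAt C a).comap L.restr = Ideal.span (x '' {k | blk k = C} ∪ Set.range z)) :
    (⨆ C : Comps a, compIdeal C).comap L.restr = Ideal.span (Set.range (Sum.elim x z)) := by
  rw [comap_iSup_of_surjective L.restr_surjective, Set.Sum.elim_range]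
  have h1 : ∀ C : Comps a, (compIdeal C).comap L.restr =
      Ideal.span (x '' {k | blk k = C.1} ∪ Set.range z) := fun C => hC C.1 C.2.1 C.2.2
  simp_rw [h1, ← Ideal.span_iUnion, ← Set.iUnion_union, ← Set.image_iUnion]
  rw [← Set.image_univ (f := x)]
  congr 3
  refine Set.eq_univ_of_forall fun k => Set.mem_iUnion.2 ⟨⟨blk k, hblk k⟩, rfl⟩

lemma mem_divisor_iff (L : LocalEmbedding f a) {p r : ℕ} {x : Fin p → L.ring}
    {z : Fin r → L.ring} {blk : Fin p → Set X}
    (hC : ∀ C ∈ irreducibleComponents X, a ∈ C →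
      (idealAt C a).comap L.restr = Ideal.span (x '' {k | blk k = C} ∪ Set.range z))
    (y : L.ring) {η : X} (h : η ⤳ a) :
    η ∈ {ζ : X | ∃ C ∈ irreducibleComponents X, a ∈ C ∧
        (idealAt (closure {ζ}) a).comap L.restr =
          Ideal.span (x '' {k | blk k = C} ∪ Set.range z ∪ {y})} ↔
      ∃ C : Comps a, primeAt h = compIdeal C ⊔ Ideal.span {L.restr y} := by
  have key : ∀ C : Comps a, (idealAt (closure {η}) a).comap L.restr =
      Ideal.span (x '' {k | blk k = C.1} ∪ Set.range z ∪ {y}) ↔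
      primeAt h = compIdeal C ⊔ Ideal.span {L.restr y} := fun C => by
    rw [Ideal.span_union, ← hC C.1 C.2.1 C.2.2, ← comap_sup_span L.restr_surjective,
      Set.image_singleton, idealAt_closure_singleton h]
    exact (Ideal.comap_injective_of_surjective _ L.restr_surjective).eq_iff
  constructor
  · rintro ⟨C, h1, h2, h3⟩
    exact ⟨⟨C, h1, h2⟩, (key ⟨C, h1, h2⟩).1 h3⟩
  · rintro ⟨C, h3⟩
    exact ⟨C.1, C.2.1, C.2.2, (key C).2 h3⟩

lemma sum_indicator_eq {ι : Type*} [Fintype ι] {y : ι → X.presheaf.stalk a}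
    (hy : IndepMod (⨆ C : Comps a, compIdeal C) y) (α : ι → ℚ) (A : ι → Set X)
    (hA : ∀ j (η : X) (h : η ⤳ a), η ∈ A j ↔
      ∃ C : Comps a, primeAt h = compIdeal C ⊔ Ideal.span {y j}) {η : X} (h : η ⤳ a) (j : ι)
    (hj : η ∈ A j) : ∑ j, α j * (A j).indicator 1 η = α j := by
  obtain ⟨C, hC⟩ := (hA j η h).1 hj
  rw [Finset.sum_eq_single j]
  · rw [Set.indicator_of_mem hj]; simp
  · intro k _ hk
    rw [Set.indicator_of_notMem, mul_zero]
    intro hη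
    obtain ⟨C', hC'⟩ := (hA k η h).1 hη
    exact hk (hy.eq_of_sup_span_eq (le_iSup _ C') (le_iSup _ C) (hC'.symm.trans hC))
  · simp

variable [CharZero K]

/-- The sum of the component ideals pulls back to the ideal of the `x` and `z`, from which the `y`
are independent. Hypersurfaces of coefficient zero are discarded, so that each remaining equation is
visible in `D` on all components. -/
theorem StableSncAt.exists_isSncDivisor {D : X → ℚ} (h : StableSncAt f D a) :
    ∃ (ι : Type) (_ : Fintype ι) (y : ι → X.presheaf.stalk a) (α : ι → ℚ),
      (∀ j, α j ≠ 0) ∧ IsSncDivisor D a y α := by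
  classical
  obtain ⟨L, p, q, r, s, x, y, z, w, blk, α, h1, h2, h3, h4⟩ := h
  have := L.isNoetherianRing
  let _ : Algebra ℚ L.ring := stalkAlgebraRat L.g L.pt
  have hy : IndepMod (⨆ C : Comps a, compIdeal C) (L.restr ∘ y) := by
    rw [← indepMod_comap_iff L.restr_surjective, comap_restr_iSup L h2 h3]
    let e : (Fin p ⊕ Fin r) ⊕ (Fin q ⊕ Fin s) ≃ Fin p ⊕ (Fin q ⊕ (Fin r ⊕ Fin s)) :=
      { toFun := Sum.elim (Sum.elim Sum.inl (fun k => Sum.inr (Sum.inr (Sum.inl k))))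
          (Sum.elim (fun k => Sum.inr (Sum.inl k)) (fun k => Sum.inr (Sum.inr (Sum.inr k))))
        invFun := Sum.elim (fun k => Sum.inl (Sum.inl k)) (Sum.elim (fun k => Sum.inr (Sum.inl k))
          (Sum.elim (fun k => Sum.inl (Sum.inr k)) (fun k => Sum.inr (Sum.inr k))))
        left_inv := by rintro ((k | k) | (k | k)) <;> rfl
        right_inv := by rintro (k | (k | (k | k))) <;> rfl }
    have h5 : IsRegularSystem (Sum.elim (Sum.elim x z) (Sum.elim y w)) := by
      convert! h1.comp_equiv e using 1
      funext k
      rcases k with (k | k) | (k | k) <;> rfl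
    have h6 := (indepMod_sumElim.1 h5.indepMod).2
    rw [bot_sup_eq] at h6
    exact (indepMod_sumElim.1 h6).1
  have hA := fun j η (h : η ⤳ a) => mem_divisor_iff L h3 (y j) h
  refine ⟨{j // α j ≠ 0}, inferInstance, fun j => L.restr (y j), fun j => α j, fun j => j.2,
    hy.comp Subtype.val_injective, fun C j η h hη => ?_, fun η h hη => ?_⟩
  · rw [h4 η h]
    exact sum_indicator_eq hy α _ hA h j.1 ((hA _ _ _).2 ⟨C, hη⟩)
  · rw [h4 η h] at hη
    obtain ⟨j, -, hj⟩ := Finset.exists_ne_zero_of_sum_ne_zero hη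
    obtain ⟨C, hC⟩ := (hA j η h).1 (Set.mem_of_indicator_ne_zero (right_ne_zero_of_mul hj))
    exact ⟨C, ⟨j, left_ne_zero_of_mul hj⟩, hC⟩

/-- The embedding, the coordinates `x` and `z` and the blocks are kept. Lifts of the given equations
are independent of `x` and `z`, and new coordinates `w'` complete the system. -/
theorem IsSncDivisor.stableSncAt {D : X → ℚ} (h : StableSncAt f 0 a) {ι : Type*} [Fintype ι]
    {y : ι → X.presheaf.stalk a} {α : ι → ℚ} (hD : IsSncDivisor D a y α) : StableSncAt f D a := by
  classical
  obtain ⟨L, p, q, r, s, x, y₀, z, w, blk, -, h1, h2, h3, -⟩ := h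
  have := L.isNoetherianRing
  let _ : Algebra ℚ L.ring := stalkAlgebraRat L.g L.pt
  let e := Fintype.equivFin ι
  choose v hv using fun j => L.restr_surjective (y (e.symm j))
  have hv' : IndepMod (Ideal.span (Set.range (Sum.elim x z))) v := by
    rw [← comap_restr_iSup L h2 h3, indepMod_comap_iff L.restr_surjective]
    have : L.restr ∘ v = y ∘ e.symm := funext hv
    rw [this]
    exact hD.indep.comp e.symm.injective
  have hxz : IndepMod ⊥ (Sum.elim x z) := by
    have := h1.indepMod.comp (f := Sum.elim Sum.inl fun k => Sum.inr (Sum.inr (Sum.inl k))) (by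
      rintro (k | k) (l | l) hkl <;> simp at hkl ⊢ <;> exact hkl)
    convert! this using 1
    funext k
    rcases k with k | k <;> rfl
  have hxzv : IndepMod ⊥ (Sum.elim (Sum.elim x z) v) :=
    indepMod_sumElim.2 ⟨hxz, by rwa [bot_sup_eq]⟩
  obtain ⟨s', w', h5⟩ := h1.exists_extension hxzv
  refine ⟨L, p, _, r, s', x, v, z, w', blk, α ∘ e.symm, ?_, h2, h3, fun η h => ?_⟩
  · let E : Fin p ⊕ (Fin (Fintype.card ι) ⊕ (Fin r ⊕ Fin s')) ≃
        ((Fin p ⊕ Fin r) ⊕ Fin (Fintype.card ι)) ⊕ Fin s' :=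
      { toFun := Sum.elim (fun k => Sum.inl (Sum.inl (Sum.inl k)))
          (Sum.elim (fun k => Sum.inl (Sum.inr k))
            (Sum.elim (fun k => Sum.inl (Sum.inl (Sum.inr k))) Sum.inr))
        invFun := Sum.elim (Sum.elim (Sum.elim Sum.inl (fun k => Sum.inr (Sum.inr (Sum.inl k))))
          (fun k => Sum.inr (Sum.inl k))) (fun k => Sum.inr (Sum.inr (Sum.inr k)))
        left_inv := by rintro (k | (k | (k | k))) <;> rfl
        right_inv := by rintro (((k | k) | k) | k) <;> rfl }
    convert! h5.comp_equiv E using 1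
    funext k
    rcases k with k | (k | (k | k)) <;> rfl
  · have hA := fun j η (h : η ⤳ a) => mem_divisor_iff L h3 (v j) h
    simp_rw [hv] at hA
    by_cases hη : D η = 0
    · rw [hη, eq_comm]
      refine Finset.sum_eq_zero fun j _ => ?_
      by_cases hj : η ∈ {ζ : X | ∃ C ∈ irreducibleComponents X, a ∈ C ∧
        (idealAt (closure {ζ}) a).comap L.restr =
          Ideal.span (x '' {k | blk k = C} ∪ Set.range z ∪ {v j})}
      · obtain ⟨C, hC⟩ := (hA j η h).1 hj
        rw [Function.comp_apply, ← hD.eq C _ η h hC, hη, zero_mul]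
      · rw [Set.indicator_of_notMem hj, mul_zero]
    · obtain ⟨C, j, hC⟩ := hD.exists_eq η h hη
      rw [hD.eq C j η h hC]
      have h6 := sum_indicator_eq (y := y ∘ e.symm) (hD.indep.comp e.symm.injective) (α ∘ e.symm) _
        hA h (e j) ((hA _ _ _).2 ⟨C, by rw [e.symm_apply_apply]; exact hC⟩)
      rw [h6, Function.comp_apply, e.symm_apply_apply]

/-- A local embedding, divided by the coordinates that vanish on all components, is a chart. -/
theorem StableSncAt.exists_isSncChart [IsReduced X] {D : X → ℚ} (h : StableSncAt f D a) :
    ∃ (R : Type u) (_ : CommRing R) (_ : IsLocalRing R) (_ : IsNoetherianRing R) (_ : Algebra ℚ R)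
      (ρ : R →+* X.presheaf.stalk a) (p s : Type) (_ : Fintype p) (_ : Fintype s)
      (x : p → R) (w : s → R) (b : p → Comps a), IsSncChart ρ x w b compIdeal := by
  obtain ⟨L, p, q, r, s, x, y, z, w, blk, -, h1, h2, h3, -⟩ := h
  have := L.isNoetherianRing
  let _ : Algebra ℚ L.ring := stalkAlgebraRat L.g L.pt
  -- The `z` vanish on every component, hence on `X`, because `X` is reduced.
  have hz : Ideal.span (Set.range z) ≤ RingHom.ker L.restr := by
    rw [RingHom.ker_eq_comap_bot, ← iInf_compIdeal, Ideal.comap_iInf]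
    refine le_iInf fun C => ?_
    rw [h3 C.1 C.2.1 C.2.2]
    exact Ideal.span_mono Set.subset_union_right
  let π := Ideal.Quotient.mk (Ideal.span (Set.range z))
  have hπ : Function.Surjective π := Ideal.Quotient.mk_surjective
  have : Nontrivial (L.ring ⧸ Ideal.span (Set.range z)) :=
    Ideal.Quotient.nontrivial_iff.2 (ne_top_of_le_ne_top (RingHom.ker_ne_top _) hz)
  have : IsLocalRing (L.ring ⧸ Ideal.span (Set.range z)) := .of_surjective' π hπ
  let ρ := Ideal.Quotient.lift (Ideal.span (Set.range z)) L.restr hz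
  have hρπ : ρ.comp π = L.restr := Ideal.Quotient.lift_comp_mk _ _ _
  refine ⟨L.ring ⧸ Ideal.span (Set.range z), inferInstance, inferInstance, inferInstance,
    inferInstance, ρ, Fin p, Fin q ⊕ Fin s, inferInstance, inferInstance, π ∘ x,
    π ∘ Sum.elim y w, fun k => ⟨blk k, h2 k⟩, ?_, ?_, fun C => ?_⟩
  · refine Function.Surjective.of_comp (g := π) ?_
    rw [← RingHom.coe_comp, hρπ]
    exact L.restr_surjective
  · let E : Fin r ⊕ (Fin p ⊕ (Fin q ⊕ Fin s)) ≃ Fin p ⊕ (Fin q ⊕ (Fin r ⊕ Fin s)) :=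
      { toFun := Sum.elim (fun k => Sum.inr (Sum.inr (Sum.inl k))) (Sum.elim Sum.inl
          (Sum.elim (fun k => Sum.inr (Sum.inl k)) (fun k => Sum.inr (Sum.inr (Sum.inr k)))))
        invFun := Sum.elim (fun k => Sum.inr (Sum.inl k)) (Sum.elim
          (fun k => Sum.inr (Sum.inr (Sum.inl k)))
          (Sum.elim Sum.inl (fun k => Sum.inr (Sum.inr (Sum.inr k)))))
        left_inv := by rintro (k | (k | (k | k))) <;> rfl
        right_inv := by rintro (k | (k | (k | k))) <;> rfl }
    have h4 : IsRegularSystem (Sum.elim z (Sum.elim x (Sum.elim y w))) := by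
      convert! h1.comp_equiv E using 1
      funext k
      rcases k with k | (k | (k | k)) <;> rfl
    convert! h4.of_surjective hπ Ideal.mk_ker using 1
    funext k
    rcases k with k | k <;> rfl
  · have h4 := h3 C.1 C.2.1 C.2.2
    rw [← hρπ, ← Ideal.comap_comap] at h4
    rw [← Ideal.map_comap_of_surjective π hπ (Ideal.comap ρ _), h4, Ideal.map_span,
      Set.image_union, Ideal.span_union, ← Set.image_comp]
    have h5 : Ideal.span (π '' Set.range z) = ⊥ := by
      rw [← Ideal.map_span, Ideal.map_eq_bot_iff_le_ker, Ideal.mk_ker]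
    rw [h5, sup_bot_eq]
    congr 2
    ext k
    exact (Subtype.ext_iff (a1 := (⟨blk k, h2 k⟩ : Comps a)) (a2 := C)).symm

end Characterization

/-! ### The decomposition of a divisor along the components -/

section Components

variable {X : Scheme.{u}} {n : ℕ} {C : Fin (n + 1) → Set X} {D : X → ℚ}

lemma initUnion_union_last (hC : Set.range C = irreducibleComponents X) :
    initUnion C ∪ C (Fin.last n) = Set.univ := by
  refine Set.eq_univ_of_forall fun η => ?_
  obtain ⟨i, hi⟩ : irreducibleComponent η ∈ Set.range C :=
    hC ▸ irreducibleComponent_mem_irreducibleComponents η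
  have hη : η ∈ C i := hi ▸ mem_irreducibleComponent
  induction i using Fin.lastCases with
  | last => exact Or.inr hη
  | cast i => exact Or.inl (Set.mem_iUnion.2 ⟨i, hη⟩)

lemma initDivisor_apply (η : X) :
    initDivisor C D η = ∑ i : Fin n, part (C i.castSucc) D η := by
  simp [initDivisor]

lemma initDivisor_eq_zero {η : X} (h : D η = 0) : initDivisor C D η = 0 := by
  rw [initDivisor_apply]
  refine Finset.sum_eq_zero fun i _ => ?_
  simp [part, h]

lemma part_eq_zero {T : Set X} {η : X} (h : D η = 0) : part T D η = 0 := by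
  simp [part, h]

lemma initDivisor_add_part {η : X} {i : Fin (n + 1)} (hi : η ∈ C i)
    (hu : ∀ j, η ∈ C j → j = i) : initDivisor C D η + part (C (Fin.last n)) D η = D η := by
  rw [initDivisor_apply, ← Fin.sum_univ_castSucc (fun i => part (C i) D η),
    Finset.sum_eq_single i]
  · exact Set.indicator_of_mem hi D
  · exact fun j _ hj => Set.indicator_of_notMem (fun h => hj (hu j h)) D
  · simp

lemma initDivisor_add_of_mem {DT : X → ℚ} (hDT : IsWeilDivisorOn (C (Fin.last n)) DT) {η : X}
    {i : Fin n} (hi : η ∈ C i.castSucc) (hu : ∀ j, η ∈ C j → j = i.castSucc) :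
    initDivisor C D η + DT η = D η := by
  have hlast : η ∉ C (Fin.last n) := fun h => (Fin.castSucc_lt_last i).ne' (hu _ h)
  have h1 := initDivisor_add_part (D := D) hi hu
  rw [part, Set.indicator_of_notMem hlast, add_zero] at h1
  rw [h1, not_not.1 fun h => hlast (hDT.2 η h).1, add_zero]

lemma exists_mem_of_initDivisor_ne_zero {η : X} (h : initDivisor C D η ≠ 0) :
    D η ≠ 0 ∧ η ∈ initUnion C := by
  refine ⟨fun h0 => h (initDivisor_eq_zero h0), ?_⟩
  rw [initDivisor_apply] at h
  obtain ⟨i, -, hi⟩ := Finset.exists_ne_zero_of_sum_ne_zero h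
  exact Set.mem_iUnion.2 ⟨i, Set.mem_of_indicator_ne_zero hi⟩

lemma isWeilDivisorOn_initDivisor (hD : IsWeilDivisorOn Set.univ D) :
    IsWeilDivisorOn (initUnion C) (initDivisor C D) :=
  ⟨hD.1.subset fun _ hη => (exists_mem_of_initDivisor_ne_zero hη).1, fun η hη =>
    ⟨(exists_mem_of_initDivisor_ne_zero hη).2, fun C' hC' _ hη' =>
      (hD.2 η (exists_mem_of_initDivisor_ne_zero hη).1).2 C' hC' (Set.subset_univ _) hη'⟩⟩

lemma isWeilDivisorOn_part (hD : IsWeilDivisorOn Set.univ D) (T : Set X) :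
    IsWeilDivisorOn T (part T D) :=
  have h : ∀ η, part T D η ≠ 0 → D η ≠ 0 := fun _ hη h0 => hη (part_eq_zero h0)
  ⟨hD.1.subset h, fun η hη => ⟨Set.mem_of_indicator_ne_zero hη, fun C' hC' _ hη' =>
      (hD.2 η (h η hη)).2 C' hC' (Set.subset_univ _) hη'⟩⟩

end Components

/-! ### Sums of divisors and 4-tuples: the first equivalence -/

section Divisors

variable {K : Type u} [Field K] {X : Scheme.{u}} {f : X ⟶ Spec (.of K)} {a : X}
  {D E D₀ : X → ℚ}

lemma StableSncAt.congr (h : StableSncAt f D a) (hE : ∀ η, η ⤳ a → D η = E η) :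
    StableSncAt f E a := by
  obtain ⟨L, p, q, r, s, x, y, z, w, blk, α, h1, h2, h3, h4⟩ := h
  exact ⟨L, p, q, r, s, x, y, z, w, blk, α, h1, h2, h3, fun η h => (hE η h) ▸ h4 η h⟩

lemma mem_of_primeAt_eq {C : Comps a} {J : Ideal (X.presheaf.stalk a)} {η : X} {hη : η ⤳ a}
    (hp : primeAt hη = compIdeal C ⊔ J) : η ∈ C.1 :=
  (mem_iff_idealAt_le C.2.1 hη).2 (hp ▸ le_sup_left)

variable [CharZero K] [IsReduced X]

lemma StableSncAt.exists_primeAt (h : StableSncAt f D₀ a) {ι : Type*} [Fintype ι]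
    {y : ι → X.presheaf.stalk a} (hy : IndepMod (⨆ C : Comps a, compIdeal C) y) (C : Comps a)
    (j : ι) : ∃ (η : X) (hη : η ⤳ a), primeAt hη = compIdeal C ⊔ Ideal.span {y j} := by
  obtain ⟨R, _, _, _, _, ρ, p, s, _, _, x, w, b, hc⟩ := h.exists_isSncChart
  exact exists_primeAt_eq _ (hc.isPrime_sup_span hy C j)

/-- Another component through the branch would have its nonempty block among the coordinates of `C`
and the equation `y j`, although blocks are disjoint. -/
lemma StableSncAt.eq_of_mem (h : StableSncAt f D₀ a) {ι : Type*} [Fintype ι]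
    {y : ι → X.presheaf.stalk a} (hy : IndepMod (⨆ C : Comps a, compIdeal C) y) {C : Comps a}
    {j : ι} {η : X} {hη : η ⤳ a} (hp : primeAt hη = compIdeal C ⊔ Ideal.span {y j}) {C' : Set X}
    (hC' : C' ∈ irreducibleComponents X) (hηC' : η ∈ C') : C' = C.1 := by
  obtain ⟨R, _, _, _, _, ρ, p, s, _, _, x, w, b, hc⟩ := h.exists_isSncChart
  by_contra hne
  have ha : a ∈ C' := hη.mem_closed (isClosed_of_mem_irreducibleComponents C' hC') hηC'
  have h1 := hc.exists_block (i := ⟨C', hC', ha⟩) (i' := C)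
    fun hle => hne (eq_of_idealAt_le C.2.1 hC' C.2.2 hle).symm
  have h2 := hc.eq_of_le_sup_span hy (i := C) (i' := ⟨C', hC', ha⟩) h1 (j := j)
    (hp ▸ idealAt_le_primeAt hηC' hη)
  exact hne (congrArg Subtype.val h2)

/-- If `D + E` and `E` are stable-snc, without common components, then `D` is stable-snc. -/
theorem StableSncAt.of_add (hDE : StableSncAt f (D + E) a) (hE : StableSncAt f E a)
    (h0 : ∀ η, η ⤳ a → D η ≠ 0 → E η = 0) : StableSncAt f D a := by
  classical
  obtain ⟨ι, _, y, α, hα, hy⟩ := hDE.exists_isSncDivisor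
  obtain ⟨κ, _, y', α', hα', hy'⟩ := hE.exists_isSncDivisor
  have hle : ∀ C : Comps a, compIdeal C ≤ ⨆ C : Comps a, compIdeal C := le_iSup _
  -- A hypersurface belonging to `D` on one component belongs to `D` on all. Otherwise it is a
  -- hypersurface `y' k` of `E` on `C'`; then on `C` the branch of `y' k` belongs to `E`, and it is
  -- the branch of `y j`, which belongs to `D`.
  have key : ∀ (C C' : Comps a) (j : ι) (η η' : X) (h : η ⤳ a) (h' : η' ⤳ a),
      primeAt h = compIdeal C ⊔ Ideal.span {y j} → primeAt h' = compIdeal C' ⊔ Ideal.span {y j} →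
      D η ≠ 0 → D η' ≠ 0 := by
    intro C C' j η η' h h' hp hp' hη hη'
    have h1 : E η' ≠ 0 := by
      have := hy.eq C' j η' h' hp'
      rw [Pi.add_apply, hη', zero_add] at this
      rw [this]
      exact hα j
    obtain ⟨C'', k, hk⟩ := hy'.exists_eq η' h' h1
    obtain rfl : C' = C'' := Subtype.ext
      (hDE.eq_of_mem hy'.indep hk C'.2.1 (mem_of_primeAt_eq hp'))
    have h2 : AssocMod _ (y j) (y' k) :=
      hy.indep.assocMod_of_sup_span_eq (hle C') (hle C') (hp'.symm.trans hk)
    obtain ⟨ζ, hζ, hζp⟩ := hDE.exists_primeAt hy'.indep C k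
    have h3 : E ζ ≠ 0 := by rw [hy'.eq C k ζ hζ hζp]; exact hα' k
    have h4 : D ζ = 0 := by
      by_contra h4
      exact h3 (h0 ζ hζ h4)
    obtain ⟨C₁, l, hl⟩ := hy.exists_eq ζ hζ (by rwa [Pi.add_apply, h4, zero_add])
    have h5 : AssocMod _ (y l) (y' k) :=
      hy.indep.assocMod_of_sup_span_eq (hle C₁) (hle C) (hl.symm.trans hζp)
    obtain rfl := hy.indep.eq_of_assocMod (h2.trans h5.symm)
    obtain rfl : C = C₁ := Subtype.ext
      (hDE.eq_of_mem hy.indep hl C.2.1 (mem_of_primeAt_eq hζp))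
    obtain rfl := eq_of_primeAt_eq _ _ (hp.trans hl.symm)
    exact hη h4
  refine IsSncDivisor.stableSncAt (ι := {j : ι // ∃ (C : Comps a) (η : X) (h : η ⤳ a),
      primeAt h = compIdeal C ⊔ Ideal.span {y j} ∧ D η ≠ 0})
    (y := fun j => y j) (α := fun j => α j) hDE.zero ⟨hy.indep.comp Subtype.val_injective, ?_, ?_⟩
  · rintro C ⟨j, C', η', h', hp', hη'⟩ η h hp
    have h1 := key C' C j η' η h' h hp' hp hη'
    have h2 := hy.eq C j η h hp
    rwa [Pi.add_apply, h0 η h h1, add_zero] at h2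
  · intro η h hη
    obtain ⟨C, j, hp⟩ := hy.exists_eq η h (by rwa [Pi.add_apply, h0 η h hη, add_zero])
    exact ⟨C, ⟨j, C, η, h, hp, hη⟩, hp⟩

variable {n : ℕ} {C : Fin (n + 1) → Set X}

/-- The part of `D` on the last component serves as the complementary divisor. A branch lies on
exactly one component, so the sum of the parts counts it once. -/
theorem StableSncAt.fourTuple (hCinj : Function.Injective C)
    (hC : Set.range C = irreducibleComponents X) (hD : IsWeilDivisorOn Set.univ D)
    (hDE : StableSncAt f (D + E) a) (h0 : ∀ η, η ⤳ a → D η ≠ 0 → E η = 0) :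
    FourTupleStableSncAt f (initUnion C) (initDivisor C D) E (C (Fin.last n)) a := by
  refine ⟨initUnion_union_last hC, isWeilDivisorOn_initDivisor hD, part (C (Fin.last n)) D,
    isWeilDivisorOn_part hD _, StableSncAt.congr hDE fun η h => ?_⟩
  rw [Pi.add_apply, Pi.add_apply, Pi.add_apply]
  congr 1
  by_cases hη : D η = 0
  · rw [hη, initDivisor_eq_zero hη, part_eq_zero hη, add_zero]
  obtain ⟨ι, _, y, α, -, hy⟩ := hDE.exists_isSncDivisor
  obtain ⟨C', j, hp⟩ := hy.exists_eq η h (by rwa [Pi.add_apply, h0 η h hη, add_zero])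
  obtain ⟨i, hi⟩ : C'.1 ∈ Set.range C := by rw [hC]; exact C'.2.1
  refine (initDivisor_add_part (i := i) (by rw [hi]; exact mem_of_primeAt_eq hp)
    fun k hk => hCinj ?_).symm
  rw [hi]
  exact hDE.eq_of_mem hy.indep hp (by rw [← hC]; exact ⟨k, rfl⟩) hk

/-- Comparison on one component other than the last sends the equations of `D` and `E` to distinct
equations of the 4-tuple, up to units modulo `S`. Independence transfers along this injection, while
the coefficients on every component come from `D` and `E` themselves. -/
theorem StableSncAt.add_of_fourTuple (hCinj : Function.Injective C)
    (hC : Set.range C = irreducibleComponents X) (ha : a ∈ initUnion C)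
    (hD : StableSncAt f D a) (hE : StableSncAt f E a) (h0 : ∀ η, η ⤳ a → D η ≠ 0 → E η = 0)
    (h4 : FourTupleStableSncAt f (initUnion C) (initDivisor C D) E (C (Fin.last n)) a) :
    StableSncAt f (D + E) a := by
  obtain ⟨-, -, DT, hDT, hF⟩ := h4
  obtain ⟨i₁, ha₁⟩ := Set.mem_iUnion.1 ha
  obtain ⟨ι, _, y, α, hα, hy⟩ := hD.exists_isSncDivisor
  obtain ⟨κ, _, y', α', hα', hy'⟩ := hE.exists_isSncDivisor
  obtain ⟨γ, _, g, β, hβ, hg⟩ := StableSncAt.exists_isSncDivisor hF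
  have hle : ∀ C : Comps a, compIdeal C ≤ ⨆ C : Comps a, compIdeal C := le_iSup _
  let C₁ : Comps a := ⟨C i₁.castSucc, hC ▸ ⟨_, rfl⟩, ha₁⟩
  -- On the component `C₁`, the divisor of the 4-tuple is `D + E`.
  have hF₁ : ∀ η (_ : η ⤳ a), (∀ C' ∈ irreducibleComponents X, η ∈ C' → C' = C₁.1) → η ∈ C₁.1 →
      (initDivisor C D + DT + E) η = (D + E) η := by
    intro η h hu hη
    rw [Pi.add_apply, Pi.add_apply, initDivisor_add_of_mem hDT hη
      fun j hj => hCinj (hu _ (hC ▸ ⟨j, rfl⟩) hj), Pi.add_apply]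
  have hτ : ∀ j, ∃ k, compIdeal C₁ ⊔ Ideal.span {g k} = compIdeal C₁ ⊔ Ideal.span {y j} := by
    intro j
    obtain ⟨η, h, hp⟩ := hD.exists_primeAt hy.indep C₁ j
    have h1 : D η ≠ 0 := by rw [hy.eq C₁ j η h hp]; exact hα j
    have h2 := hF₁ η h (fun C' hC' => hD.eq_of_mem hy.indep hp hC') (mem_of_primeAt_eq hp)
    obtain ⟨C', k, hk⟩ := hg.exists_eq η h (by rwa [h2, Pi.add_apply, h0 η h h1, add_zero])
    obtain rfl : C₁ = C' := Subtype.ext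
      (hD.eq_of_mem hg.indep hk C₁.2.1 (mem_of_primeAt_eq hp))
    exact ⟨k, hk.symm.trans hp⟩
  have hτ' : ∀ j, ∃ k, compIdeal C₁ ⊔ Ideal.span {g k} = compIdeal C₁ ⊔ Ideal.span {y' j} := by
    intro j
    obtain ⟨η, h, hp⟩ := hE.exists_primeAt hy'.indep C₁ j
    have h1 : E η ≠ 0 := by rw [hy'.eq C₁ j η h hp]; exact hα' j
    have h1' : D η = 0 := by
      by_contra h3
      exact h1 (h0 η h h3)
    have h2 := hF₁ η h (fun C' hC' => hE.eq_of_mem hy'.indep hp hC') (mem_of_primeAt_eq hp)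
    obtain ⟨C', k, hk⟩ := hg.exists_eq η h (by rwa [h2, Pi.add_apply, h1', zero_add])
    obtain rfl : C₁ = C' := Subtype.ext
      (hD.eq_of_mem hg.indep hk C₁.2.1 (mem_of_primeAt_eq hp))
    exact ⟨k, hk.symm.trans hp⟩
  choose τ hτ using hτ
  choose τ' hτ' using hτ'
  have hτa := fun j => hg.indep.assocMod_of_sup_span_eq (hle C₁) (hle C₁) (hτ j)
  have hτa' := fun j => hg.indep.assocMod_of_sup_span_eq (hle C₁) (hle C₁) (hτ' j)
  have hinj : Function.Injective (Sum.elim τ τ') := by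
    have hne : ∀ j k, τ j ≠ τ' k := fun j k hjk => by
      obtain ⟨η, h, hp⟩ := hD.exists_primeAt hy.indep C₁ j
      have h1 : D η ≠ 0 := by rw [hy.eq C₁ j η h hp]; exact hα j
      rw [← hτ, hjk, hτ'] at hp
      have h2 : E η ≠ 0 := by rw [hy'.eq C₁ k η h hp]; exact hα' k
      exact h2 (h0 η h h1)
    rintro (j | j) (k | k) hjk <;> simp only [Sum.elim_inl, Sum.elim_inr] at hjk
    · have := hτa k
      rw [← hjk] at this
      rw [hy.indep.eq_of_assocMod ((hτa j).symm.trans this)]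
    · exact absurd hjk (hne j k)
    · exact absurd hjk.symm (hne k j)
    · have := hτa' k
      rw [← hjk] at this
      rw [hy'.indep.eq_of_assocMod ((hτa' j).symm.trans this)]
  obtain ⟨R, _, _, _, _, ρ, p, s, _, _, x, w, b, hc⟩ := hD.exists_isSncChart
  refine IsSncDivisor.stableSncAt (y := Sum.elim y y') (α := Sum.elim α α') hD.zero
    ⟨hg.indep.congr_of_assocMod hc.iSup_le_maximalIdeal hinj (Sum.rec hτa hτa'), ?_, ?_⟩
  · rintro C' (j | j) η h hp
    · have h1 := hy.eq C' j η h hp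
      rw [Pi.add_apply, h0 η h (by rw [h1]; exact hα j), add_zero, h1]
      rfl
    · have h1 := hy'.eq C' j η h hp
      have h2 : D η = 0 := by
        by_contra h2
        exact hα' j (h1 ▸ h0 η h h2)
      rw [Pi.add_apply, h2, zero_add, h1]
      rfl
  · intro η h hη
    by_cases h1 : D η = 0
    · rw [Pi.add_apply, h1, zero_add] at hη
      obtain ⟨C', j, hp⟩ := hy'.exists_eq η h hη
      exact ⟨C', Sum.inr j, hp⟩
    · obtain ⟨C', j, hp⟩ := hy.exists_eq η h h1
      exact ⟨C', Sum.inl j, hp⟩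

end Divisors

/-! ### The Hilbert-Samuel function in a chart -/

section HilbertSamuel

variable {R O : Type*} [CommRing R] [CommRing O] [IsLocalRing R] [IsLocalRing O]
  [IsNoetherianRing R] [Algebra ℚ R] {p J : Type*} [Fintype p] {ρ : R →+* O} {x : p → R}
  {b : p → J} {I : J → Ideal O}

lemma IsSncChart.hilbertSamuel_iInf (K : Type u) [Field K] [CharZero K]
    {ι s' : Type*} [Fintype ι] [Fintype s'] {v : ι → R} {w' : s' → R}
    (h : IsSncChart ρ x (Sum.elim v w') b I) {N : ℕ} (φ : Fin N ≃ J) (c : Fin N → ℕ)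
    (hc : ∀ j, Nat.card {k // b k = φ j} = c j) (e : ℕ)
    (he : Fintype.card p + (Fintype.card ι + Fintype.card s') = e) :
    hilbertSamuel (⨅ i, (I i ⊔ Ideal.span {∏ l, ρ (v l)})) =
      hilbertSamuel (modelIdeal K e c (Fintype.card ι)) := by
  classical
  set B := (Finset.univ : Finset ι).map (Function.Embedding.inl (β := s')) with hB
  have hBcard : B.card = Fintype.card ι := by rw [hB, Finset.card_map, Finset.card_univ]
  have hprod : ∏ l ∈ B, Sum.elim v w' l = ∏ l, v l := by rw [hB, Finset.prod_map]; rfl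
  have h1 := hilbertSamuel_eq_modelIdeal K h.isRegularSystem (φ.symm ∘ b) c (fun j => by
    rw [← hc]
    simp [Equiv.symm_apply_eq]) e (by rw [Fintype.card_sum]; exact he) B
  rw [← hBcard, ← h1, ← hilbertSamuel_comap h.surj, Ideal.comap_iInf, ← φ.iInf_comp]
  congr 1
  refine iInf_congr fun i => ?_
  rw [← map_prod, ← Set.image_singleton, comap_sup_span h.surj, h.comap_eq, hprod]
  simp [Equiv.symm_apply_eq]

end HilbertSamuel

/-! ### Branches, relevant components and the obstruction ideal -/

section Branches

variable {X : Scheme.{u}} {a : X} {D : X → ℚ}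

lemma iInf_primeAt_eq {S : Set X} {ι : Type*} {P : ι → Ideal (X.presheaf.stalk a)}
    (hP : ∀ j, (P j).IsPrime) (hS : ∀ η (h : η ⤳ a), η ∈ S ↔ ∃ j, primeAt h = P j) :
    idealAt S a = ⨅ j, P j := by
  refine le_antisymm (le_iInf fun j => ?_) ?_
  · obtain ⟨η, h, hj⟩ := exists_primeAt_eq (P j) (hP j)
    rw [← hj]
    exact idealAt_le_primeAt ((hS η h).2 ⟨j, hj⟩) h
  · refine le_iInf fun η => le_iInf fun hη => le_iInf fun h => ?_
    obtain ⟨j, hj⟩ := (hS η h).1 hη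
    exact (iInf_le _ j).trans_eq hj.symm

lemma idealAt_supp_eq (D : X → ℚ) : idealAt (supp D) a = idealAt {η | D η ≠ 0} a :=
  idealAt_supp D

lemma part_ne_zero_iff {T : Set X} {η : X} : part T D η ≠ 0 ↔ D η ≠ 0 ∧ η ∈ T := by
  rw [part, Set.indicator_apply_ne_zero, and_comm]
  rfl

lemma ncard_branches {S : Set X} {ι : Type*} [Fintype ι] {P : ι → Ideal (X.presheaf.stalk a)}
    (hP : ∀ j, (P j).IsPrime) (hPinj : Function.Injective P)
    (hS : ∀ η (h : η ⤳ a), η ∈ S ↔ ∃ j, primeAt h = P j) :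
    {η | η ⤳ a ∧ η ∈ S}.ncard = Fintype.card ι := by
  choose η h hη using fun j => exists_primeAt_eq (P j) (hP j)
  have h1 : {η | η ⤳ a ∧ η ∈ S} = Set.range η := by
    ext ζ
    constructor
    · rintro ⟨hζ, hζS⟩
      obtain ⟨j, hj⟩ := (hS ζ hζ).1 hζS
      exact ⟨j, eq_of_primeAt_eq (h j) hζ ((hη j).trans hj.symm)⟩
    · rintro ⟨j, rfl⟩
      exact ⟨h j, (hS _ (h j)).2 ⟨j, hη j⟩⟩
  have h2 : Function.Injective η := fun j k hjk => hPinj (by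
    rw [← hη, ← hη]
    congr 1)
  rw [h1, ← Set.image_univ, Set.ncard_image_of_injective _ h2, Set.ncard_univ,
    Nat.card_eq_fintype_card]

variable {n : ℕ} {C : Fin (n + 1) → Set X}

lemma obstructionIdeal_eq_top_iff : obstructionIdeal C D a = ⊤ ↔ ∀ i j,
    idealAt (supp (part (C j) D)) a ⊔ idealAt (C i) a ≤
      idealAt (supp (part (C i) D)) a ⊔ idealAt (C j) a := by
  simp only [obstructionIdeal, iInf_eq_top]
  refine forall_congr' fun i => forall_congr' fun j => ?_
  rw [Submodule.colon_eq_top_iff_subset]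
  rfl

/-- The components through `a` are the irreducible components indexed by the `i` with `a ∈ C i`. -/
noncomputable def compEquiv (hCinj : Function.Injective C)
    (hC : Set.range C = irreducibleComponents X) (a : X) : {i | a ∈ C i} ≃ Comps a :=
  Equiv.ofBijective (fun i => ⟨C i, hC ▸ ⟨i.1, rfl⟩, i.2⟩)
    ⟨fun i j hij => Subtype.ext (hCinj (congrArg Subtype.val hij)), fun C' => by
      obtain ⟨i, hi⟩ : C'.1 ∈ Set.range C := by rw [hC]; exact C'.2.1
      exact ⟨⟨i, by rw [Set.mem_ofPred_eq, hi]; exact C'.2.2⟩, Subtype.ext hi⟩⟩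

lemma isClosed_comp (hC : Set.range C = irreducibleComponents X) (i : Fin (n + 1)) :
    IsClosed (C i) := isClosed_of_mem_irreducibleComponents _ (hC ▸ ⟨i, rfl⟩)

lemma relevant_subset (hC : Set.range C = irreducibleComponents X) (ha : a ∈ C (Fin.last n)) :
    relevant C D a ⊆ {i | a ∈ C i} := by
  rintro i (rfl | ⟨η, h, -, hη⟩)
  exacts [ha, h.mem_closed (isClosed_comp hC i) hη]

lemma idealAt_iUnion_eq_iInf (hCinj : Function.Injective C)
    (hC : Set.range C = irreducibleComponents X) :
    idealAt (⋃ i ∈ {i | a ∈ C i}, C i) a = ⨅ C' : Comps a, compIdeal C' := by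
  rw [Set.biUnion_eq_iUnion, idealAt_iUnion, ← (compEquiv hCinj hC a).iInf_comp]
  rfl

lemma idealAt_supp_part_of_notMem (hC : Set.range C = irreducibleComponents X) {i : Fin (n + 1)}
    (ha : a ∉ C i) : idealAt (supp (part (C i) D)) a = ⊤ := by
  rw [idealAt_supp]
  simp only [iInf_eq_top]
  exact fun η hη h => absurd (h.mem_closed (isClosed_comp hC i) (part_ne_zero_iff.1 hη).2) ha

end Branches

/-! ### Necessity in the second equivalence -/

section SncDivisor

variable {K : Type u} [Field K] [CharZero K] {X : Scheme.{u}} [IsReduced X]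
  {f : X ⟶ Spec (.of K)} {a : X} {D : X → ℚ} {n : ℕ} {C : Fin (n + 1) → Set X}
  {ι : Type*} [Fintype ι] {y : ι → X.presheaf.stalk a} {α : ι → ℚ}

lemma IsSncDivisor.branch_iff (h : StableSncAt f 0 a) (hα : ∀ j, α j ≠ 0)
    (hD : IsSncDivisor D a y α) (C' : Comps a) (η : X) (hη : η ⤳ a) :
    (D η ≠ 0 ∧ η ∈ C'.1) ↔ ∃ j, primeAt hη = compIdeal C' ⊔ Ideal.span {y j} := by
  constructor
  · rintro ⟨h1, h2⟩
    obtain ⟨C'', j, hp⟩ := hD.exists_eq η hη h1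
    obtain rfl : C' = C'' := Subtype.ext (h.eq_of_mem hD.indep hp C'.2.1 h2)
    exact ⟨j, hp⟩
  · rintro ⟨j, hp⟩
    exact ⟨by rw [hD.eq C' j η hη hp]; exact hα j, mem_of_primeAt_eq hp⟩

/-- The same product of equations cuts out the divisor on all components through `a`, so both sides
of each quotient coincide. A component that misses `a` contributes unit ideals. -/
theorem IsSncDivisor.obstructionIdeal_eq_top (hC : Set.range C = irreducibleComponents X)
    (h : StableSncAt f 0 a) (hα : ∀ j, α j ≠ 0) (hD : IsSncDivisor D a y α) :
    obstructionIdeal C D a = ⊤ := by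
  obtain ⟨R, _, _, _, _, ρ, p, s, _, _, x, w, b, hc⟩ := h.exists_isSncChart
  have key : ∀ i, a ∈ C i →
      idealAt (supp (part (C i) D)) a = idealAt (C i) a ⊔ Ideal.span {∏ j, y j} := by
    intro i hi
    let C' : Comps a := ⟨C i, hC ▸ ⟨i, rfl⟩, hi⟩
    rw [idealAt_supp_eq, iInf_primeAt_eq (P := fun j => compIdeal C' ⊔ Ideal.span {y j})
      (hc.isPrime_sup_span hD.indep C'), hc.iInf_sup_span hD.indep]
    intro η hη
    rw [← hD.branch_iff h hα C' η hη, Set.mem_ofPred_eq, part_ne_zero_iff]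
  rw [obstructionIdeal_eq_top_iff]
  intro i j
  by_cases hj : a ∈ C j
  · by_cases hi : a ∈ C i
    · rw [key i hi, key j hj]
      exact le_of_eq (by ac_rfl)
    · rw [idealAt_supp_part_of_notMem hC hi, top_sup_eq]
      exact le_top
  · rw [idealAt_eq_top (isClosed_comp hC j) hj, sup_top_eq]
    exact le_top

theorem IsSncDivisor.exists_memStratum (hCinj : Function.Injective C)
    (hC : Set.range C = irreducibleComponents X) (ha : a ∈ C (Fin.last n)) {i₀ : Fin (n + 1)}
    (hi₀ : i₀ ≠ Fin.last n) (hai₀ : a ∈ C i₀) (h : StableSncAt f 0 a) (hα : ∀ j, α j ≠ 0)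
    (hD : IsSncDivisor D a y α) [Nonempty ι] :
    ∃ (e N : ℕ) (c : Fin N → ℕ) (q : ℕ), ∑ i, c i + q ≤ e ∧ MemStratum C D e c q a ∧
      hilbertSamuel (idealAt (supp D) a) = hilbertSamuel (modelIdeal K e c q) := by
  classical
  obtain ⟨R, _, _, _, _, ρ, p, s, _, _, x, w, b, hc₀⟩ := h.exists_isSncChart
  obtain ⟨s', v, w', rfl, hc⟩ := hc₀.exists_chart hD.indep
  have hrel : relevant C D a = {i | a ∈ C i} := by
    refine (relevant_subset hC ha).antisymm fun i hi => Or.inr ?_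
    let C' : Comps a := ⟨C i, hC ▸ ⟨i, rfl⟩, hi⟩
    obtain ⟨η, hη, hp⟩ := h.exists_primeAt hD.indep C' (Classical.arbitrary ι)
    have h1 := (hD.branch_iff h hα C' η hη).2 ⟨_, hp⟩
    exact ⟨η, hη, h1.1, h1.2⟩
  let E : relevant C D a ≃ Comps a := (Equiv.setCongr hrel).trans (compEquiv hCinj hC a)
  obtain ⟨N, ⟨e₀⟩⟩ := Finite.exists_equiv_fin (relevant C D a)
  let c₀ : Fin N → ℕ := fun j => Nat.card {k // b k = E (e₀.symm j)}
  let τ := Tuple.sort (OrderDual.toDual ∘ c₀)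
  let φ : Fin N ≃ relevant C D a := τ.trans e₀.symm
  let e := Fintype.card p + (Fintype.card ι + Fintype.card (Fin s'))
  have hcard : ∑ j, (c₀ ∘ τ) j = Fintype.card p := by
    rw [← Nat.card_eq_fintype_card,
      Nat.card_congr (Equiv.sigmaFiberEquiv ((φ.trans E).symm ∘ b)).symm, Nat.card_sigma]
    refine Finset.sum_congr rfl fun j _ => ?_
    refine Nat.card_congr (Equiv.subtypeEquivRight fun k => ?_)
    rw [Function.comp_apply, Equiv.symm_apply_eq]
    rfl
  have hbr := fun C' : Comps a => hD.branch_iff h hα C'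
  refine ⟨e, N, c₀ ∘ τ, Fintype.card ι, by rw [hcard]; simp only [e]; omega,
    ⟨ha, ?_, ⟨φ, fun j => ?_⟩, ?_, ?_⟩, ?_⟩
  · have := Tuple.monotone_sort (OrderDual.toDual ∘ c₀)
    exact fun i j hij => this hij
  · have := hc.ringKrullDim_quotient (E (φ j))
    rw [Fintype.card_sum] at this
    exact this
  · rw [hrel, idealAt_iUnion_eq_iInf hCinj hC]
    have := hc.embDim_iInf (i := compEquiv hCinj hC a ⟨i₀, hai₀⟩)
      (j := compEquiv hCinj hC a ⟨Fin.last n, ha⟩) (fun h1 => hi₀ (by simpa using h1))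
    rw [this, Fintype.card_sum]
  · have h1 : ∀ i ∈ relevant C D a,
        {η : X | η ⤳ a ∧ D η ≠ 0 ∧ η ∈ C i}.ncard = Fintype.card ι := by
      intro i hi
      rw [hrel] at hi
      let C' : Comps a := ⟨C i, hC ▸ ⟨i, rfl⟩, hi⟩
      exact ncard_branches (S := {η | D η ≠ 0 ∧ η ∈ C i}) (hc.isPrime_sup_span hD.indep C')
        (fun _ _ h1 => hD.indep.eq_of_sup_span_eq (le_iSup _ C') (le_iSup _ C') h1) (hbr C')
    refine ⟨⟨Fin.last n, Or.inl rfl, h1 _ (Or.inl rfl)⟩, ?_⟩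
    rintro _ ⟨i, hi, rfl⟩
    exact (h1 i hi).ge
  · have h1 : idealAt (supp D) a =
        ⨅ C' : Comps a, (compIdeal C' ⊔ Ideal.span {∏ l, ρ (v l)}) := by
      have h2 : ∀ C' : Comps a, compIdeal C' ⊔ Ideal.span {∏ l, ρ (v l)} =
          ⨅ j, (compIdeal C' ⊔ Ideal.span {(ρ ∘ v) j}) := fun C' =>
        (hc.iInf_sup_span hD.indep C').symm
      simp_rw [h2]
      rw [idealAt_supp_eq]
      refine Eq.trans ?_ (iInf_prod
        (f := fun z : Comps a × ι => compIdeal z.1 ⊔ Ideal.span {(ρ ∘ v) z.2}))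
      refine iInf_primeAt_eq (fun z => hc.isPrime_sup_span hD.indep z.1 z.2) fun η hη => ?_
      rw [Prod.exists]
      refine ⟨fun h3 => hD.exists_eq η hη h3, fun ⟨C', j, h3⟩ => ?_⟩
      exact ((hbr C' η hη).2 ⟨j, h3⟩).1
    rw [h1]
    exact hc.hilbertSamuel_iInf K (φ.trans E) (c₀ ∘ τ) (fun j => rfl) e rfl

end SncDivisor

lemma natCast_eq_of_add_eq {d : WithBot ℕ∞} {k l m : ℕ} (hk : d + (k : ℕ) = (m : ℕ))
    (hl : d + (l : ℕ) = (m : ℕ)) : k = l := by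
  induction d using WithBot.recBotCoe with
  | bot => simp at hk
  | coe d =>
    induction d using ENat.recTopCoe with
    | top =>
      have : (⊤ : ℕ∞) + (k : ℕ) = (m : ℕ) := by exact_mod_cast hk
      simp at this
    | coe d =>
      have h1 : d + k = m := by exact_mod_cast hk
      have h2 : d + l = m := by exact_mod_cast hl
      omega

/-! ### The divisor on one component: principal branches -/

section LastComponent

variable {X : Scheme.{u}} {a : X} {D : X → ℚ}

/-- The branches of a divisor on one component of a chart are principal. -/
lemma exists_branches {R p s : Type*} [CommRing R] [IsLocalRing R] [IsNoetherianRing R]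
    [Algebra ℚ R] [Fintype p] [Fintype s] {ρ : R →+* X.presheaf.stalk a} {x : p → R} {w : s → R}
    {b : p → Comps a} (hc : IsSncChart ρ x w b compIdeal) (hD : IsWeilDivisorOn Set.univ D)
    (M : Comps a) :
    ∃ g : {η : X | η ⤳ a ∧ D η ≠ 0 ∧ η ∈ M.1} → X.presheaf.stalk a,
      ∀ j, primeAt j.2.1 = compIdeal M ⊔ Ideal.span {g j} := by
  choose g hg using fun j : {η : X | η ⤳ a ∧ D η ≠ 0 ∧ η ∈ M.1} =>
    have h1 := ne_and_eq_of_le M.2.1 j.2.1 j.2.2.2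
      ((hD.2 j.1 j.2.2.1).2 M.1 M.2.1 (Set.subset_univ _) j.2.2.2)
    hc.exists_eq_sup_span M (P := primeAt j.2.1) inferInstance (idealAt_le_primeAt j.2.2.2 j.2.1)
      h1.1 h1.2
  exact ⟨g, hg⟩

/-- Codimension one excludes inclusions between distinct branches, so the intersection of their
principal primes modulo the component is generated by the product. -/
lemma idealAt_supp_part_eq (hD : IsWeilDivisorOn Set.univ D) (M : Comps a)
    [Fintype {η : X | η ⤳ a ∧ D η ≠ 0 ∧ η ∈ M.1}]
    {g : {η : X | η ⤳ a ∧ D η ≠ 0 ∧ η ∈ M.1} → X.presheaf.stalk a}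
    (hg : ∀ j, primeAt j.2.1 = compIdeal M ⊔ Ideal.span {g j}) :
    idealAt (supp (part M.1 D)) a = compIdeal M ⊔ Ideal.span {∏ j, g j} := by
  have hprime : ∀ j, (compIdeal M ⊔ Ideal.span {g j}).IsPrime := fun j => by
    rw [← hg]; infer_instance
  rw [idealAt_supp_eq, iInf_primeAt_eq hprime]
  · refine le_antisymm (fun z hz => ?_) (le_iInf fun j => sup_le_sup_left
      (Ideal.span_singleton_le_span_singleton.2 (Finset.dvd_prod_of_mem g (Finset.mem_univ j))) _)
    refine mem_sup_span_prod _ _ hprime (fun j k hjk hk => hjk ?_)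
      fun j _ => (Submodule.mem_iInf _).1 hz j
    have h1 : ∀ j : {η : X | η ⤳ a ∧ D η ≠ 0 ∧ η ∈ M.1}, _ := fun j =>
      ne_and_eq_of_le M.2.1 j.2.1 j.2.2.2
        ((hD.2 j.1 j.2.2.1).2 M.1 M.2.1 (Set.subset_univ _) j.2.2.2)
    have h2 : primeAt k.2.1 ≤ primeAt j.2.1 := by
      rw [hg k, hg j]
      exact sup_le le_sup_left ((Ideal.span_singleton_le_iff_mem _).2 hk)
    exact (Subtype.ext (eq_of_primeAt_eq _ _ ((h1 j).2 _ inferInstance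
      (idealAt_le_primeAt k.2.2.2 k.2.1) (h1 k).1 h2))).symm
  · intro η hη
    rw [Set.mem_ofPred_eq, part_ne_zero_iff]
    refine ⟨fun h => ⟨⟨η, hη, h⟩, hg ⟨η, hη, h⟩⟩, ?_⟩
    rintro ⟨j, hj⟩
    obtain rfl := eq_of_primeAt_eq _ _ (hj.trans (hg j).symm)
    exact j.2.2

end LastComponent

/-! ### Sufficiency in the second equivalence -/

section Converse

variable {K : Type u} [Field K] [CharZero K] {X : Scheme.{u}} [IsReduced X]
  {f : X ⟶ Spec (.of K)} {a : X} {D : X → ℚ} {n : ℕ} {C : Fin (n + 1) → Set X}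

/-- On the components other than the last, the divisor of a `4`-tuple is `D`. -/
lemma branch_iff_of_ne_last (hCinj : Function.Injective C)
    (hC : Set.range C = irreducibleComponents X) (hsing : ∀ η, D η ≠ 0 → η ∉ singLocus X)
    {DT : X → ℚ} (hDT : IsWeilDivisorOn (C (Fin.last n)) DT) {ι : Type*} [Fintype ι]
    {y : ι → X.presheaf.stalk a} {α : ι → ℚ} (h : StableSncAt f 0 a) (hα : ∀ j, α j ≠ 0)
    (hF : IsSncDivisor (initDivisor C D + DT) a y α) (C' : Comps a) (hC' : C'.1 ≠ C (Fin.last n))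
    (η : X) (hη : η ⤳ a) :
    (D η ≠ 0 ∧ η ∈ C'.1) ↔ ∃ j, primeAt hη = compIdeal C' ⊔ Ideal.span {y j} := by
  obtain ⟨i, hi⟩ : C'.1 ∈ Set.range C := by rw [hC]; exact C'.2.1
  induction i using Fin.lastCases with
  | last => exact absurd hi.symm hC'
  | cast i =>
  have hmem : ∀ j, C j ∈ irreducibleComponents X := fun j => hC ▸ ⟨j, rfl⟩
  rw [← hF.branch_iff h hα C' η hη]
  refine and_congr_left fun h2 => ?_
  rw [Pi.add_apply]
  constructor
  · intro h1
    -- Since `D` avoids the singular locus, `η` is on no other component: it is counted once among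
    -- the parts, and `DT` has no share in it.
    rwa [initDivisor_add_of_mem hDT (hi ▸ h2) fun j hj => hCinj
      (eq_of_mem_of_isRegularLocalRing f (hsing η h1) (hmem j) (hmem _) hj (hi ▸ h2))]
  · intro h1
    obtain ⟨C'', j, hp⟩ := hF.exists_eq η hη h1
    rwa [initDivisor_add_of_mem hDT (hi ▸ h2) fun j hj => hCinj
      ((h.eq_of_mem hF.indep hp (hmem j) hj).trans
        (h.eq_of_mem hF.indep hp (hmem _) (hi ▸ h2)).symm)] at h1

/-- The 4-tuple controls all components but the last, factoriality gives equations on the last, the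
obstruction ideal compares their traces, and the Hilbert-Samuel function compares their numbers; the
matching then provides common equations. -/
theorem stableSncAt_of_fourTuple (hCinj : Function.Injective C)
    (hC : Set.range C = irreducibleComponents X) (hD : IsWeilDivisorOn Set.univ D)
    (ha : a ∈ C (Fin.last n)) (hred : ∀ η, D η ≠ 0 → D η = 1)
    (hsing : ∀ η, D η ≠ 0 → η ∉ singLocus X)
    (hi₀ : ∃ i : Fin n, ∃ η : X, η ⤳ a ∧ D η ≠ 0 ∧ η ∈ C i.castSucc)
    (h4 : FourTupleStableSncAt f (initUnion C) (initDivisor C D) 0 (C (Fin.last n)) a)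
    {e N : ℕ} {c : Fin N → ℕ} {q : ℕ} (hS : MemStratum C D e c q a)
    (hHS : hilbertSamuel (idealAt (supp D) a) = hilbertSamuel (modelIdeal K e c q))
    (hJ : obstructionIdeal C D a = ⊤) : StableSncAt f D a := by
  classical
  obtain ⟨-, -, DT, hDT, hF⟩ := h4
  have hmem : ∀ j, C j ∈ irreducibleComponents X := fun j => hC ▸ ⟨j, rfl⟩
  rw [TripleStableSncAt, add_zero] at hF
  have h := hF.zero
  obtain ⟨ι, _, y, α, hα, hy⟩ := hF.exists_isSncDivisor
  obtain ⟨R, _, _, _, _, ρ, p, s, _, _, x, w, b, hc₀⟩ := h.exists_isSncChart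
  obtain ⟨s', v, w', rfl, hc⟩ := hc₀.exists_chart hy.indep
  have hbr := branch_iff_of_ne_last hCinj hC hsing hDT h hα hy
  let M : Comps a := ⟨C (Fin.last n), hmem _, ha⟩
  obtain ⟨i₀, η₀, hη₀, hD₀, hη₀C⟩ := hi₀
  let M₀ : Comps a := ⟨C i₀.castSucc, hmem _,
    hη₀.mem_closed (isClosed_comp hC _) hη₀C⟩
  have hM₀ : M₀ ≠ M := fun h1 =>
    (Fin.castSucc_lt_last i₀).ne (hCinj (congrArg Subtype.val h1))
  have hne : ∀ {C' : Comps a}, C' ≠ M → C'.1 ≠ C (Fin.last n) := fun h1 h2 =>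
    h1 (Subtype.ext h2)
  obtain ⟨j₀, -⟩ := (hbr M₀ (hne hM₀) η₀ hη₀).1 ⟨hD₀, hη₀C⟩
  have : Finite {η : X | η ⤳ a ∧ D η ≠ 0 ∧ η ∈ M.1} :=
    (hD.1.subset fun η hη => hη.2.1).to_subtype
  have := Fintype.ofFinite {η : X | η ⤳ a ∧ D η ≠ 0 ∧ η ∈ M.1}
  obtain ⟨g, hg⟩ := exists_branches hc hD M
  have hgm : ∀ j, g j ∈ maximalIdeal (X.presheaf.stalk a) := fun j =>
    le_maximalIdeal (Ideal.IsPrime.ne_top (I := primeAt j.2.1) inferInstance) (by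
      rw [hg]
      exact Ideal.mem_sup_right (Ideal.mem_span_singleton_self _))
  have hm := idealAt_supp_part_eq hD M hg
  have hi : ∀ C' : Comps a, C' ≠ M →
      idealAt (supp (part C'.1 D)) a = compIdeal C' ⊔ Ideal.span {∏ l, ρ (v l)} := by
    intro C' hC'
    rw [idealAt_supp_eq, iInf_primeAt_eq (hc.isPrime_sup_span hy.indep C'),
      hc.iInf_sup_span hy.indep]
    · rfl
    · intro η hη
      rw [← hbr C' (hne hC') η hη, Set.mem_ofPred_eq, part_ne_zero_iff]
  have hgI : ∀ C' ≠ M, compIdeal M ⊔ Ideal.span {∏ j, g j} ⊔ compIdeal C' =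
      compIdeal M ⊔ compIdeal C' ⊔ Ideal.span {∏ l, ρ (v l)} := by
    intro C' hC'
    obtain ⟨i, hiC⟩ : C'.1 ∈ Set.range C := by rw [hC]; exact C'.2.1
    have h1 := obstructionIdeal_eq_top_iff.1 hJ
    have h2 := h1 i (Fin.last n)
    have h3 := h1 (Fin.last n) i
    rw [hiC, hi C' hC'] at h2 h3
    change idealAt (supp (part M.1 D)) a ⊔ _ ≤ _ ⊔ compIdeal M at h2
    change _ ⊔ compIdeal M ≤ idealAt (supp (part M.1 D)) a ⊔ _ at h3
    rw [hm] at h2 h3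
    rw [sup_comm (compIdeal M) (compIdeal C'), sup_right_comm (compIdeal C')]
    exact le_antisymm h2 h3
  have hb : ∀ C', ∃ k, b k = C' := by
    intro C'
    obtain ⟨C'', hC''⟩ : ∃ C'' : Comps a, C'' ≠ C' := by
      by_cases h1 : C' = M
      · exact ⟨M₀, h1 ▸ hM₀⟩
      · exact ⟨M, Ne.symm h1⟩
    exact hc.exists_block (i := C') (i' := C'') fun hle => hC''
      (Subtype.ext (eq_of_idealAt_le C''.2.1 C'.2.1 C''.2.2 hle))
  have hrel : relevant C D a = {i | a ∈ C i} := by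
    refine (relevant_subset hC ha).antisymm fun i hi => ?_
    by_cases h1 : i = Fin.last n
    · exact Or.inl h1
    obtain ⟨η, hη, hp⟩ := h.exists_primeAt hy.indep ⟨C i, hmem i, hi⟩ j₀
    have h2 := (hbr ⟨C i, hmem i, hi⟩ (fun h2 => h1 (hCinj h2)) η hη).2 ⟨_, hp⟩
    exact Or.inr ⟨η, hη, h2.1, h2.2⟩
  obtain ⟨-, -, ⟨φ, hφ⟩, he, hq⟩ := hS
  let E : relevant C D a ≃ Comps a := (Equiv.setCongr hrel).trans (compEquiv hCinj hC a)
  rw [hrel, idealAt_iUnion_eq_iInf hCinj hC, hc.embDim_iInf hM₀] at he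
  -- Block size and `c j` are both the difference between `e` and the dimension of the component.
  have hcj : ∀ j, Nat.card {k // b k = (φ.trans E) j} = c j := fun j => by
    have h1 := hc.ringKrullDim_quotient ((φ.trans E) j)
    rw [← he] at h1
    exact natCast_eq_of_add_eq h1 (hφ j)
  have hcount : ∀ C' : Comps a, C' ≠ M →
      {η : X | η ⤳ a ∧ D η ≠ 0 ∧ η ∈ C'.1}.ncard = Fintype.card ι := fun C' hC' =>
    ncard_branches (S := {η | D η ≠ 0 ∧ η ∈ C'.1}) (hc.isPrime_sup_span hy.indep C')
      (fun _ _ h1 => hy.indep.eq_of_sup_span_eq (le_iSup _ C') (le_iSup _ C') h1)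
      (hbr C' (hne hC'))
  have hcountM : {η : X | η ⤳ a ∧ D η ≠ 0 ∧ η ∈ C (Fin.last n)}.ncard =
      Fintype.card {η : X | η ⤳ a ∧ D η ≠ 0 ∧ η ∈ M.1} := by
    rw [← Nat.card_eq_fintype_card, Nat.card_coe_set_eq]
  -- All components other than the last have the number of branches prescribed by the 4-tuple, so
  -- only two numbers compete for the minimum.
  have hqmin : q = min (Fintype.card ι) (Fintype.card {η : X | η ⤳ a ∧ D η ≠ 0 ∧ η ∈ M.1}) := by
    refine le_antisymm (le_min ?_ ?_) ?_
    · exact (hq.2 ⟨i₀.castSucc, Or.inr ⟨η₀, hη₀, hD₀, hη₀C⟩, rfl⟩).trans_eq (hcount M₀ hM₀)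
    · exact (hq.2 ⟨Fin.last n, Or.inl rfl, rfl⟩).trans_eq hcountM
    · obtain ⟨i, hi, rfl⟩ := hq.1
      by_cases h1 : i = Fin.last n
      · subst h1
        exact (min_le_right _ _).trans_eq hcountM.symm
      · rw [hrel] at hi
        exact (min_le_left _ _).trans_eq (hcount ⟨C i, hmem i, hi⟩
          fun h2 => h1 (hCinj (congrArg Subtype.val h2))).symm
  have hle : ∀ T : Set X, idealAt (supp D) a ≤ idealAt (supp (part T D)) a := fun T => by
    rw [idealAt_supp_eq, idealAt_supp_eq]
    exact le_iInf fun η => le_iInf fun hη => le_iInf fun h1 =>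
      idealAt_le_primeAt (part_ne_zero_iff.1 hη).1 h1
  have hcard := hc.card_eq_of_hilbertSamuel K hb M M₀ hM₀ g hgm (hgI M₀ hM₀) (idealAt (supp D) a)
    (fun C' hC' => (hle C'.1).trans_eq (hi C' hC')) ((hle M.1).trans_eq hm) (φ.trans E) c hcj e
    (by rw [he, Fintype.card_sum]) (by rw [hHS, hqmin])
  obtain ⟨σ, z, hσ, hz, hσz⟩ := hc.exists_matching M M₀ hM₀ g hgm hgI hcard
  -- As `D` is reduced, every matched equation has coefficient `1` on each component.
  refine IsSncDivisor.stableSncAt (y := z) (α := fun _ => 1) h ⟨hz, fun C' l η hη hp => ?_,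
    fun η hη h1 => ?_⟩
  · refine hred η ?_
    by_cases hC' : C' = M
    · subst hC'
      obtain rfl := eq_of_primeAt_eq _ _ ((hp.trans (hσz l).1).trans (hg (σ l)).symm)
      exact (σ l).2.2.1
    · exact ((hbr C' (hne hC') η hη).2 ⟨l, hp.trans ((hσz l).2 C' hC')⟩).1
  · have h2 := irreducibleComponent_mem_irreducibleComponents η
    let C' : Comps a := ⟨irreducibleComponent η, h2,
      hη.mem_closed (isClosed_of_mem_irreducibleComponents _ h2) mem_irreducibleComponent⟩
    have h3 : η ∈ C'.1 := mem_irreducibleComponent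
    by_cases hC' : C' = M
    · obtain ⟨l, hl⟩ := hσ.2 ⟨η, hη, h1, hC' ▸ h3⟩
      refine ⟨M, l, ?_⟩
      rw [(hσz l).1, hl]
      exact hg ⟨η, hη, h1, hC' ▸ h3⟩
    · obtain ⟨l, hl⟩ := (hbr C' (hne hC') η hη).1 ⟨h1, h3⟩
      exact ⟨C', l, hl.trans ((hσz l).2 C' hC').symm⟩

end Converse

end StableSnc

theorem mainTheorem6 {K : Type u} [Field K] [CharZero K] {X : Scheme.{u}}
    (f : X ⟶ Spec (.of K)) [LocallyOfFiniteType f] [QuasiCompact f] [IsSeparated f] [IsReduced X]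
    (n : ℕ) (hn : 1 ≤ n)
    (C : Fin (n + 1) → Set X) (hCinj : Function.Injective C)
    (hC : Set.range C = irreducibleComponents X)
    (D : X → ℚ) (hD : StableSnc.IsWeilDivisorOn Set.univ D)
    (E : StableSnc.OrderedSncDivisor f)
    (a : X) (ha : IsClosed ({a} : Set X))
    (haInit : a ∈ StableSnc.initUnion C) (haLast : a ∈ C (Fin.last n)) :
    (StableSnc.StableSncAt f E.toDivisor a →
      (∀ η : X, η ⤳ a → D η ≠ 0 → η ∉ E.support) →
      (StableSnc.TripleStableSncAt f D E.toDivisor a ↔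
        StableSnc.FourTupleStableSncAt f (StableSnc.initUnion C) (StableSnc.initDivisor C D)
          E.toDivisor (C (Fin.last n)) a ∧
        StableSnc.StableSncAt f D a)) ∧
    ((∀ η : X, D η ≠ 0 → D η = 1) →
      (∀ η : X, D η ≠ 0 → η ∉ StableSnc.singLocus X) →
      (∃ η : X, η ⤳ a ∧ D η ≠ 0 ∧ η ∈ C (Fin.last n)) →
      (∃ i : Fin n, ∃ η : X, η ⤳ a ∧ D η ≠ 0 ∧ η ∈ C i.castSucc) →
      (StableSnc.StableSncAt f D a ↔
        StableSnc.FourTupleStableSncAt f (StableSnc.initUnion C) (StableSnc.initDivisor C D)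
          0 (C (Fin.last n)) a ∧
        (∃ (e N : ℕ) (c : Fin N → ℕ) (q : ℕ),
          ∑ i, c i + q ≤ e ∧
          StableSnc.MemStratum C D e c q a ∧
          StableSnc.hilbertSamuel (StableSnc.idealAt (StableSnc.supp D) a) =
            StableSnc.hilbertSamuel (StableSnc.modelIdeal K e c q)) ∧
        StableSnc.obstructionIdeal C D a = ⊤)) := by
  classical
  refine ⟨fun hE hsupp => ?_, fun hred hsing hlast hinit => ?_⟩
  · have h0 : ∀ η, η ⤳ a → D η ≠ 0 → E.toDivisor η = 0 := fun η h hη =>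
      E.toDivisor_eq_zero (hsupp η h hη)
    exact ⟨fun h => ⟨StableSnc.StableSncAt.fourTuple hCinj hC hD h h0, h.of_add hE h0⟩,
      fun h => StableSnc.StableSncAt.add_of_fourTuple hCinj hC haInit h.2 hE h0 h.1⟩
  · constructor
    · intro h
      refine ⟨StableSnc.StableSncAt.fourTuple hCinj hC hD (by rwa [add_zero]) fun _ _ _ => rfl,
        ?_, ?_⟩
      · obtain ⟨ι, _, y, α, hα, hy⟩ := h.exists_isSncDivisor
        -- A branch of `D` through `a` makes the family of equations nonempty; every component
        -- through `a` is then relevant.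
        obtain ⟨η, hη, hDη, -⟩ := hlast
        obtain ⟨-, j, -⟩ := hy.exists_eq η hη hDη
        have : Nonempty ι := ⟨j⟩
        obtain ⟨i, hi⟩ := Set.mem_iUnion.1 haInit
        exact hy.exists_memStratum hCinj hC haLast (Fin.castSucc_lt_last i).ne hi h.zero hα
      · obtain ⟨ι, _, y, α, hα, hy⟩ := h.exists_isSncDivisor
        exact hy.obstructionIdeal_eq_top hC h.zero hα
    · rintro ⟨h4, ⟨e, N, c, q, -, hS, hHS⟩, hJ⟩
      exact StableSnc.stableSncAt_of_fourTuple hCinj hC hD haLast hred hsing hinit h4 hS hHS hJ
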